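/- **Setting.** Let $\mathcal X_0$ be a real Hilbert space, $\mathcal X\subset\mathcal X_0$ convex, and consider $\min_{x\in\mathcal X}F(x)$, $F=f+\psi$, $f=\frac1n\sum_{i=1}^n f_i$, where $f_i:\mathcal X_0\to\mathbb R$ is differentiable at the points of $\mathcal X$, $\psi$ is convex on $\mathcal X$, and $x^*\in\mathcal X$ is a minimizer of $F$ over $\mathcal X$. Let $w$ be differentiable at the points of $\mathcal X$, and write $D_h(x,y)=h(x)-h(y)-\langle\nabla h(y),x-y\rangle$ and $G^*(x)=\sup_y\langle x,y\rangle-G(y)$. Let $g:[0,\infty)\to[0,\infty)$ be increasing with $g(t)>0$ for $t>0$ (i.e. $g^{-1}(s)\to0$ as $s\to0$), and $C_G>0$. A function $G:\mathcal X_0\to[0,\infty)$ is a *CHEF with parameters $(g,C_G)$* if $G$ is convex, $G(0)=0$, $G(-x)=G(x)$; $G(\lambda x)\ge\lambda g(\lambda)G(x)$ for all $x$ and $\lambda>0$; and $\mathbb E\,G^*(\sum_jZ_j)\le C_G\sum_j\mathbb E\,G^*(Z_j)$ for all finite families of independent mean-zero random vectors $Z_j$ (the *generalized Nemirovsky inequality*).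 Assume, for a CHEF $G$, some $L>0$ and $0\le\mu\le L$: * (B1) $D_w(x,y)\ge G(x-y)$ for $x,y\in\mathcal X$; * (B2) $0\le D_{f_i}(x,y)\le L\,G(x-y)$ for all $i$, $x\in\mathcal X_0$, $y\in\mathcal X$; * (B3) $F(x)-F(x^*)\ge\mu D_w(x^*,x)$ for $x\in\mathcal X$. **Algorithm (mirror-proximal SCSG).** Start from a random $\tilde x_0\in\mathcal X$. In epoch $j=1,2,\dots$ draw a uniform $\mathcal I_j\subset\{1,\dots,n\}$ of size $B_j$, put $x_0=\tilde x_{j-1}$, and draw $N_j$ with $P(N_j=k)=(1-\gamma_j)\gamma_j^k$, $\gamma_j=\frac{m_j}{m_j+b}$; for $k=1,\dots,N_j$ draw a uniform $\tilde{\mathcal I}$ of size $b$, put $\nu=\nabla f_{\tilde{\mathcal I}}(x_{k-1})-\nabla f_{\tilde{\mathcal I}}(x_0)+\nabla f_{\mathcal I_j}(x_0)$ (where $\nabla f_{\mathcal I}=|\mathcal I|^{-1}\sum_{i\in\mathcal I}\nabla f_i$) and $x_k\in\operatorname{argmin}_{y\in\mathcal X}\langle\nu,y\rangle+\psi(y)+\frac1\eta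 D_w(y,x_{k-1})$ (the minimizers are assumed to exist and are selected by a fixed function of $(\nu,x_{k-1})$); then $\tilde x_j=x_{N_j}$. All draws are independent of each other and of $\tilde x_0$. The parameters are, for constants $\alpha>1$, $\xi\in(0,1)$, $m_0>0$ and an integer $1\le b\le n$, $$m_j=m_0\alpha^j,\qquad B_j=\lceil\beta(j)\rceil\wedge n,\qquad \beta(\tau)=\tfrac{5\alpha^{1/\xi}}2\,g\Big(\tfrac1{12C_G\alpha^{1/\xi}}\Big)\frac{m_0\alpha^\tau}{g(1/(m_0\alpha^\tau))},$$ with $m_0\ge4\alpha^{1/\xi}\max\{b,4C_G\}$ and $0<6\eta L\le\min\{1,\ g(\tfrac1{12C_G\alpha^{1/\xi}})\,b\}$. **Quantities.** $T(\epsilon)=\min\{T':\mathbb E(F(\tilde x_T)-F(x^*))\le\epsilon\ \ \forall T\ge T'\}$ and $C_{\rm comp}(\epsilon)=\sum_{j=1}^{T(\epsilon)}(bN_j+B_j)$. Let $D_x=L\,\mathbb E D_w(x^*,\tilde x_0)$, $D_F=\mathbb E[F(\tilde x_0)-F(x^*)]$, $D_H=\frac Ln\sum_iG^*\big(\frac{\nabla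 f_i(x^*)-\nabla f(x^*)}L\big)$, all assumed finite, and $D=\max\{D_x,D_H,D_F\}$. Let $\kappa=L/\mu$, let $T_n^*=\inf\{\tau\ge0:\beta(\tau)\ge n\}$, $\tilde\kappa=\alpha^{T_n^*}+\kappa$, and $(a)_*^\xi=\max\{a,1\}^\xi$. **Theorem.** There is a constant $K>0$, depending only on $\alpha,\xi,m_0,b,\eta L,C_G$ and $g$, such that for every such problem and every $\epsilon>0$ the time $T(\epsilon)$ exists, and with $$A(\epsilon)=K(1+\log n)\,\max\Big\{1,\ \min\Big\{\frac D\epsilon,\ \kappa\Big(\frac{D_x+D_F}{\epsilon\kappa}\Big)_*^{\xi}+\frac{D_H}\epsilon,\ \tilde\kappa\Big(\frac D{\epsilon\tilde\kappa}\Big)_*^{\xi}\Big\}\Big\}$$ (for $\mu=0$ the last two terms of the minimum are $+\infty$) one has $$\mathbb E\,C_{\rm comp}(\epsilon)\le K\Big(\frac{A(\epsilon)}{g(1/A(\epsilon))}\wedge\big(A(\epsilon)+n\log A(\epsilon)\big)\Big).$$ In particular, in the uniformly convex case $G(x)=\frac1q\|x\|^q$, $q>1$, for a (semi)norm $\|\cdot\|$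 on $\mathcal X_0$ such that $G$ satisfies the generalized Nemirovsky inequality with constant $C_G$, and with $g(\lambda)=\lambda^{q-1}$, there is such a $K$ with $$\mathbb E\,C_{\rm comp}(\epsilon)\le K\Big(A(\epsilon)^q\wedge\big(A(\epsilon)+n\log A(\epsilon)\big)\Big).$$ -/

import Mathlib

open MeasureTheory ProbabilityTheory
open scoped ENNReal

universe u v

namespace MirrorSCSG

noncomputable section

/-! ### Convex conjugates, Bregman divergences, CHEFs -/

/-- The convex conjugate `G*(x) = sup_y (⟨x, y⟩ - G y)`, with values in `[-∞, ∞]`. -/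
def convexConj {E : Type u} [NormedAddCommGroup E] [InnerProductSpace ℝ E]
    (G : E → ℝ) (x : E) : EReal :=
  ⨆ y : E, ((inner ℝ x y - G y : ℝ) : EReal)

/-- The Bregman divergence `D_h(x, y) = h x - h y - ⟨∇h y, x - y⟩`. -/
def bregman {E : Type u} [NormedAddCommGroup E] [InnerProductSpace ℝ E] [CompleteSpace E]
    (h : E → ℝ) (x y : E) : ℝ :=
  h x - h y - inner ℝ (gradient h y) (x - y)

/-- The generalized Nemirovsky inequality for `G*`: for independent mean-zero random vectors
`Z₁, …, Z_m`, one has `𝔼 G*(∑ Z_j) ≤ C_G ∑ 𝔼 G*(Z_j)`. It is only used for `G ≥ 0 = G 0`, where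
`G* ≥ 0`, so that the expectations are integrals of `[0, ∞]`-valued functions. -/
def GeneralizedNemirovsky {E : Type u} [NormedAddCommGroup E] [InnerProductSpace ℝ E]
    [MeasurableSpace E] (CG : ℝ) (G : E → ℝ) : Prop :=
  ∀ (Ω : Type) [MeasurableSpace Ω] (P : Measure Ω) [IsProbabilityMeasure P]
    (m : ℕ) (Z : Fin m → Ω → E),
    iIndepFun Z P → (∀ j, Integrable (Z j) P) → (∀ j, ∫ ω, Z j ω ∂P = 0) →
      ∫⁻ ω, (convexConj G (∑ j, Z j ω)).toENNReal ∂P ≤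
        ENNReal.ofReal CG * ∑ j, ∫⁻ ω, (convexConj G (Z j ω)).toENNReal ∂P

/-- `G` is a convex sup-homogeneous envelope function with parameters `(g, C_G)`.
The function `g : [0, ∞) → [0, ∞)` is increasing (only the values on `[0, ∞)` matter),
and `g_pos` says that its generalized inverse `s ↦ inf {t | s ≤ g t}` tends to `0` at `0`. -/
structure IsCHEF {E : Type u} [NormedAddCommGroup E] [InnerProductSpace ℝ E]
    [MeasurableSpace E] (g : ℝ → ℝ) (CG : ℝ) (G : E → ℝ) : Prop where
  g_nonneg : ∀ t, 0 ≤ t → 0 ≤ g t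
  g_mono : MonotoneOn g (Set.Ici 0)
  g_pos : ∀ t, 0 < t → 0 < g t
  nonneg : ∀ x, 0 ≤ G x
  zero : G 0 = 0
  convex : ConvexOn ℝ Set.univ G
  symm : ∀ x, G (-x) = G x
  sup_homogeneous : ∀ (x : E) (r : ℝ), 0 < r → r * g r * G x ≤ G (r • x)
  nemirovsky : GeneralizedNemirovsky CG G

/-! ### Composite finite-sum problems -/

/-- The data of the problem `min_{x ∈ X} F x`, `F = (1/n) ∑ f_i + ψ`, together with a
distance-generating function `w`. -/
structure CompositeProblem (E : Type u) (n : ℕ) where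
  X : Set E
  f : Fin n → E → ℝ
  ψ : E → ℝ
  w : E → ℝ

namespace CompositeProblem

variable {E : Type u} {n : ℕ}

/-- The objective `F = (1/n) ∑ f_i + ψ`. -/
def F (p : CompositeProblem E n) (x : E) : ℝ := (n : ℝ)⁻¹ * ∑ i, p.f i x + p.ψ x

/-- `D_F = 𝔼 (F(x̃₀) - F(x*))`. -/
def DF (p : CompositeProblem E n) {Ω : Type v} [MeasurableSpace Ω] (xs : E) (P : Measure Ω)
    (x₀ : Ω → E) : ℝ :=
  ∫ ω, (p.F (x₀ ω) - p.F xs) ∂P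

variable [NormedAddCommGroup E] [InnerProductSpace ℝ E] [CompleteSpace E]

/-- The batch gradient `∇f_I(x) = |I|⁻¹ ∑_{i ∈ I} ∇f_i(x)`. -/
def batchGrad (p : CompositeProblem E n) (I : Finset (Fin n)) (x : E) : E :=
  (I.card : ℝ)⁻¹ • ∑ i ∈ I, gradient (p.f i) x

/-- The full gradient `∇f(x)` of `f = (1/n) ∑ f_i`. -/
def fullGrad (p : CompositeProblem E n) (x : E) : E := p.batchGrad Finset.univ x

/-- The variance-reduced gradient `ν = ∇f_I(x) - ∇f_I(x₀) + ∇f_J(x₀)`. -/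
def vrGrad (p : CompositeProblem E n) (J I : Finset (Fin n)) (x₀ x : E) : E :=
  p.batchGrad I x - p.batchGrad I x₀ + p.batchGrad J x₀

/-- The assumptions on the problem: convexity of `X` and `ψ`, differentiability of the `f_i` and
of `w`, optimality of `xs`, and the conditions B1, B2, B3. Convexity of the `f_i` is the lower
bound in `B2`, and convexity of `w` on `X` is contained in `B1`. In `B2` the functions `f_i` live on
the whole Hilbert space, and the first argument of the divergence ranges over it. -/
structure Assumptions (p : CompositeProblem E n) (G : E → ℝ) (L μ : ℝ) (xs : E) : Prop where
  convex_X : Convex ℝ p.X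
  convex_ψ : ConvexOn ℝ p.X p.ψ
  diff_f : ∀ i, ∀ x ∈ p.X, DifferentiableAt ℝ (p.f i) x
  diff_w : ∀ x ∈ p.X, DifferentiableAt ℝ p.w x
  mem : xs ∈ p.X
  isMin : IsMinOn p.F p.X xs
  L_pos : 0 < L
  μ_nonneg : 0 ≤ μ
  μ_le : μ ≤ L
  B1 : ∀ x ∈ p.X, ∀ y ∈ p.X, G (x - y) ≤ bregman p.w x y
  B2 : ∀ i, ∀ x : E, ∀ y ∈ p.X, 0 ≤ bregman (p.f i) x y ∧ bregman (p.f i) x y ≤ L * G (x - y)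
  B3 : ∀ x ∈ p.X, μ * bregman p.w xs x ≤ p.F x - p.F xs

/-- `prox ν x` is a point of `argmin_{y ∈ X} (⟨ν, y⟩ + ψ y + η⁻¹ D_w(y, x))`, for every
variance-reduced gradient `ν` that can occur with mini-batches of size `b`. Ties are broken by a
fixed function of `(ν, x)`. -/
def IsProxMap (p : CompositeProblem E n) (b : ℕ) (η : ℝ) (prox : E → E → E) : Prop :=
  ∀ x₀ ∈ p.X, ∀ x ∈ p.X, ∀ J I : Finset (Fin n), J.Nonempty → I.card = b →
    prox (p.vrGrad J I x₀ x) x ∈ p.X ∧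
      IsMinOn (fun y => inner ℝ (p.vrGrad J I x₀ x) y + p.ψ y + η⁻¹ * bregman p.w y x) p.X
        (prox (p.vrGrad J I x₀ x) x)

/-- The vector `(∇f_i(x*) - ∇f(x*)) / L`. -/
def gradDev (p : CompositeProblem E n) (L : ℝ) (xs : E) (i : Fin n) : E :=
  L⁻¹ • (gradient (p.f i) xs - p.fullGrad xs)

/-- `D_H = (L/n) ∑ G*((∇f_i(x*) - ∇f(x*)) / L)`; used when all the summands are finite. -/
def DH (p : CompositeProblem E n) (G : E → ℝ) (L : ℝ) (xs : E) : ℝ :=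
  L / n * ∑ i, (convexConj G (p.gradDev L xs i)).toReal

variable {Ω : Type v} [MeasurableSpace Ω]

/-- `D_x = L 𝔼 D_w(x*, x̃₀)`. -/
def Dx (p : CompositeProblem E n) (L : ℝ) (xs : E) (P : Measure Ω) (x₀ : Ω → E) : ℝ :=
  L * ∫ ω, bregman p.w xs (x₀ ω) ∂P

/-- The initial iterate: a random point of `X` for which `D_x` and `D_F` are finite. -/
structure IsInitial (p : CompositeProblem E n) (xs : E) (P : Measure Ω) (x₀ : Ω → E) : Prop where
  mem : ∀ᵐ ω ∂P, x₀ ω ∈ p.X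
  integrable_w : Integrable (fun ω => bregman p.w xs (x₀ ω)) P
  integrable_F : Integrable (fun ω => p.F (x₀ ω) - p.F xs) P

end CompositeProblem

/-! ### Tuning parameters -/

/-- The tuning constants: `θ` is the product `η L`. -/
structure Tuning where
  α : ℝ
  ξ : ℝ
  m₀ : ℝ
  θ : ℝ
  CG : ℝ
  b : ℕ
  g : ℝ → ℝ

namespace Tuning

/-- The constant `g(1 / (12 C_G α^{1/ξ}))`. -/
def g₀ (t : Tuning) : ℝ := t.g (1 / (12 * t.CG * t.α ^ (1 / t.ξ)))

/-- `1 < α`, `0 < ξ < 1`, `m₀ ≥ 4 α^{1/ξ} max {b, 4 C_G}` and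
`6 η L ≤ min {1, g(1 / (12 C_G α^{1/ξ})) b}`. -/
structure Admissible (t : Tuning) : Prop where
  α_gt : 1 < t.α
  ξ_pos : 0 < t.ξ
  ξ_lt : t.ξ < 1
  CG_pos : 0 < t.CG
  b_pos : 0 < t.b
  θ_pos : 0 < t.θ
  m₀_ge : 4 * t.α ^ (1 / t.ξ) * max (t.b : ℝ) (4 * t.CG) ≤ t.m₀
  θ_le : 6 * t.θ ≤ min 1 (t.g₀ * t.b)

/-- The inner loop size `m₀ α^τ`, for a real epoch index `τ`. -/
def m (t : Tuning) (τ : ℝ) : ℝ := t.m₀ * t.α ^ τ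

/-- The untruncated batch size `(5 α^{1/ξ} / 2) g(1 / (12 C_G α^{1/ξ})) m / g(1 / m)` at
`m = m₀ α^τ`, for a real epoch index `τ`. -/
def rawBatch (t : Tuning) (τ : ℝ) : ℝ :=
  5 * t.α ^ (1 / t.ξ) / 2 * t.g₀ * (t.m τ / t.g (1 / t.m τ))

/-- The batch size `B_j = ⌈rawBatch j⌉ ∧ n`. -/
def B (t : Tuning) (n j : ℕ) : ℕ := min ⌈t.rawBatch j⌉₊ n

/-- `T_n*`, the nonnegative real number at which the untruncated batch size reaches `n`
(and `0` if it is at least `n` from the beginning). -/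
def Tn (t : Tuning) (n : ℕ) : ℝ := sInf {τ : ℝ | 0 ≤ τ ∧ (n : ℝ) ≤ t.rawBatch τ}

end Tuning

/-! ### The algorithm -/

/-- The law of a uniform random subset of `{1, …, n}` of size `k` (for `k ≤ n`). -/
def uniformBatch (n k : ℕ) : PMF (Finset (Fin n)) :=
  PMF.uniformOfFinset (Finset.powersetCard (min k n) Finset.univ)
    (Finset.powersetCard_nonempty.2 (by simp))

theorem geom_hasSum {γ : ℝ} (h : 0 ≤ γ ∧ γ < 1) :
    HasSum (fun k : ℕ => ENNReal.ofReal ((1 - γ) * γ ^ k)) 1 := by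
  have h1 : (1 - γ) ≠ 0 := by linarith [h.2]
  have hs : HasSum (fun k : ℕ => (1 - γ) * γ ^ k) 1 := by
    have := (hasSum_geometric_of_lt_one h.1 h.2).mul_left (1 - γ)
    rwa [mul_inv_cancel₀ h1] at this
  have hn : ∀ k : ℕ, 0 ≤ (1 - γ) * γ ^ k := fun k =>
    mul_nonneg (by linarith [h.2]) (pow_nonneg h.1 k)
  have := ENNReal.ofReal_tsum_of_nonneg hn hs.summable
  rw [hs.tsum_eq, ENNReal.ofReal_one] at this
  rw [this]
  exact ENNReal.summable.hasSum

/-- The geometric law `P(N = k) = (1 - γ) γ^k`, `k = 0, 1, …`, for `0 ≤ γ < 1`. -/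
def geomLaw (γ : ℝ) : PMF ℕ :=
  open Classical in
  if h : 0 ≤ γ ∧ γ < 1 then ⟨fun k => ENNReal.ofReal ((1 - γ) * γ ^ k), geom_hasSum h⟩
  else PMF.pure 0

/-- The expectation of a `[0, ∞]`-valued function under a discrete law. -/
def expect {β : Type u} (p : PMF β) (φ : β → ℝ≥0∞) : ℝ≥0∞ := ∑' a, p a * φ a

section Algorithm

variable {E : Type u} [NormedAddCommGroup E] [InnerProductSpace ℝ E] [CompleteSpace E] {n : ℕ}

/-- The law of the inner iterate `x_k`, given the starting point `x₀` and the batch `J` of the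
epoch: every step draws a fresh uniform mini-batch `I` of size `b` and moves from `x` to
`prox ν x`, where `ν = ∇f_I(x) - ∇f_I(x₀) + ∇f_J(x₀)`. -/
def innerLoop (p : CompositeProblem E n) (prox : E → E → E) (b : ℕ) (J : Finset (Fin n))
    (x₀ : E) : ℕ → PMF E
  | 0 => PMF.pure x₀
  | k + 1 => (innerLoop p prox b J x₀ k).bind fun x =>
      (uniformBatch n b).map fun I => prox (p.vrGrad J I x₀ x) x

/-- One epoch from `x`: draw a batch `J` of size `B`, draw `N ∼ Geom(m / (m + b))`, perform `N`
inner steps. The result is the new iterate, with the cost `b N + B` of the epoch. -/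
def epoch (p : CompositeProblem E n) (prox : E → E → E) (b : ℕ) (m : ℝ) (B : ℕ) (x : E) :
    PMF (E × ℕ) :=
  (uniformBatch n B).bind fun J => (geomLaw (m / (m + b))).bind fun N =>
    (innerLoop p prox b J x N).map fun y => (y, b * N + B)

/-- The joint law of the iterate `x̃_T` and of the total cost `∑_{j ≤ T} (b N_j + B_j)` of the
first `T` epochs of mirror-proximal SCSG, started at the point `x`. -/
def run (t : Tuning) (p : CompositeProblem E n) (prox : E → E → E) (x : E) : ℕ → PMF (E × ℕ)
  | 0 => PMF.pure (x, 0)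
  | T + 1 => (run t p prox x T).bind fun s =>
      (epoch p prox t.b (t.m (T + 1 : ℕ)) (t.B n (T + 1)) s.1).map fun r => (r.1, s.2 + r.2)

variable {Ω : Type v} [MeasurableSpace Ω]

/-- The expected suboptimality `𝔼 (F(x̃_T) - F(x*))`, for the random initial point `x₀`. -/
def expectedGap (t : Tuning) (p : CompositeProblem E n) (prox : E → E → E) (xs : E)
    (P : Measure Ω) (x₀ : Ω → E) (T : ℕ) : ℝ≥0∞ :=
  ∫⁻ ω, expect (run t p prox (x₀ ω) T) (fun s => ENNReal.ofReal (p.F s.1 - p.F xs)) ∂P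

/-- The `T'` with `𝔼 (F(x̃_T) - F(x*)) ≤ ε` for all `T ≥ T'`; `T(ε)` is the least of them. -/
def accurateTimes (t : Tuning) (p : CompositeProblem E n) (prox : E → E → E) (xs : E)
    (P : Measure Ω) (x₀ : Ω → E) (ε : ℝ) : Set ℕ :=
  {T' | ∀ T, T' ≤ T → expectedGap t p prox xs P x₀ T ≤ ENNReal.ofReal ε}

/-- The expected complexity `𝔼 C_comp(ε) = 𝔼 ∑_{j ≤ T(ε)} (b N_j + B_j)`. -/
def expectedCost (t : Tuning) (p : CompositeProblem E n) (prox : E → E → E) (xs : E)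
    (P : Measure Ω) (x₀ : Ω → E) (ε : ℝ) : ℝ≥0∞ :=
  ∫⁻ ω, expect (run t p prox (x₀ ω) (sInf (accurateTimes t p prox xs P x₀ ε)))
    (fun s => (s.2 : ℝ≥0∞)) ∂P

/-! ### The complexity scale -/

/-- With `κ = L / μ`, `κ' = α^{T_n*} + κ`, `D = max {D_x, D_H, D_F}` and `(a)_* = max {a, 1}`:
`min {D/ε, κ ((D_x + D_F)/(ε κ))_*^ξ + D_H/ε, κ' (D/(ε κ'))_*^ξ}`.
For `μ = 0`, that is `κ = ∞`, the last two terms are infinite. -/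
def scale (t : Tuning) (n : ℕ) (L μ Dx DH DF ε : ℝ) : ℝ :=
  open Classical in
  let D := max Dx (max DH DF)
  let κ := L / μ
  let κ' := t.α ^ t.Tn n + κ
  if μ = 0 then D / ε
  else min (D / ε)
    (min (κ * max ((Dx + DF) / (ε * κ)) 1 ^ t.ξ + DH / ε) (κ' * max (D / (ε * κ')) 1 ^ t.ξ))

/-- `A(ε) = K (1 + log n) max {1, scale}`: the scale up to a constant and a logarithmic factor. -/
def A (t : Tuning) (K : ℝ) (p : CompositeProblem E n) (G : E → ℝ) (L μ : ℝ) (xs : E)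
    (P : Measure Ω) (x₀ : Ω → E) (ε : ℝ) : ℝ :=
  K * (1 + Real.log n) *
    max 1 (scale t n L μ (p.Dx L xs P x₀) (p.DH G L xs) (p.DF xs P x₀) ε)

end Algorithm

end

end MirrorSCSG

open MirrorSCSG

/-! Gradient noise is measured by the conjugate `G*` alone, and it enters through Fenchel–Young,
`⟨δ, v⟩ ≤ c G(v) + c G*(δ/c)`; by B1 the term `c G(v)` is absorbed by Bregman divergences of `w`.

Three facts control `G*`. Sup-homogeneity dualizes to `G*(g(r) z) ≤ r g(r) G*(z)`, so averaging many
gradients pays off (`conjE_smul_le_of_supHom`). The Nemirovsky inequality, given for independent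
vectors, passes to sampling without replacement by Hoeffding's comparison (`hoeffding_comparison`).
Finally B2 gives co-coercivity, `G*((∇f_i x - ∇f_i x*)/L) ≤ D_{f_i}(x, x*)/L`, and optimality of
`x*` bounds the mean of these divergences by the gap `F x - F x*`; what remains at `x*` is `D_H`.

Within an epoch `ν = ∇f(x) + δ + e`. The mini-batch noise `δ` is centred given `x`. The batch error
`e` is frozen for the whole epoch, hence not centred given later iterates. The inequality for the
comparison point `x*` is therefore added to `ω` times the one for `x₀`. The pairing of `e` with `z -
x₀` is paid for by `D_w(x₀, z)`, and the leftover `⟨e, x* - x₀⟩` has mean zero over the batch. The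
geometric law of `N` turns the step inequalities into a telescoping sum (`inner_sum_le`).

With the tuned parameters and `a = α^{1/ξ}`, an epoch gives (`tuned_epoch_le`) `h_j + (u/m_j) d_j ≤
a⁻¹ h_{j-1} + (u/m_j) d_{j-1} + (c_H/m_j) D_H · 1[B_j < n]`, where `h` is the expected gap and `d`
is `L` times the expected divergence to `x*`. Since `α ≤ a`, the potential `m_j h_j + u d_j` grows
only in truncated epochs, of which there are `O(1 + log n)`; this yields the term `D/ε`. By B3, `d ≤
κ h`; once `α^j ≥ κ` the divergence perturbs the factor `a⁻¹` only by a summable amount, so the gap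
contracts like `α^{-i/ξ}` while the cost grows like `α^i`, which produces the exponent `ξ`. Waiting
until `α^j ≥ α^{T_n*} + κ` also removes the noise of truncated epochs, which gives the third term.

The expected cost of `T` epochs is `∑ (m_j + B_j)`. With `m_T ≤ A`, the batches are bounded either
by multiples of `m_j / g(1/A)` plus one, or by `n` each over `O(log A)` epochs. -/

namespace MirrorSCSG

/-! ### The conjugate as a `[0, ∞]`-valued function -/

section Conjugate

variable {E : Type u} [NormedAddCommGroup E] [InnerProductSpace ℝ E] {G : E → ℝ}

/-- The conjugate `G*`, for `G ≥ 0 = G 0`, as a `[0, ∞]`-valued function. -/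
noncomputable def conjE (G : E → ℝ) (x : E) : ℝ≥0∞ := (convexConj G x).toENNReal

theorem ofReal_le_conjE (G : E → ℝ) (x y : E) :
    ENNReal.ofReal (inner ℝ x y - G y) ≤ conjE G x := by
  have h : ((inner ℝ x y - G y : ℝ) : EReal) ≤ convexConj G x :=
    le_iSup (fun y : E => ((inner ℝ x y - G y : ℝ) : EReal)) y
  have h2 := EReal.toENNReal_le_toENNReal h
  rwa [EReal.toENNReal_of_ne_top (EReal.coe_ne_top _), EReal.toReal_coe] at h2

theorem conjE_le {x : E} {c : ℝ≥0∞}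
    (h : ∀ y, ENNReal.ofReal (inner ℝ x y - G y) ≤ c) : conjE G x ≤ c := by
  have h1 : convexConj G x ≤ (c : EReal) := by
    refine iSup_le fun y => ?_
    have h2 : ((inner ℝ x y - G y : ℝ) : EReal)
        ≤ ((ENNReal.ofReal (inner ℝ x y - G y) : ℝ≥0∞) : EReal) := by
      rw [EReal.coe_ennreal_ofReal]
      exact_mod_cast le_max_left _ _
    exact h2.trans (by exact_mod_cast h y)
  simpa [conjE] using EReal.toENNReal_le_toENNReal h1

theorem conjE_ne_top {x : E} (h : convexConj G x ≠ ⊤) : conjE G x ≠ ⊤ := by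
  simpa [conjE] using h

theorem toReal_conjE (h0 : G 0 = 0) (x : E) : (conjE G x).toReal = (convexConj G x).toReal := by
  have h : 0 ≤ convexConj G x := by
    have := le_iSup (fun y : E => ((inner ℝ x y - G y : ℝ) : EReal)) 0
    rwa [inner_zero_right, h0, sub_zero] at this
  rw [conjE, ← EReal.toReal_coe_ennreal, EReal.coe_toENNReal h]

theorem conjE_neg (hs : ∀ x, G (-x) = G x) (x : E) : conjE G (-x) = conjE G x := by
  have key : ∀ x, conjE G (-x) ≤ conjE G x := fun x => conjE_le fun y => by
    have := ofReal_le_conjE G x (-y)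
    rwa [hs, inner_neg_right, ← inner_neg_left] at this
  exact le_antisymm (key x) (by simpa using key (-x))

theorem conjE_zero (hG : ∀ x, 0 ≤ G x) : conjE G 0 = 0 := by
  refine le_antisymm (conjE_le fun y => ?_) zero_le
  rw [inner_zero_left, ENNReal.ofReal_of_nonpos (by linarith [hG y])]

/-- This is Jensen's inequality for a supremum of affine functions. Total weight below one is
allowed because `G ≥ 0`: replacing `G y` by `(∑ c i) G y` only increases the bound. -/
theorem conjE_sum_le (hG : ∀ x, 0 ≤ G x) {ι : Type*} (s : Finset ι) (c : ι → ℝ) (z : ι → E)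
    (hc : ∀ i ∈ s, 0 ≤ c i) (hc1 : ∑ i ∈ s, c i ≤ 1) :
    conjE G (∑ i ∈ s, c i • z i) ≤ ∑ i ∈ s, ENNReal.ofReal (c i) * conjE G (z i) := by
  refine conjE_le fun y => ?_
  calc ENNReal.ofReal (inner ℝ (∑ i ∈ s, c i • z i) y - G y)
      ≤ ENNReal.ofReal (∑ i ∈ s, c i * (inner ℝ (z i) y - G y)) := by
        apply ENNReal.ofReal_le_ofReal
        simp only [sum_inner, real_inner_smul_left, mul_sub, Finset.sum_sub_distrib,
          ← Finset.sum_mul]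
        nlinarith [hG y]
    _ ≤ ∑ i ∈ s, ENNReal.ofReal (c i * (inner ℝ (z i) y - G y)) :=
        Finset.le_sum_of_subadditive _ ENNReal.ofReal_zero.le (fun _ _ => ENNReal.ofReal_add_le) _ _
    _ ≤ _ := Finset.sum_le_sum fun i hi => by
        rw [ENNReal.ofReal_mul (hc i hi)]
        gcongr
        exact ofReal_le_conjE G _ _

/-- The dual form of sup-homogeneity, obtained by substituting `r⁻¹ • y` in the supremum. It is
applied with `s = g r`. -/
theorem conjE_smul_le_of_supHom {r s : ℝ} (hr : 0 < r) (hs : 0 ≤ s)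
    (h : ∀ x, r * s * G x ≤ G (r • x)) (z : E) :
    conjE G (s • z) ≤ ENNReal.ofReal (r * s) * conjE G z := by
  refine conjE_le fun y => ?_
  have h1 := h (r⁻¹ • y)
  rw [smul_smul, mul_inv_cancel₀ hr.ne', one_smul] at h1
  calc ENNReal.ofReal (inner ℝ (s • z) y - G y)
      ≤ ENNReal.ofReal (r * s * (inner ℝ z (r⁻¹ • y) - G (r⁻¹ • y))) := by
        apply ENNReal.ofReal_le_ofReal
        rw [real_inner_smul_left, real_inner_smul_right]
        have : r * s * (r⁻¹ * inner ℝ z y) = s * inner ℝ z y := by field_simp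
        linarith
    _ ≤ _ := by
        rw [ENNReal.ofReal_mul (by positivity)]
        gcongr
        exact ofReal_le_conjE G _ _

/-- The Fenchel–Young inequality. -/
theorem inner_le_of_conjE_ne_top {z : E} (hz : conjE G z ≠ ⊤) (y : E) :
    inner ℝ z y ≤ G y + (conjE G z).toReal := by
  have h := (ENNReal.ofReal_le_iff_le_toReal hz).1 (ofReal_le_conjE G z y)
  linarith

theorem inner_le_of_conjE_smul_ne_top {z : E} {c : ℝ} (hc : 0 < c)
    (hz : conjE G (c⁻¹ • z) ≠ ⊤) (y : E) :
    inner ℝ z y ≤ c * G y + c * (conjE G (c⁻¹ • z)).toReal := by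
  have h := mul_le_mul_of_nonneg_left (inner_le_of_conjE_ne_top hz y) hc.le
  rwa [real_inner_smul_left, mul_inv_cancel_left₀ hc.ne', mul_add] at h

end Conjugate

/-! ### Sampling without replacement -/

section Hoeffding

variable {n k : ℕ}

/-- The number of `k`-subsets of `{1, …, n}` that contain all entries of `U`. -/
def supersetCount (U : Fin k → Fin n) : ℕ :=
  ((Finset.powersetCard k Finset.univ).filter fun J => ∀ j, U j ∈ J).card

/-- The conditional law of a `k`-subset given the with-replacement sample `U`: uniform on the
`k`-subsets that contain all entries of `U`. -/
noncomputable def coupling (U : Fin k → Fin n) (J : Finset (Fin n)) : ℝ :=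
  if J ∈ Finset.powersetCard k Finset.univ ∧ ∀ j, U j ∈ J then (supersetCount U : ℝ)⁻¹ else 0

theorem coupling_nonneg (U : Fin k → Fin n) (J : Finset (Fin n)) : 0 ≤ coupling U J := by
  unfold coupling; split_ifs <;> positivity

theorem sum_coupling (hkn : k ≤ n) (U : Fin k → Fin n) :
    ∑ J ∈ Finset.powersetCard k Finset.univ, coupling U J = 1 := by
  have h1 : ∀ J ∈ Finset.powersetCard k (Finset.univ : Finset (Fin n)),
      coupling U J = if ∀ j, U j ∈ J then (supersetCount U : ℝ)⁻¹ else 0 := fun J hJ => by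
    simp [coupling, hJ]
  rw [Finset.sum_congr rfl h1, ← Finset.sum_filter, Finset.sum_const, nsmul_eq_mul]
  refine mul_inv_cancel₀ ?_
  obtain ⟨J, hJ, hJk⟩ := Finset.exists_superset_card_eq
    (s := Finset.univ.image U) (n := k) (Finset.card_image_le.trans (by simp)) (by simpa using hkn)
  have : 0 < supersetCount U := Finset.card_pos.2 ⟨J, by
    rw [Finset.mem_filter, Finset.mem_powersetCard]
    exact ⟨⟨Finset.subset_univ _, hJk⟩, fun j => hJ (Finset.mem_image_of_mem U (Finset.mem_univ j))⟩⟩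
  exact_mod_cast this.ne'

theorem supersetCount_perm (σ : Equiv.Perm (Fin n)) (U : Fin k → Fin n) :
    supersetCount (σ ∘ U) = supersetCount U := by
  symm
  refine Finset.card_bij' (fun J _ => J.map σ.toEmbedding) (fun J _ => J.map σ.symm.toEmbedding)
    ?_ ?_ ?_ ?_
  · intro J hJ
    simpa [Finset.mem_powersetCard] using hJ
  · intro J hJ
    simpa [Finset.mem_powersetCard] using hJ
  · intro J _
    ext; simp
  · intro J _
    ext; simp

theorem coupling_perm (σ : Equiv.Perm (Fin n)) (U : Fin k → Fin n) (J : Finset (Fin n)) :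
    coupling (σ ∘ U) (J.map σ.toEmbedding) = coupling U J := by
  simp [coupling, supersetCount_perm, Finset.mem_powersetCard]

/-- A permutation of the indices carries `J` to `J'` and preserves the coupling, so the marginal law
of the subset is uniform. -/
theorem sum_coupling_eq {J J' : Finset (Fin n)} (h : J.card = J'.card) :
    ∑ U : Fin k → Fin n, coupling U J = ∑ U : Fin k → Fin n, coupling U J' := by
  let e : J ≃ J' := Finset.equivOfCardEq h
  let σ : Equiv.Perm (Fin n) := e.extendSubtype
  have hσ : J.map σ.toEmbedding = J' := by
    apply Finset.eq_of_subset_of_card_le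
    · intro x hx
      obtain ⟨y, hy, rfl⟩ := Finset.mem_map.1 hx
      exact e.extendSubtype_mem y hy
    · simp [h]
  rw [← hσ, ← Equiv.sum_comp (Equiv.arrowCongr (Equiv.refl (Fin k)) σ)
    (fun U => coupling U (J.map σ.toEmbedding))]
  refine Finset.sum_congr rfl fun U _ => ?_
  rw [← coupling_perm σ U J]
  rfl

theorem sum_coupling_fixed (hkn : k ≤ n) {J : Finset (Fin n)} (hJ : J.card = k) :
    (n.choose k : ℝ) * ∑ U : Fin k → Fin n, coupling U J = (n : ℝ) ^ k := by
  have h1 : ∑ J' ∈ Finset.powersetCard k Finset.univ, ∑ U : Fin k → Fin n, coupling U J'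
      = (n.choose k : ℝ) * ∑ U : Fin k → Fin n, coupling U J := by
    rw [Finset.sum_congr rfl fun J' hJ' => sum_coupling_eq
      ((Finset.mem_powersetCard.1 hJ').2.trans hJ.symm)]
    simp
  rw [← h1, Finset.sum_comm]
  simp [sum_coupling hkn]

/-- Given `J`, each coordinate of the with-replacement sample is uniform on `J`: the transposition
of two elements of `J` fixes `J` and exchanges the corresponding events. -/
theorem sum_coupling_coord {J : Finset (Fin n)} (hJ : J.card = k) (j : Fin k)
    {i : Fin n} (hi : i ∈ J) :
    k * (∑ U : Fin k → Fin n, if U j = i then coupling U J else 0)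
      = ∑ U : Fin k → Fin n, coupling U J := by
  have h1 : ∀ i' ∈ J, (∑ U : Fin k → Fin n, if U j = i' then coupling U J else 0)
      = ∑ U : Fin k → Fin n, if U j = i then coupling U J else 0 := by
    intro i' hi'
    let σ := Equiv.swap i i'
    have hσ : J.map σ.toEmbedding = J := by
      apply Finset.eq_of_subset_of_card_le
      · intro x hx
        obtain ⟨y, hy, rfl⟩ := Finset.mem_map.1 hx
        simp only [Equiv.coe_toEmbedding, σ, Equiv.swap_apply_def]
        split_ifs <;> assumption
      · simp
    rw [← Equiv.sum_comp (Equiv.arrowCongr (Equiv.refl (Fin k)) σ)]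
    refine Finset.sum_congr rfl fun U _ => ?_
    have h2 := coupling_perm σ U J
    rw [hσ] at h2
    have h3 : (Equiv.arrowCongr (Equiv.refl (Fin k)) σ) U = σ ∘ U := rfl
    rw [h3, h2]
    have h4 : (σ ∘ U) j = i' ↔ U j = i := by
      rw [Function.comp_apply, ← Equiv.eq_symm_apply]
      simp [σ]
    simp only [h4]
  have h5 : ∑ i' ∈ J, (∑ U : Fin k → Fin n, if U j = i' then coupling U J else 0)
      = ∑ U : Fin k → Fin n, coupling U J := by
    rw [Finset.sum_comm]
    refine Finset.sum_congr rfl fun U _ => ?_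
    rw [Finset.sum_ite_eq]
    split_ifs with h
    · rfl
    · exact (if_neg fun h' => h (h'.2 j)).symm
  rw [← h5, Finset.sum_congr rfl h1, Finset.sum_const, hJ, nsmul_eq_mul]

/-- Hoeffding's comparison: for a convex function, the average over samples without replacement is
at most the average over samples with replacement. -/
theorem hoeffding_comparison {E : Type u} [NormedAddCommGroup E] [InnerProductSpace ℝ E]
    {G : E → ℝ} (hG : ∀ x, 0 ≤ G x) (hk : 0 < k) (hkn : k ≤ n) (z : Fin n → E) :
    (n.choose k : ℝ≥0∞)⁻¹ * ∑ J ∈ Finset.powersetCard k Finset.univ, conjE G (∑ i ∈ J, z i)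
      ≤ ((n : ℝ≥0∞)⁻¹) ^ k * ∑ U : Fin k → Fin n, conjE G (∑ j, z (U j)) := by
  have hn : 0 < n := hk.trans_le hkn
  have hch : 0 < n.choose k := Nat.choose_pos hkn
  -- `A` is the mass that the coupling gives to each `k`-subset, so `A⁻¹ * coupling U J` is the
  -- conditional law of `U` given `J`.
  set A : ℝ := (n : ℝ) ^ k / n.choose k with hA
  have hApos : 0 < A := by positivity
  have hmass : ∀ J ∈ Finset.powersetCard k Finset.univ,
      ∑ U : Fin k → Fin n, coupling U J = A := fun J hJ => by
    rw [hA, ← sum_coupling_fixed hkn (Finset.mem_powersetCard.1 hJ).2]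
    field_simp
  -- The sum over `J` is the conditional mean of the with-replacement sum given `J`; Jensen then
  -- compares the two averages.
  have hmean : ∀ J ∈ Finset.powersetCard k Finset.univ,
      ∑ i ∈ J, z i = ∑ U : Fin k → Fin n, (A⁻¹ * coupling U J) • ∑ j, z (U j) := by
    intro J hJ
    have hJk := (Finset.mem_powersetCard.1 hJ).2
    have h1 : ∀ j : Fin k, ∑ U : Fin k → Fin n, coupling U J • z (U j)
        = ∑ i ∈ J, (A / k) • z i := by
      intro j
      have h2 : ∀ i ∈ J, (A / k) • z i
          = ∑ U : Fin k → Fin n, (if U j = i then coupling U J else 0) • z i := by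
        intro i hi
        rw [← Finset.sum_smul]
        congr 1
        rw [← hmass J hJ, ← sum_coupling_coord hJk j hi]
        field_simp
      rw [Finset.sum_congr rfl h2, Finset.sum_comm]
      refine Finset.sum_congr rfl fun U _ => ?_
      simp only [ite_smul, zero_smul]
      rw [Finset.sum_ite_eq]
      split_ifs with h
      · rfl
      · have : coupling U J = 0 := if_neg fun h' => h (h'.2 j)
        simp [this]
    simp only [mul_smul, Finset.smul_sum]
    rw [Finset.sum_comm]
    simp only [← Finset.smul_sum, h1]
    rw [Finset.sum_const, Finset.card_univ, Fintype.card_fin, ← Nat.cast_smul_eq_nsmul ℝ, smul_smul,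
      smul_smul]
    rw [show A⁻¹ * (A / k) * k = 1 by field_simp, one_smul]
  have hjensen : ∀ J ∈ Finset.powersetCard k Finset.univ, conjE G (∑ i ∈ J, z i)
      ≤ ∑ U : Fin k → Fin n, ENNReal.ofReal (A⁻¹ * coupling U J) * conjE G (∑ j, z (U j)) := by
    intro J hJ
    rw [hmean J hJ]
    refine conjE_sum_le hG _ _ _ (fun U _ => mul_nonneg (by positivity) (coupling_nonneg U J)) ?_
    rw [← Finset.mul_sum, hmass J hJ, inv_mul_cancel₀ hApos.ne']
  have hconst : (n.choose k : ℝ≥0∞)⁻¹ * ENNReal.ofReal A⁻¹ = ((n : ℝ≥0∞)⁻¹) ^ k := by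
    have h1 : (n.choose k : ℝ≥0∞)⁻¹ = ENNReal.ofReal ((n.choose k : ℝ)⁻¹) := by
      rw [ENNReal.ofReal_inv_of_pos (by positivity), ENNReal.ofReal_natCast]
    have h2 : (n : ℝ≥0∞)⁻¹ = ENNReal.ofReal ((n : ℝ)⁻¹) := by
      rw [ENNReal.ofReal_inv_of_pos (by positivity), ENNReal.ofReal_natCast]
    rw [h1, h2, ← ENNReal.ofReal_mul (by positivity), ← ENNReal.ofReal_pow (by positivity), hA]
    congr 1
    rw [inv_div, ← mul_div_assoc, inv_mul_cancel₀ (by positivity), inv_pow, one_div]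
  calc (n.choose k : ℝ≥0∞)⁻¹ * ∑ J ∈ Finset.powersetCard k Finset.univ, conjE G (∑ i ∈ J, z i)
      ≤ (n.choose k : ℝ≥0∞)⁻¹ * ∑ J ∈ Finset.powersetCard k Finset.univ, ∑ U : Fin k → Fin n,
          ENNReal.ofReal (A⁻¹ * coupling U J) * conjE G (∑ j, z (U j)) := by
        gcongr with J hJ
        exact hjensen J hJ
    _ = (n.choose k : ℝ≥0∞)⁻¹ * ∑ U : Fin k → Fin n,
          ENNReal.ofReal A⁻¹ * conjE G (∑ j, z (U j)) := by
        rw [Finset.sum_comm]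
        congr 1
        refine Finset.sum_congr rfl fun U _ => ?_
        rw [← Finset.sum_mul, ← ENNReal.ofReal_sum_of_nonneg
          (fun J _ => mul_nonneg (by positivity) (coupling_nonneg U J)), ← Finset.mul_sum,
          sum_coupling hkn, mul_one]
    _ = _ := by rw [← Finset.mul_sum, ← mul_assoc, hconst]

/-- The generalized Nemirovsky inequality for samples without replacement. -/
theorem GeneralizedNemirovsky.sampling {E : Type u} [NormedAddCommGroup E] [InnerProductSpace ℝ E]
    [CompleteSpace E] [MeasurableSpace E] [BorelSpace E] {G : E → ℝ} {CG : ℝ} (hN : GeneralizedNemirovsky CG G)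
    (hG : ∀ x, 0 ≤ G x) (hk : 0 < k) (hkn : k ≤ n) (z : Fin n → E) (hz : ∑ i, z i = 0) :
    (n.choose k : ℝ≥0∞)⁻¹ * ∑ J ∈ Finset.powersetCard k Finset.univ, conjE G (∑ i ∈ J, z i)
      ≤ ENNReal.ofReal CG * (k * ((n : ℝ≥0∞)⁻¹ * ∑ i, conjE G (z i))) := by
  have : Nonempty (Fin n) := ⟨⟨0, hk.trans_le hkn⟩⟩
  refine (hoeffding_comparison hG hk hkn z).trans ?_
  let ν : Measure (Fin n) := (PMF.uniformOfFintype (Fin n)).toMeasure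
  let μ : Measure (Fin k → Fin n) := Measure.pi fun _ => ν
  have hν : ∀ a, ν {a} = (n : ℝ≥0∞)⁻¹ := fun a => by
    simp [ν]
  have hμ : ∀ U, μ {U} = ((n : ℝ≥0∞)⁻¹) ^ k := fun U => by
    simp [μ, Measure.pi_singleton, hν]
  have hmz : Measurable z := measurable_of_countable z
  have hmp : ∀ j : Fin k, μ.map (fun U => U j) = ν := fun j =>
    (measurePreserving_eval (fun _ => ν) j).map_eq
  -- With-replacement sampling is realized on the finite product space, where the coordinates are
  -- independent and integrability is automatic.
  have h1 := hN (Fin k → Fin n) μ k (fun j U => z (U j))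
    (iIndepFun_pi (μ := fun _ => ν) (X := fun _ => z) fun _ => hmz.aemeasurable)
    (fun j => Integrable.of_finite)
    (fun j => by
      have h2 : ∫ U, z (U j) ∂μ = ∫ a, z a ∂ν := by
        rw [← hmp j, integral_map (measurable_pi_apply j).aemeasurable
          (Integrable.of_finite).aestronglyMeasurable]
      rw [h2, integral_fintype Integrable.of_finite]
      simp only [measureReal_def, hν, ← Finset.smul_sum, hz, smul_zero])
  have h3 : ∀ j : Fin k, ∫⁻ U, (convexConj G (z (U j))).toENNReal ∂μ
      = (n : ℝ≥0∞)⁻¹ * ∑ i, conjE G (z i) := fun j => by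
    rw [← lintegral_map (μ := μ) (f := fun a => (convexConj G (z a)).toENNReal)
      (measurable_of_countable _) (measurable_pi_apply j), hmp j, lintegral_fintype]
    simp only [hν, ← Finset.sum_mul, conjE]
    rw [mul_comm]
  simp only [h3, Finset.sum_const, Finset.card_univ, Fintype.card_fin, nsmul_eq_mul] at h1
  rw [lintegral_fintype] at h1
  simp only [hμ, ← Finset.sum_mul] at h1
  rw [mul_comm]
  exact h1

end Hoeffding

/-! ### Optimality conditions and Bregman divergences -/

section Optimality

variable {E : Type u} [NormedAddCommGroup E] [InnerProductSpace ℝ E] [CompleteSpace E]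

/-- First-order optimality for a sum of a differentiable and a convex function. -/
theorem inner_add_sub_nonneg_of_isMinOn {X : Set E} {φ ψ : E → ℝ} {z d y : E}
    (hφ : HasGradientAt φ d z) (hψ : ConvexOn ℝ X ψ) (hz : z ∈ X)
    (hmin : IsMinOn (fun y => φ y + ψ y) X z) (hy : y ∈ X) :
    0 ≤ inner ℝ d (y - z) + (ψ y - ψ z) := by
  have hline : HasDerivAt (fun t : ℝ => φ (z + t • (y - z))) (inner ℝ d (y - z)) 0 := by
    have h1 : HasDerivAt (fun t : ℝ => z + t • (y - z)) (y - z) 0 := by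
      simpa using ((hasDerivAt_id (0 : ℝ)).smul_const (y - z)).const_add z
    have h2 : HasFDerivAt φ (InnerProductSpace.toDual ℝ E d) (z + (0 : ℝ) • (y - z)) := by
      simpa using hφ.hasFDerivAt
    have h3 := h2.comp_hasDerivAt (0 : ℝ) h1
    rwa [InnerProductSpace.toDual_apply_apply] at h3
  have hlim := (hasDerivAt_iff_tendsto_slope.1 hline).mono_left
    (nhdsWithin_mono (0 : ℝ) (fun t (ht : t ∈ Set.Ioi (0 : ℝ)) => ne_of_gt ht))
  -- Minimality along the segment bounds the difference quotients of `φ` from below, convexity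
  -- bounding the increment of `ψ` linearly in `t`; only `t ↓ 0` is used, since the segment may
  -- leave `X` for `t < 0`.
  have hge : ψ z - ψ y ≤ inner ℝ d (y - z) := by
    refine ge_of_tendsto hlim ?_
    filter_upwards [Ioc_mem_nhdsGT (show (0 : ℝ) < 1 by norm_num)] with t ht
    have hmem : z + t • (y - z) ∈ X := hψ.1.add_smul_sub_mem hz hy ⟨ht.1.le, ht.2⟩
    have h3 : φ z + ψ z ≤ φ (z + t • (y - z)) + ψ (z + t • (y - z)) := hmin hmem
    have h4 : ψ (z + t • (y - z)) ≤ (1 - t) * ψ z + t * ψ y := by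
      have := hψ.2 hz hy (sub_nonneg.2 ht.2) ht.1.le (by ring)
      have h5 : z + t • (y - z) = (1 - t) • z + t • y := by module
      rw [h5]
      simpa using this
    rw [slope_def_field, sub_zero, zero_smul, add_zero, le_div_iff₀ ht.1]
    linarith
  linarith

theorem bregman_three_point (w : E → ℝ) (x y z : E) :
    inner ℝ (gradient w z - gradient w x) (y - z)
      = bregman w y x - bregman w y z - bregman w z x := by
  have h : y - x = (y - z) + (z - x) := by abel
  simp only [bregman, h, inner_sub_left, inner_add_right]
  ring

theorem bregman_self (w : E → ℝ) (x : E) : bregman w x x = 0 := by simp [bregman]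

end Optimality

/-! ### Consequences of the assumptions on the problem -/

namespace CompositeProblem

variable {E : Type u} [NormedAddCommGroup E] [InnerProductSpace ℝ E] [CompleteSpace E] {n : ℕ}
  {p : CompositeProblem E n} {G : E → ℝ} {L μ : ℝ} {xs : E}

theorem inner_batchGrad (p : CompositeProblem E n) (I : Finset (Fin n)) (x v : E) :
    inner ℝ (p.batchGrad I x) v = (I.card : ℝ)⁻¹ * ∑ i ∈ I, inner ℝ (gradient (p.f i) x) v := by
  simp [batchGrad, real_inner_smul_left, sum_inner]

theorem inner_fullGrad (p : CompositeProblem E n) (x v : E) :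
    inner ℝ (p.fullGrad x) v = (n : ℝ)⁻¹ * ∑ i, inner ℝ (gradient (p.f i) x) v := by
  simp [fullGrad, inner_batchGrad]

namespace Assumptions

theorem gap_nonneg (hp : p.Assumptions G L μ xs) {x : E} (hx : x ∈ p.X) : 0 ≤ p.F x - p.F xs :=
  sub_nonneg.2 (hp.isMin hx)

theorem bregman_nonneg (hp : p.Assumptions G L μ xs) (hG : ∀ x, 0 ≤ G x) {x y : E}
    (hx : x ∈ p.X) (hy : y ∈ p.X) : 0 ≤ bregman p.w x y :=
  (hG _).trans (hp.B1 x hx y hy)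

/-- First-order optimality of the prox step, with the pairing of `∇w` differences rewritten by the
three-point identity. Only `ψ` needs to be treated as nonsmooth. -/
theorem prox_three_point (hp : p.Assumptions G L μ xs) {ν x y z : E} {η : ℝ}
    (hz : z ∈ p.X) (hy : y ∈ p.X)
    (hmin : IsMinOn (fun y => inner ℝ ν y + p.ψ y + η⁻¹ * bregman p.w y x) p.X z) :
    inner ℝ ν (z - y) + (p.ψ z - p.ψ y)
      ≤ η⁻¹ * (bregman p.w y x - bregman p.w y z - bregman p.w z x) := by
  let φ : E → ℝ := fun y => inner ℝ ν y + η⁻¹ * bregman p.w y x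
  have hw := (hp.diff_w z hz).hasGradientAt.hasFDerivAt
  have hφ : HasGradientAt φ (ν + η⁻¹ • (gradient p.w z - gradient p.w x)) z := by
    have h1 : HasFDerivAt (fun y : E => inner ℝ ν y) (InnerProductSpace.toDual ℝ E ν) z :=
      (InnerProductSpace.toDual ℝ E ν).hasFDerivAt
    have h2 : HasFDerivAt (fun y : E => inner ℝ (gradient p.w x) (y - x))
        (InnerProductSpace.toDual ℝ E (gradient p.w x)) z :=
      ((InnerProductSpace.toDual ℝ E (gradient p.w x)).hasFDerivAt).comp z
        ((hasFDerivAt_id z).sub_const x)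
    have h3 := h1.add (((hw.sub_const (p.w x)).sub h2).const_mul η⁻¹)
    rw [hasGradientAt_iff_hasFDerivAt]
    simp only [map_add, map_smul, map_sub]
    exact h3
  have h := inner_add_sub_nonneg_of_isMinOn hφ hp.convex_ψ hz
    (by
      have : (fun y => φ y + p.ψ y)
          = fun y => inner ℝ ν y + p.ψ y + η⁻¹ * bregman p.w y x := by
        funext y; simp only [φ]; ring
      rw [this]; exact hmin) hy
  rw [inner_add_left, real_inner_smul_left, bregman_three_point] at h
  rw [← neg_sub y z, inner_neg_right]
  linarith

/-- Both bounds of B2 are used at the base point `x`: the upper one (smoothness) towards `z`, the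
lower one (convexity) towards `y`. -/
theorem F_sub_le (hp : p.Assumptions G L μ xs) (hn : 0 < n) {x : E} (hx : x ∈ p.X) (y z : E) :
    p.F z - p.F y ≤ inner ℝ (p.fullGrad x) (z - y) + (p.ψ z - p.ψ y) + L * G (z - x) := by
  have h1 : ∀ i, p.f i z - p.f i y ≤ inner ℝ (gradient (p.f i) x) (z - y) + L * G (z - x) := by
    intro i
    have h2 := (hp.B2 i z x hx).2
    have h3 := (hp.B2 i y x hx).1
    simp only [bregman, inner_sub_right] at h2 h3 ⊢
    linarith
  have h2 := Finset.sum_le_sum fun i (_ : i ∈ Finset.univ) => h1 i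
  simp only [Finset.sum_sub_distrib, Finset.sum_add_distrib, Finset.sum_const, Finset.card_univ,
    Fintype.card_fin, nsmul_eq_mul] at h2
  have h3 := mul_le_mul_of_nonneg_left h2 (inv_nonneg.2 (Nat.cast_nonneg n : (0 : ℝ) ≤ n))
  have hn' : (n : ℝ) ≠ 0 := by positivity
  rw [inner_fullGrad, F, F]
  rw [mul_sub, mul_add, inv_mul_cancel_left₀ hn'] at h3
  linarith

theorem mean_bregman_le_gap (hp : p.Assumptions G L μ xs) {x : E} (hx : x ∈ p.X) :
    (n : ℝ)⁻¹ * ∑ i, bregman (p.f i) x xs ≤ p.F x - p.F xs := by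
  have hgrad : HasGradientAt (fun x => (n : ℝ)⁻¹ * ∑ i, p.f i x) (p.fullGrad xs) xs := by
    have h1 : HasFDerivAt (fun x => ∑ i, p.f i x)
        (∑ i, InnerProductSpace.toDual ℝ E (gradient (p.f i) xs)) xs :=
      HasFDerivAt.fun_sum fun i _ => (hp.diff_f i xs hp.mem).hasGradientAt.hasFDerivAt
    rw [hasGradientAt_iff_hasFDerivAt]
    simpa [fullGrad, batchGrad] using h1.const_mul (n : ℝ)⁻¹
  have h := inner_add_sub_nonneg_of_isMinOn hgrad hp.convex_ψ hp.mem hp.isMin hx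
  rw [inner_fullGrad] at h
  simp only [bregman, F, Finset.sum_sub_distrib, mul_sub]
  linarith

/-- Co-coercivity: the tangent at `y` lies below `f_i` at `x - d`, and the smooth upper bound at `x`
lies above it; comparing them for every `d` bounds the conjugate. The point `x - d` may lie outside
`X`, which is why B2 is required with its first argument in the whole space. -/
theorem conjE_gradient_sub_le (hp : p.Assumptions G L μ xs) (hs : ∀ x, G (-x) = G x)
    (i : Fin n) {x y : E} (hx : x ∈ p.X) (hy : y ∈ p.X) :
    conjE G (L⁻¹ • (gradient (p.f i) x - gradient (p.f i) y))
      ≤ ENNReal.ofReal (L⁻¹ * bregman (p.f i) x y) := by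
  refine conjE_le fun d => ENNReal.ofReal_le_ofReal ?_
  have h1 := (hp.B2 i (x - d) y hy).1
  have h2 := (hp.B2 i (x - d) x hx).2
  have hL := hp.L_pos
  have h3 : x - d - x = -d := by abel
  rw [bregman, h3, hs, inner_neg_right] at h2
  rw [bregman, sub_right_comm x d y, inner_sub_right] at h1
  rw [real_inner_smul_left, ← mul_le_mul_iff_right₀ hL, mul_sub, mul_inv_cancel_left₀ hL.ne',
    mul_inv_cancel_left₀ hL.ne', bregman, inner_sub_left]
  linarith

theorem mean_conjE_le (hp : p.Assumptions G L μ xs) (hs : ∀ x, G (-x) = G x)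
    (hn : 0 < n) {x : E} (hx : x ∈ p.X) :
    (n : ℝ≥0∞)⁻¹ * ∑ i, conjE G (L⁻¹ • (gradient (p.f i) x - gradient (p.f i) xs))
      ≤ ENNReal.ofReal (L⁻¹ * (p.F x - p.F xs)) := by
  have hL := hp.L_pos
  calc _ ≤ (n : ℝ≥0∞)⁻¹ * ∑ i, ENNReal.ofReal (L⁻¹ * bregman (p.f i) x xs) := by
        gcongr with i
        exact hp.conjE_gradient_sub_le hs i hx hp.mem
    _ = ENNReal.ofReal ((n : ℝ)⁻¹ * ∑ i, L⁻¹ * bregman (p.f i) x xs) := by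
        rw [ENNReal.ofReal_mul (by positivity), ENNReal.ofReal_sum_of_nonneg fun i _ =>
          mul_nonneg (by positivity) (hp.B2 i x xs hp.mem).1,
          ENNReal.ofReal_inv_of_pos (by positivity), ENNReal.ofReal_natCast]
    _ ≤ _ := by
        apply ENNReal.ofReal_le_ofReal
        rw [← Finset.mul_sum, mul_left_comm]
        gcongr
        exact hp.mean_bregman_le_gap hx

end Assumptions

theorem mean_conjE_gradDev (p : CompositeProblem E n) (h0 : G 0 = 0) (hL : 0 < L) (hn : 0 < n)
    (hfin : ∀ i, convexConj G (p.gradDev L xs i) ≠ ⊤) :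
    (n : ℝ≥0∞)⁻¹ * ∑ i, conjE G (p.gradDev L xs i) = ENNReal.ofReal (L⁻¹ * p.DH G L xs) := by
  have h1 : L⁻¹ * p.DH G L xs = (n : ℝ)⁻¹ * ∑ i, (conjE G (p.gradDev L xs i)).toReal := by
    simp only [DH, toReal_conjE h0]
    field_simp
  rw [h1, ENNReal.ofReal_mul (by positivity), ENNReal.ofReal_sum_of_nonneg fun i _ => by positivity,
    ENNReal.ofReal_inv_of_pos (by positivity), ENNReal.ofReal_natCast]
  simp only [ENNReal.ofReal_toReal (conjE_ne_top (hfin _))]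

theorem DH_nonneg (p : CompositeProblem E n) (h0 : G 0 = 0) (hL : 0 < L) (xs : E) :
    0 ≤ p.DH G L xs := by
  simp only [DH, ← toReal_conjE h0]
  positivity

end CompositeProblem

/-! ### Averages over mini-batches -/

section BatchMean

variable {n k : ℕ}

/-- The average over the `k`-subsets of `{1, …, n}`. -/
noncomputable def batchMean (n k : ℕ) (φ : Finset (Fin n) → ℝ) : ℝ :=
  (n.choose k : ℝ)⁻¹ * ∑ J ∈ Finset.powersetCard k Finset.univ, φ J

theorem batchMean_add (φ χ : Finset (Fin n) → ℝ) :
    batchMean n k (fun J => φ J + χ J) = batchMean n k φ + batchMean n k χ := by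
  simp [batchMean, Finset.sum_add_distrib, mul_add]

theorem batchMean_mul_left (c : ℝ) (φ : Finset (Fin n) → ℝ) :
    batchMean n k (fun J => c * φ J) = c * batchMean n k φ := by
  simp only [batchMean, ← Finset.mul_sum]; ring

theorem batchMean_const (hkn : k ≤ n) (c : ℝ) : batchMean n k (fun _ => c) = c := by
  have : (n.choose k : ℝ) ≠ 0 := by exact_mod_cast (Nat.choose_pos hkn).ne'
  simp [batchMean, this]

theorem batchMean_mono {φ χ : Finset (Fin n) → ℝ}
    (h : ∀ J ∈ Finset.powersetCard k Finset.univ, φ J ≤ χ J) :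
    batchMean n k φ ≤ batchMean n k χ :=
  mul_le_mul_of_nonneg_left (Finset.sum_le_sum h) (by positivity)

theorem batchMean_nonneg {φ : Finset (Fin n) → ℝ}
    (h : ∀ J ∈ Finset.powersetCard k Finset.univ, 0 ≤ φ J) : 0 ≤ batchMean n k φ :=
  mul_nonneg (by positivity) (Finset.sum_nonneg h)

theorem batchMean_sum {ι : Type*} (s : Finset ι) (φ : ι → Finset (Fin n) → ℝ) :
    batchMean n k (fun J => ∑ i ∈ s, φ i J) = ∑ i ∈ s, batchMean n k (φ i) := by
  simp only [batchMean, Finset.mul_sum]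
  exact Finset.sum_comm

theorem sum_powersetCard_sum_eq_zero {E : Type*} [AddCommGroup E] (z : Fin n → E)
    (hz : ∑ i, z i = 0) :
    ∑ J ∈ Finset.powersetCard k (Finset.univ : Finset (Fin n)), ∑ i ∈ J, z i = 0 := by
  rcases isEmpty_or_nonempty (Fin n) with h | ⟨⟨a⟩⟩
  · exact Finset.sum_eq_zero fun J _ => Finset.sum_eq_zero fun i _ => h.elim i
  have hcard : ∀ i : Fin n,
      ((Finset.powersetCard k (Finset.univ : Finset (Fin n))).filter (i ∈ ·)).card
        = ((Finset.powersetCard k (Finset.univ : Finset (Fin n))).filter (a ∈ ·)).card := by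
    intro i
    refine Finset.card_bij' (fun J _ => J.map (Equiv.swap i a).toEmbedding)
      (fun J _ => J.map (Equiv.swap i a).toEmbedding) ?_ ?_ ?_ ?_
    · intro J hJ
      simpa [Finset.mem_powersetCard] using hJ
    · intro J hJ
      simpa [Finset.mem_powersetCard] using hJ
    · intro J _
      ext; simp
    · intro J _
      ext; simp
  have h1 : ∀ J : Finset (Fin n), ∑ i ∈ J, z i = ∑ i, if i ∈ J then z i else 0 := by
    intro J; simp
  simp only [h1]
  rw [Finset.sum_comm]
  simp only [← Finset.sum_filter, Finset.sum_const, hcard]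
  rw [← Finset.smul_sum, hz, smul_zero]

theorem batchMean_inner_eq_zero {E : Type*} [NormedAddCommGroup E] [InnerProductSpace ℝ E]
    (z : Fin n → E) (hz : ∑ i, z i = 0) (c : ℝ) (v : E) :
    batchMean n k (fun J => inner ℝ (c • ∑ i ∈ J, z i) v) = 0 := by
  rw [batchMean, ← sum_inner, ← Finset.smul_sum, sum_powersetCard_sum_eq_zero z hz]
  simp

/-- Finiteness is recorded together with the real bound: `toReal` sends `⊤` to `0`, so the real
bound alone would not permit Fenchel–Young. -/
theorem toReal_batchMean_le (hkn : k ≤ n) {Φ : Finset (Fin n) → ℝ≥0∞} {R : ℝ} (hR : 0 ≤ R)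
    (h : (n.choose k : ℝ≥0∞)⁻¹ * ∑ J ∈ Finset.powersetCard k Finset.univ, Φ J
      ≤ ENNReal.ofReal R) :
    (∀ J ∈ Finset.powersetCard k Finset.univ, Φ J ≠ ⊤) ∧
      batchMean n k (fun J => (Φ J).toReal) ≤ R := by
  have hch := Nat.choose_pos hkn
  have hfin : ∀ J ∈ Finset.powersetCard k Finset.univ, Φ J ≠ ⊤ := by
    have h1 : ∑ J ∈ Finset.powersetCard k Finset.univ, Φ J ≠ ⊤ := by
      intro h2
      rw [h2, ENNReal.mul_top (by simp)] at h
      exact ENNReal.ofReal_ne_top (top_le_iff.1 h)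
    exact fun J hJ => (ENNReal.sum_ne_top.1 h1) J hJ
  refine ⟨hfin, ?_⟩
  have h2 := ENNReal.toReal_mono ENNReal.ofReal_ne_top h
  rwa [ENNReal.toReal_mul, ENNReal.toReal_sum hfin, ENNReal.toReal_ofReal hR, ENNReal.toReal_inv,
    ENNReal.toReal_natCast] at h2

end BatchMean

/-! ### The noise of mini-batch averages -/

section Noise

variable {E : Type u} [NormedAddCommGroup E] [InnerProductSpace ℝ E] {n : ℕ} {G : E → ℝ}

theorem conjE_mean_le (hG : ∀ x, 0 ≤ G x) (hn : 0 < n) (U : Fin n → E) :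
    conjE G ((n : ℝ)⁻¹ • ∑ i, U i) ≤ (n : ℝ≥0∞)⁻¹ * ∑ i, conjE G (U i) := by
  rw [Finset.smul_sum]
  refine (conjE_sum_le hG Finset.univ (fun _ => (n : ℝ)⁻¹) U (fun _ _ => by positivity)
    (by simp [hn.ne'])).trans_eq ?_
  rw [← Finset.mul_sum, ENNReal.ofReal_inv_of_pos (by positivity), ENNReal.ofReal_natCast]

theorem mean_const (hn : 0 < n) (c : ℝ≥0∞) : (n : ℝ≥0∞)⁻¹ * ∑ _i : Fin n, c = c := by
  rw [Finset.sum_const, Finset.card_univ, Fintype.card_fin, nsmul_eq_mul, ← mul_assoc,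
    ENNReal.inv_mul_cancel (by exact_mod_cast hn.ne') (by simp), one_mul]

/-- The difference of two centred families splits into four vectors, each given weight `s`; this is
admissible in Jensen's inequality because `4 s ≤ 1`. The two means are again bounded by Jensen. -/
theorem mean_conjE_smul_le_four (hG : ∀ x, 0 ≤ G x) (hs : ∀ x, G (-x) = G x) (hn : 0 < n)
    (U V : Fin n → E) {A B s : ℝ} (hs0 : 0 ≤ s) (hs1 : s ≤ 1 / 4) (hA0 : 0 ≤ A) (hB0 : 0 ≤ B)
    (hA : (n : ℝ≥0∞)⁻¹ * ∑ i, conjE G (U i) ≤ ENNReal.ofReal A)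
    (hB : (n : ℝ≥0∞)⁻¹ * ∑ i, conjE G (V i) ≤ ENNReal.ofReal B) :
    (n : ℝ≥0∞)⁻¹ * ∑ i, conjE G
        (s • (U i - (n : ℝ)⁻¹ • ∑ j, U j - (V i - (n : ℝ)⁻¹ • ∑ j, V j)))
      ≤ ENNReal.ofReal (s * (2 * A + 2 * B)) := by
  have h1 : ∀ i, conjE G (s • (U i - (n : ℝ)⁻¹ • ∑ j, U j - (V i - (n : ℝ)⁻¹ • ∑ j, V j)))
      ≤ ENNReal.ofReal s * (conjE G (U i) + conjE G (V i) +
        (conjE G ((n : ℝ)⁻¹ • ∑ j, U j) + conjE G ((n : ℝ)⁻¹ • ∑ j, V j))) := by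
    intro i
    have h2 := conjE_sum_le hG (Finset.univ : Finset (Fin 4)) (fun _ => s)
      ![U i, -((n : ℝ)⁻¹ • ∑ j, U j), -V i, (n : ℝ)⁻¹ • ∑ j, V j] (fun _ _ => hs0)
      (by simp; linarith)
    simp only [Fin.sum_univ_four, Matrix.cons_val_zero, Matrix.cons_val_one, Matrix.cons_val,
      conjE_neg hs] at h2
    convert h2 using 1
    · congr 1; module
    · ring
  calc _ ≤ (n : ℝ≥0∞)⁻¹ * ∑ i, ENNReal.ofReal s * (conjE G (U i) + conjE G (V i) +
        (conjE G ((n : ℝ)⁻¹ • ∑ j, U j) + conjE G ((n : ℝ)⁻¹ • ∑ j, V j))) := by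
        gcongr with i; exact h1 i
    _ = ENNReal.ofReal s * ((n : ℝ≥0∞)⁻¹ * ∑ i, conjE G (U i) + (n : ℝ≥0∞)⁻¹ * ∑ i, conjE G (V i) +
        (conjE G ((n : ℝ)⁻¹ • ∑ j, U j) + conjE G ((n : ℝ)⁻¹ • ∑ j, V j))) := by
        rw [← Finset.mul_sum, mul_left_comm, Finset.sum_add_distrib, Finset.sum_add_distrib,
          mul_add, mul_add, mean_const hn]
        ring
    _ ≤ ENNReal.ofReal s * (ENNReal.ofReal A + ENNReal.ofReal B
        + (ENNReal.ofReal A + ENNReal.ofReal B)) := by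
        gcongr
        · exact (conjE_mean_le hG hn U).trans hA
        · exact (conjE_mean_le hG hn V).trans hB
    _ = _ := by
        rw [← ENNReal.ofReal_add hA0 hB0, ← ENNReal.ofReal_add (by positivity) (by positivity),
          ← ENNReal.ofReal_mul hs0]
        congr 1; ring

theorem mean_conjE_smul_le_three (hG : ∀ x, 0 ≤ G x) (hs : ∀ x, G (-x) = G x) (hn : 0 < n)
    (U W : Fin n → E) {A B s : ℝ} (hs0 : 0 ≤ s) (hs1 : s ≤ 1 / 3) (hA0 : 0 ≤ A) (hB0 : 0 ≤ B)
    (hA : (n : ℝ≥0∞)⁻¹ * ∑ i, conjE G (U i) ≤ ENNReal.ofReal A)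
    (hB : (n : ℝ≥0∞)⁻¹ * ∑ i, conjE G (W i) ≤ ENNReal.ofReal B) :
    (n : ℝ≥0∞)⁻¹ * ∑ i, conjE G (s • (U i - (n : ℝ)⁻¹ • ∑ j, U j + W i))
      ≤ ENNReal.ofReal (s * (2 * A + B)) := by
  have h1 : ∀ i, conjE G (s • (U i - (n : ℝ)⁻¹ • ∑ j, U j + W i))
      ≤ ENNReal.ofReal s * (conjE G (U i) + conjE G (W i) +
        conjE G ((n : ℝ)⁻¹ • ∑ j, U j)) := by
    intro i
    have h2 := conjE_sum_le hG (Finset.univ : Finset (Fin 3)) (fun _ => s)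
      ![U i, -((n : ℝ)⁻¹ • ∑ j, U j), W i] (fun _ _ => hs0)
      (by simp; linarith)
    simp only [Fin.sum_univ_three, Matrix.cons_val_zero, Matrix.cons_val_one, Matrix.cons_val,
      conjE_neg hs] at h2
    convert h2 using 1
    · congr 1; module
    · ring
  calc _ ≤ (n : ℝ≥0∞)⁻¹ * ∑ i, ENNReal.ofReal s * (conjE G (U i) + conjE G (W i) +
        conjE G ((n : ℝ)⁻¹ • ∑ j, U j)) := by
        gcongr with i; exact h1 i
    _ = ENNReal.ofReal s * ((n : ℝ≥0∞)⁻¹ * ∑ i, conjE G (U i) + (n : ℝ≥0∞)⁻¹ * ∑ i, conjE G (W i) +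
        conjE G ((n : ℝ)⁻¹ • ∑ j, U j)) := by
        rw [← Finset.mul_sum, mul_left_comm, Finset.sum_add_distrib, Finset.sum_add_distrib,
          mul_add, mul_add, mean_const hn]
        ring
    _ ≤ ENNReal.ofReal s * (ENNReal.ofReal A + ENNReal.ofReal B + ENNReal.ofReal A) := by
        gcongr
        exact (conjE_mean_le hG hn U).trans hA
    _ = _ := by
        rw [← ENNReal.ofReal_add hA0 hB0, ← ENNReal.ofReal_add (by positivity) (by positivity),
          ← ENNReal.ofReal_mul hs0]
        congr 1; ring

/-- The noise of a mini-batch average of centred vectors, measured by the conjugate at the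
scale `c`. -/
theorem IsCHEF.batch_noise [CompleteSpace E] [MeasurableSpace E] [BorelSpace E] {g : ℝ → ℝ}
    {CG : ℝ} (hG : IsCHEF g CG G) (hCG : 0 < CG) {k : ℕ} (hk : 0 < k) (hkn : k ≤ n)
    (Y : Fin n → E) (hY : ∑ i, Y i = 0) {r c L M : ℝ} (hr : 0 < r) (hc : 0 < c) (hL : 0 < L)
    (hM0 : 0 ≤ M)
    (hM : (n : ℝ≥0∞)⁻¹ * ∑ i, conjE G ((L / (c * k * g r)) • L⁻¹ • Y i)
      ≤ ENNReal.ofReal (L / (c * k * g r) * M)) :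
    (∀ J ∈ Finset.powersetCard k Finset.univ, conjE G (c⁻¹ • (k : ℝ)⁻¹ • ∑ i ∈ J, Y i) ≠ ⊤) ∧
      c * batchMean n k (fun J => (conjE G (c⁻¹ • (k : ℝ)⁻¹ • ∑ i ∈ J, Y i)).toReal)
        ≤ CG * r * L * M := by
  have hgr := hG.g_pos r hr
  have hk' : (0 : ℝ) < k := by exact_mod_cast hk
  set s := L / (c * k * g r) with hs
  have hs0 : 0 < s := by positivity
  -- The factor `(c k)⁻¹` is split as `g r * s * L⁻¹`: sup-homogeneity removes `g r` at the price `r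
  -- * g r`, and `s` is left for the convexity bound in `hM`.
  have hYs : ∀ J : Finset (Fin n), c⁻¹ • (k : ℝ)⁻¹ • ∑ i ∈ J, Y i
      = ∑ i ∈ J, g r • s • L⁻¹ • Y i := by
    intro J
    simp only [smul_smul, ← Finset.smul_sum]
    congr 1
    rw [hs]
    field_simp
  have h1 : (n.choose k : ℝ≥0∞)⁻¹ * ∑ J ∈ Finset.powersetCard k Finset.univ,
      conjE G (c⁻¹ • (k : ℝ)⁻¹ • ∑ i ∈ J, Y i)
      ≤ ENNReal.ofReal (CG * (k * (r * g r * (s * M)))) := by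
    simp only [hYs]
    refine (hG.nemirovsky.sampling hG.nonneg hk hkn _ (by
      simp only [← Finset.smul_sum, hY, smul_zero])).trans ?_
    rw [ENNReal.ofReal_mul hCG.le, ENNReal.ofReal_mul hk'.le, ENNReal.ofReal_natCast]
    gcongr
    calc (n : ℝ≥0∞)⁻¹ * ∑ i, conjE G (g r • s • L⁻¹ • Y i)
        ≤ (n : ℝ≥0∞)⁻¹ * ∑ i, ENNReal.ofReal (r * g r) * conjE G (s • L⁻¹ • Y i) := by
          gcongr with i
          exact conjE_smul_le_of_supHom hr hgr.le (fun x => hG.sup_homogeneous x r hr) _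
      _ = ENNReal.ofReal (r * g r) * ((n : ℝ≥0∞)⁻¹ * ∑ i, conjE G (s • L⁻¹ • Y i)) := by
          rw [← Finset.mul_sum, mul_left_comm]
      _ ≤ _ := by
          rw [ENNReal.ofReal_mul (by positivity : (0 : ℝ) ≤ r * g r)]
          gcongr
  obtain ⟨h2, h3⟩ := toReal_batchMean_le hkn (by positivity) h1
  refine ⟨h2, ?_⟩
  refine (mul_le_mul_of_nonneg_left h3 hc.le).trans_eq ?_
  rw [hs]
  field_simp

end Noise

/-! ### Noise of the two gradient estimators. -/

namespace CompositeProblem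

variable {E : Type u} [NormedAddCommGroup E] [InnerProductSpace ℝ E] [CompleteSpace E]
  {n : ℕ} {p : CompositeProblem E n} {G : E → ℝ}
  {L μ CG : ℝ} {xs : E} {g : ℝ → ℝ}

theorem batchGrad_sub_fullGrad (p : CompositeProblem E n) {k : ℕ} (hk : 0 < k)
    {J : Finset (Fin n)} (hJ : J.card = k) (x : E) :
    p.batchGrad J x - p.fullGrad x
      = (k : ℝ)⁻¹ • ∑ i ∈ J, (gradient (p.f i) x - p.fullGrad x) := by
  have hk' : (k : ℝ) ≠ 0 := by positivity
  rw [Finset.sum_sub_distrib, Finset.sum_const, smul_sub, hJ, ← Nat.cast_smul_eq_nsmul ℝ, smul_smul,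
    inv_mul_cancel₀ hk', one_smul, batchGrad, hJ]

theorem sum_gradient_sub_fullGrad (p : CompositeProblem E n) (hn : 0 < n) (x : E) :
    ∑ i, (gradient (p.f i) x - p.fullGrad x) = 0 := by
  have hn' : (n : ℝ) ≠ 0 := by positivity
  rw [Finset.sum_sub_distrib, Finset.sum_const, Finset.card_univ, Fintype.card_fin, fullGrad,
    batchGrad, ← Nat.cast_smul_eq_nsmul ℝ, smul_smul, Finset.card_univ, Fintype.card_fin,
    mul_inv_cancel₀ hn', one_smul, sub_self]

variable [MeasurableSpace E] [BorelSpace E]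

/-- The noise of the inner mini-batches. -/
theorem Assumptions.step_noise (hp : p.Assumptions G L μ xs) (hG : IsCHEF g CG G) (hCG : 0 < CG)
    {b : ℕ} (hb : 0 < b) (hbn : b ≤ n) {x x₀ : E} (hx : x ∈ p.X) (hx₀ : x₀ ∈ p.X) {r c : ℝ}
    (hr : 0 < r) (hc : 0 < c) (hL : L ≤ c * b * g r / 4) :
    (∀ I ∈ Finset.powersetCard b Finset.univ, conjE G (c⁻¹ •
        (p.batchGrad I x - p.fullGrad x - (p.batchGrad I x₀ - p.fullGrad x₀))) ≠ ⊤) ∧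
      c * batchMean n b (fun I => (conjE G (c⁻¹ •
        (p.batchGrad I x - p.fullGrad x - (p.batchGrad I x₀ - p.fullGrad x₀)))).toReal)
        ≤ 2 * CG * r * ((p.F x - p.F xs) + (p.F x₀ - p.F xs)) := by
  have hn : 0 < n := hb.trans_le hbn
  have hn' : (n : ℝ) ≠ 0 := by positivity
  have hLp := hp.L_pos
  have hgr := hG.g_pos r hr
  have hb' : (0 : ℝ) < b := by exact_mod_cast hb
  let Y : Fin n → E := fun i =>
    gradient (p.f i) x - p.fullGrad x - (gradient (p.f i) x₀ - p.fullGrad x₀)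
  have hY : ∑ i, Y i = 0 := by
    simp only [Y]
    rw [Finset.sum_sub_distrib, sum_gradient_sub_fullGrad p hn, sum_gradient_sub_fullGrad p hn,
      sub_zero]
  -- Both gradients are compared with those at `x*`, so that co-coercivity turns the noise into the
  -- two gaps. The hypothesis on `L` is exactly `s ≤ 1/4`.
  have h1 := mean_conjE_smul_le_four hG.nonneg hG.symm hn
    (fun i => L⁻¹ • (gradient (p.f i) x - gradient (p.f i) xs))
    (fun i => L⁻¹ • (gradient (p.f i) x₀ - gradient (p.f i) xs))
    (s := L / (c * b * g r)) (by positivity)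
    (by rw [div_le_iff₀ (by positivity)]; linarith)
    (mul_nonneg (by positivity) (hp.gap_nonneg hx)) (mul_nonneg (by positivity) (hp.gap_nonneg hx₀))
    (hp.mean_conjE_le hG.symm hn hx) (hp.mean_conjE_le hG.symm hn hx₀)
  have h2 : ∀ i, L⁻¹ • (gradient (p.f i) x - gradient (p.f i) xs)
      - (n : ℝ)⁻¹ • ∑ j, L⁻¹ • (gradient (p.f j) x - gradient (p.f j) xs)
      - (L⁻¹ • (gradient (p.f i) x₀ - gradient (p.f i) xs)
      - (n : ℝ)⁻¹ • ∑ j, L⁻¹ • (gradient (p.f j) x₀ - gradient (p.f j) xs)) = L⁻¹ • Y i := by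
    intro i
    simp only [Y, fullGrad, batchGrad, ← Finset.smul_sum, Finset.sum_sub_distrib, Finset.card_univ,
      Fintype.card_fin]
    module
  simp only [h2] at h1
  have h3 := hG.batch_noise hCG hb hbn Y hY hr hc hLp
    (add_nonneg (mul_nonneg zero_le_two (mul_nonneg (by positivity) (hp.gap_nonneg hx)))
      (mul_nonneg zero_le_two (mul_nonneg (by positivity) (hp.gap_nonneg hx₀)))) h1
  have h4 : ∀ I ∈ Finset.powersetCard b (Finset.univ : Finset (Fin n)),
      p.batchGrad I x - p.fullGrad x - (p.batchGrad I x₀ - p.fullGrad x₀)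
        = (b : ℝ)⁻¹ • ∑ i ∈ I, Y i := fun I hI => by
    have hI' := (Finset.mem_powersetCard.1 hI).2
    rw [batchGrad_sub_fullGrad p hb hI', batchGrad_sub_fullGrad p hb hI', ← smul_sub,
      ← Finset.sum_sub_distrib]
  constructor
  · intro I hI
    rw [h4 I hI]
    exact h3.1 I hI
  · have h5 : batchMean n b (fun I => (conjE G (c⁻¹ •
        (p.batchGrad I x - p.fullGrad x - (p.batchGrad I x₀ - p.fullGrad x₀)))).toReal)
        = batchMean n b (fun I => (conjE G (c⁻¹ • (b : ℝ)⁻¹ • ∑ i ∈ I, Y i)).toReal) := by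
      simp only [batchMean]
      congr 1
      exact Finset.sum_congr rfl fun I hI => by rw [h4 I hI]
    rw [h5]
    refine h3.2.trans_eq ?_
    field_simp

/-- The noise of the batch of an epoch. -/
theorem Assumptions.epoch_noise (hp : p.Assumptions G L μ xs) (hG : IsCHEF g CG G) (hCG : 0 < CG)
    (hfin : ∀ i, convexConj G (p.gradDev L xs i) ≠ ⊤)
    {B : ℕ} (hB : 0 < B) (hBn : B ≤ n) {x₀ : E} (hx₀ : x₀ ∈ p.X) {r c : ℝ}
    (hr : 0 < r) (hc : 0 < c) (hL : L ≤ c * B * g r / 3) :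
    (∀ J ∈ Finset.powersetCard B Finset.univ,
        conjE G (c⁻¹ • (p.batchGrad J x₀ - p.fullGrad x₀)) ≠ ⊤) ∧
      c * batchMean n B (fun J => (conjE G (c⁻¹ • (p.batchGrad J x₀ - p.fullGrad x₀))).toReal)
        ≤ CG * r * (2 * (p.F x₀ - p.F xs) + p.DH G L xs) := by
  have hn : 0 < n := hB.trans_le hBn
  have hn' : (n : ℝ) ≠ 0 := by positivity
  have hLp := hp.L_pos
  have hgr := hG.g_pos r hr
  have hB' : (0 : ℝ) < B := by exact_mod_cast hB
  let Y : Fin n → E := fun i => gradient (p.f i) x₀ - p.fullGrad x₀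
  have hY : ∑ i, Y i = 0 := sum_gradient_sub_fullGrad p hn x₀
  have hDH := p.DH_nonneg hG.zero hLp xs
  have h1 := mean_conjE_smul_le_three hG.nonneg hG.symm hn
    (fun i => L⁻¹ • (gradient (p.f i) x₀ - gradient (p.f i) xs))
    (fun i => p.gradDev L xs i)
    (s := L / (c * B * g r)) (by positivity)
    (by rw [div_le_iff₀ (by positivity)]; linarith)
    (mul_nonneg (by positivity) (hp.gap_nonneg hx₀)) (by positivity)
    (hp.mean_conjE_le hG.symm hn hx₀) (p.mean_conjE_gradDev hG.zero hLp hn hfin).le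
  have h2 : ∀ i, L⁻¹ • (gradient (p.f i) x₀ - gradient (p.f i) xs)
      - (n : ℝ)⁻¹ • ∑ j, L⁻¹ • (gradient (p.f j) x₀ - gradient (p.f j) xs)
      + p.gradDev L xs i = L⁻¹ • Y i := by
    intro i
    simp only [Y, gradDev, fullGrad, batchGrad, ← Finset.smul_sum, Finset.sum_sub_distrib,
      Finset.card_univ, Fintype.card_fin]
    module
  simp only [h2] at h1
  have h3 := hG.batch_noise hCG hB hBn Y hY hr hc hLp
    (add_nonneg (mul_nonneg zero_le_two (mul_nonneg (by positivity) (hp.gap_nonneg hx₀)))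
      (by positivity)) h1
  have h4 : ∀ J ∈ Finset.powersetCard B (Finset.univ : Finset (Fin n)),
      p.batchGrad J x₀ - p.fullGrad x₀ = (B : ℝ)⁻¹ • ∑ i ∈ J, Y i := fun J hJ =>
    batchGrad_sub_fullGrad p hB (Finset.mem_powersetCard.1 hJ).2 x₀
  constructor
  · intro J hJ
    rw [h4 J hJ]
    exact h3.1 J hJ
  · have h5 : batchMean n B (fun J =>
        (conjE G (c⁻¹ • (p.batchGrad J x₀ - p.fullGrad x₀))).toReal)
        = batchMean n B (fun J => (conjE G (c⁻¹ • (B : ℝ)⁻¹ • ∑ i ∈ J, Y i)).toReal) := by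
      simp only [batchMean]
      congr 1
      exact Finset.sum_congr rfl fun J hJ => by rw [h4 J hJ]
    rw [h5]
    refine h3.2.trans_eq ?_
    field_simp

end CompositeProblem

/-! ### Expectations under discrete laws -/

section Expect

variable {β : Type u} {γ : Type v}

theorem expect_pure (a : β) (φ : β → ℝ≥0∞) : expect (PMF.pure a) φ = φ a := by
  rw [expect, tsum_eq_single a fun b hb => by simp [hb]]
  simp

theorem expect_bind (p : PMF β) (q : β → PMF γ) (φ : γ → ℝ≥0∞) :
    expect (p.bind q) φ = expect p fun a => expect (q a) φ := by
  simp only [expect, PMF.bind_apply, ← ENNReal.tsum_mul_right, ← ENNReal.tsum_mul_left]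
  rw [ENNReal.tsum_comm]
  simp only [mul_assoc]

theorem expect_map (p : PMF β) (f : β → γ) (φ : γ → ℝ≥0∞) :
    expect (p.map f) φ = expect p fun a => φ (f a) := by
  rw [PMF.map, expect_bind]
  simp only [Function.comp_apply, expect_pure]

theorem expect_mono {p : PMF β} {φ χ : β → ℝ≥0∞} (h : ∀ a ∈ p.support, φ a ≤ χ a) :
    expect p φ ≤ expect p χ := by
  refine ENNReal.tsum_le_tsum fun a => ?_
  by_cases ha : a ∈ p.support
  · gcongr; exact h a ha
  · simp [(PMF.apply_eq_zero_iff p a).2 ha]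

theorem expect_congr {p : PMF β} {φ χ : β → ℝ≥0∞} (h : ∀ a ∈ p.support, φ a = χ a) :
    expect p φ = expect p χ :=
  le_antisymm (expect_mono fun a ha => (h a ha).le) (expect_mono fun a ha => (h a ha).ge)

theorem expect_add (p : PMF β) (φ χ : β → ℝ≥0∞) :
    expect p (fun a => φ a + χ a) = expect p φ + expect p χ := by
  simp only [expect, mul_add, ENNReal.tsum_add]

theorem expect_mul_left (p : PMF β) (c : ℝ≥0∞) (φ : β → ℝ≥0∞) :
    expect p (fun a => c * φ a) = c * expect p φ := by
  simp only [expect, ← ENNReal.tsum_mul_left, mul_left_comm]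

theorem expect_const (p : PMF β) (c : ℝ≥0∞) : expect p (fun _ => c) = c := by
  rw [expect, ENNReal.tsum_mul_right, p.tsum_coe, one_mul]

theorem expect_uniformBatch {n k : ℕ} (hkn : k ≤ n) (φ : Finset (Fin n) → ℝ≥0∞) :
    expect (uniformBatch n k) φ
      = (n.choose k : ℝ≥0∞)⁻¹ * ∑ J ∈ Finset.powersetCard k Finset.univ, φ J := by
  have h : ∀ J, uniformBatch n k J * φ J
      = if J ∈ Finset.powersetCard k Finset.univ then (n.choose k : ℝ≥0∞)⁻¹ * φ J else 0 := by
    intro J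
    simp only [uniformBatch, PMF.uniformOfFinset_apply, min_eq_left hkn, Finset.card_powersetCard,
      Finset.card_univ, Fintype.card_fin]
    split_ifs <;> simp
  rw [expect, tsum_fintype]
  simp only [h, Finset.sum_ite_mem, Finset.univ_inter, Finset.mul_sum]

theorem mem_support_uniformBatch {n k : ℕ} (hkn : k ≤ n) {J : Finset (Fin n)} :
    J ∈ (uniformBatch n k).support ↔ J ∈ Finset.powersetCard k Finset.univ := by
  simp [uniformBatch, min_eq_left hkn]

theorem expect_uniformBatch_ofReal {n k : ℕ} (hkn : k ≤ n) {φ : Finset (Fin n) → ℝ}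
    (hφ : ∀ J ∈ Finset.powersetCard k Finset.univ, 0 ≤ φ J) :
    expect (uniformBatch n k) (fun J => ENNReal.ofReal (φ J))
      = ENNReal.ofReal (batchMean n k φ) := by
  have hch := Nat.choose_pos hkn
  rw [expect_uniformBatch hkn, batchMean, ENNReal.ofReal_mul (by positivity),
    ENNReal.ofReal_sum_of_nonneg hφ, ENNReal.ofReal_inv_of_pos (by positivity),
    ENNReal.ofReal_natCast]

end Expect

/-! ### The inner loop -/

section InnerLoop

variable {E : Type u} [NormedAddCommGroup E] [InnerProductSpace ℝ E] [CompleteSpace E] {n : ℕ}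
  {p : CompositeProblem E n} {prox : E → E → E} {b : ℕ} {J : Finset (Fin n)} {x₀ : E} {η : ℝ}

/-- The transition operator of the inner loop. -/
noncomputable def stepMean (p : CompositeProblem E n) (prox : E → E → E) (b : ℕ)
    (J : Finset (Fin n)) (x₀ : E) (φ : E → ℝ) (x : E) : ℝ :=
  batchMean n b fun I => φ (prox (p.vrGrad J I x₀ x) x)

/-- The expectation of a real function of the inner iterate `x_k`. -/
noncomputable def innerMean (p : CompositeProblem E n) (prox : E → E → E) (b : ℕ)
    (J : Finset (Fin n)) (x₀ : E) : ℕ → (E → ℝ) → ℝ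
  | 0, φ => φ x₀
  | k + 1, φ => innerMean p prox b J x₀ k (stepMean p prox b J x₀ φ)

theorem CompositeProblem.IsProxMap.mem (hprox : p.IsProxMap b η prox) (hx₀ : x₀ ∈ p.X)
    (hJ : J.Nonempty) {x : E} (hx : x ∈ p.X) {I : Finset (Fin n)}
    (hI : I ∈ Finset.powersetCard b Finset.univ) : prox (p.vrGrad J I x₀ x) x ∈ p.X :=
  (hprox x₀ hx₀ x hx J I hJ (Finset.mem_powersetCard.1 hI).2).1

theorem innerMean_add (k : ℕ) (φ χ : E → ℝ) :
    innerMean p prox b J x₀ k (fun x => φ x + χ x)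
      = innerMean p prox b J x₀ k φ + innerMean p prox b J x₀ k χ := by
  induction k generalizing φ χ with
  | zero => rfl
  | succ k ih =>
    rw [innerMean, innerMean, innerMean, ← ih]
    congr 1
    funext x
    exact batchMean_add _ _

theorem innerMean_mul_left (k : ℕ) (c : ℝ) (φ : E → ℝ) :
    innerMean p prox b J x₀ k (fun x => c * φ x) = c * innerMean p prox b J x₀ k φ := by
  induction k generalizing φ with
  | zero => rfl
  | succ k ih =>
    rw [innerMean, innerMean, ← ih]
    congr 1
    funext x
    exact batchMean_mul_left _ _

theorem innerMean_const (hbn : b ≤ n) (k : ℕ) (c : ℝ) :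
    innerMean p prox b J x₀ k (fun _ => c) = c := by
  induction k with
  | zero => rfl
  | succ k ih =>
    rw [innerMean]
    have : stepMean p prox b J x₀ (fun _ => c) = fun _ => c := by
      funext x; exact batchMean_const hbn c
    rw [this, ih]

theorem innerMean_mono (hprox : p.IsProxMap b η prox) (hx₀ : x₀ ∈ p.X) (hJ : J.Nonempty) (k : ℕ)
    {φ χ : E → ℝ} (h : ∀ x ∈ p.X, φ x ≤ χ x) :
    innerMean p prox b J x₀ k φ ≤ innerMean p prox b J x₀ k χ := by
  induction k generalizing φ χ with
  | zero => exact h x₀ hx₀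
  | succ k ih => exact ih fun x hx => batchMean_mono fun I hI => h _ (hprox.mem hx₀ hJ hx hI)

theorem support_innerLoop_subset (hprox : p.IsProxMap b η prox) (hbn : b ≤ n) (hx₀ : x₀ ∈ p.X)
    (hJ : J.Nonempty) (k : ℕ) : (innerLoop p prox b J x₀ k).support ⊆ p.X := by
  induction k with
  | zero =>
    intro y hy
    rw [innerLoop, PMF.mem_support_pure_iff] at hy
    exact hy ▸ hx₀
  | succ k ih =>
    intro y hy
    rw [innerLoop, PMF.mem_support_bind_iff] at hy
    obtain ⟨x, hx, hy⟩ := hy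
    rw [PMF.mem_support_map_iff] at hy
    obtain ⟨I, hI, rfl⟩ := hy
    exact hprox.mem hx₀ hJ (ih hx) ((mem_support_uniformBatch hbn).1 hI)

/-- The telescoping argument needs signed functions, hence the real operator `innerMean`. On
functions that are nonnegative on `X` it agrees with the expectation under the discrete law, because
all iterates stay in `X`. -/
theorem expect_innerLoop (hprox : p.IsProxMap b η prox) (hbn : b ≤ n) (hx₀ : x₀ ∈ p.X)
    (hJ : J.Nonempty) (k : ℕ) {φ : E → ℝ} (hφ : ∀ x ∈ p.X, 0 ≤ φ x) :
    expect (innerLoop p prox b J x₀ k) (fun x => ENNReal.ofReal (φ x))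
      = ENNReal.ofReal (innerMean p prox b J x₀ k φ) := by
  induction k generalizing φ with
  | zero => exact expect_pure _ _
  | succ k ih =>
    rw [innerLoop, expect_bind, innerMean, ← ih]
    · refine expect_congr fun x hx => ?_
      have hxX := support_innerLoop_subset hprox hbn hx₀ hJ k hx
      rw [expect_map]
      exact expect_uniformBatch_ofReal hbn fun I hI => hφ _ (hprox.mem hx₀ hJ hxX hI)
    · exact fun x hx => batchMean_nonneg fun I hI => hφ _ (hprox.mem hx₀ hJ hx hI)

end InnerLoop

/-! ### One inner step and one epoch -/

namespace CompositeProblem.Assumptions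

variable {E : Type u} [NormedAddCommGroup E] [InnerProductSpace ℝ E] [CompleteSpace E]
  {n : ℕ} {p : CompositeProblem E n} {G : E → ℝ}
  {L μ CG η r ω : ℝ} {xs x₀ : E} {g : ℝ → ℝ} {b : ℕ} {J : Finset (Fin n)} {prox : E → E → E}

/-- One inner step, compared with an arbitrary point, for a given mini-batch. -/
theorem step_pointwise (hp : p.Assumptions G L μ xs) (hs : ∀ x, G (-x) = G x)
    (hn : 0 < n) (hprox : p.IsProxMap b η prox) (hx₀ : x₀ ∈ p.X) (hJ : J.Nonempty)
    (hη : 0 < η) (hc : 0 < η⁻¹ - L) {x y : E} (hx : x ∈ p.X) (hy : y ∈ p.X)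
    {I : Finset (Fin n)} (hI : I ∈ Finset.powersetCard b Finset.univ) {δ : E}
    (hδ : δ = p.batchGrad I x - p.fullGrad x - (p.batchGrad I x₀ - p.fullGrad x₀))
    (hfin : conjE G ((η⁻¹ - L)⁻¹ • δ) ≠ ⊤) {z : E} (hz : z = prox (p.vrGrad J I x₀ x) x) :
    p.F z - p.F y + η⁻¹ * bregman p.w y z + inner ℝ (p.batchGrad J x₀ - p.fullGrad x₀) (z - y)
      ≤ η⁻¹ * bregman p.w y x + (η⁻¹ - L) * (conjE G ((η⁻¹ - L)⁻¹ • δ)).toReal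
        + (-1) * inner ℝ δ (x - y) := by
  obtain ⟨hzX, hmin⟩ := hprox x₀ hx₀ x hx J I hJ (Finset.mem_powersetCard.1 hI).2
  rw [← hz] at hzX hmin
  have h1 := hp.F_sub_le hn hx y z
  have h2 := hp.prox_three_point hzX hy hmin
  have h3 := hp.B1 z hzX x hx
  -- The constant `η⁻¹ - L` is what the proximal term can still pay: with `L G(z - x)` from
  -- smoothness it makes `η⁻¹ G(z - x)`, which is at most `η⁻¹ D_w(z, x)` by B1.
  have h4 := inner_le_of_conjE_smul_ne_top hc hfin (x - z)
  have h5 : p.vrGrad J I x₀ x = p.fullGrad x + δ + (p.batchGrad J x₀ - p.fullGrad x₀) := by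
    rw [hδ, vrGrad]; abel
  have h6 : G (x - z) = G (z - x) := by rw [← hs, neg_sub]
  have h7 : inner ℝ δ (z - y) = inner ℝ δ (x - y) - inner ℝ δ (x - z) := by
    rw [← inner_sub_right]; congr 1; abel
  rw [h5, inner_add_left, inner_add_left] at h2
  rw [h6] at h4
  have h8 : 0 ≤ η⁻¹ * (bregman p.w z x - G (z - x)) :=
    mul_nonneg (by positivity) (sub_nonneg.2 h3)
  linarith

/-- The average of `step_pointwise` over the mini-batch. The pairing of the noise with `x - y`
vanishes because neither point depends on the mini-batch; the pairing with the batch error stays on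
the left, to be treated over the whole epoch. -/
theorem step_le [MeasurableSpace E] [BorelSpace E] (hp : p.Assumptions G L μ xs)
    (hG : IsCHEF g CG G) (hCG : 0 < CG)
    (hb : 0 < b) (hbn : b ≤ n) (hprox : p.IsProxMap b η prox) (hx₀ : x₀ ∈ p.X) (hJ : J.Nonempty)
    (hη : 0 < η) (hr : 0 < r) (hc : 0 < η⁻¹ - L) (hL : L ≤ (η⁻¹ - L) * b * g r / 4)
    {x y : E} (hx : x ∈ p.X) (hy : y ∈ p.X) :
    stepMean p prox b J x₀ (fun z => p.F z - p.F y + η⁻¹ * bregman p.w y z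
        + inner ℝ (p.batchGrad J x₀ - p.fullGrad x₀) (z - y)) x
      ≤ η⁻¹ * bregman p.w y x
        + 2 * CG * r * ((p.F x - p.F xs) + (p.F x₀ - p.F xs)) := by
  have hn : 0 < n := hb.trans_le hbn
  obtain ⟨h1, h2⟩ := hp.step_noise hG hCG hb hbn hx hx₀ hr hc hL
  refine (batchMean_mono fun I hI => hp.step_pointwise hG.symm hn hprox hx₀ hJ hη hc hx hy hI rfl
    (h1 I hI) rfl).trans ?_
  rw [batchMean_add, batchMean_add, batchMean_const hbn, batchMean_mul_left, batchMean_mul_left]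
  have h3 : batchMean n b (fun I => inner ℝ
      (p.batchGrad I x - p.fullGrad x - (p.batchGrad I x₀ - p.fullGrad x₀)) (x - y)) = 0 := by
    rw [← batchMean_inner_eq_zero (n := n) (k := b) (fun i => gradient (p.f i) x - p.fullGrad x
      - (gradient (p.f i) x₀ - p.fullGrad x₀)) (by
        rw [Finset.sum_sub_distrib, sum_gradient_sub_fullGrad p hn, sum_gradient_sub_fullGrad p hn,
          sub_zero]) (b : ℝ)⁻¹ (x - y)]
    simp only [batchMean]
    congr 1
    refine Finset.sum_congr rfl fun I hI => ?_
    have hI' := (Finset.mem_powersetCard.1 hI).2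
    rw [batchGrad_sub_fullGrad p hb hI', batchGrad_sub_fullGrad p hb hI', ← smul_sub,
      ← Finset.sum_sub_distrib]
  rw [h3]
  linarith

/-- One inner step: the comparison with `x*` plus `ω` times the comparison with `x₀`. -/
theorem step_potential_le [MeasurableSpace E] [BorelSpace E] (hp : p.Assumptions G L μ xs)
    (hG : IsCHEF g CG G) (hCG : 0 < CG)
    (hb : 0 < b) (hbn : b ≤ n) (hprox : p.IsProxMap b η prox) (hx₀ : x₀ ∈ p.X) (hJ : J.Nonempty)
    (hη : 0 < η) (hr : 0 < r) (hc : 0 < η⁻¹ - L) (hL : L ≤ (η⁻¹ - L) * b * g r / 4)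
    (hω : 0 ≤ ω) {x : E} (hx : x ∈ p.X) :
    stepMean p prox b J x₀ (fun z =>
        (1 + ω) * (p.F z - p.F xs + inner ℝ (p.batchGrad J x₀ - p.fullGrad x₀) (z - x₀))
          + η⁻¹ * (bregman p.w xs z + ω * bregman p.w x₀ z)) x
      ≤ (η⁻¹ * (bregman p.w xs x + ω * bregman p.w x₀ x)
          + (1 + ω) * (2 * CG * r) * (p.F x - p.F xs))
        + ((ω + (1 + ω) * (2 * CG * r)) * (p.F x₀ - p.F xs)
          + inner ℝ (p.batchGrad J x₀ - p.fullGrad x₀) (xs - x₀)) := by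
  set e := p.batchGrad J x₀ - p.fullGrad x₀ with he
  have h1 := hp.step_le hG hCG hb hbn hprox hx₀ hJ hη hr hc hL hx hp.mem
  have h2 := hp.step_le hG hCG hb hbn hprox hx₀ hJ hη hr hc hL hx hx₀
  rw [← he] at h1 h2
  -- The split `z - x* = (z - x₀) + (x₀ - x*)` isolates a pairing that does not depend on the
  -- iterate.
  have h3 : (fun z => (1 + ω) * (p.F z - p.F xs + inner ℝ e (z - x₀))
          + η⁻¹ * (bregman p.w xs z + ω * bregman p.w x₀ z))
      = fun z => (p.F z - p.F xs + η⁻¹ * bregman p.w xs z + inner ℝ e (z - xs))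
        + ω * (p.F z - p.F x₀ + η⁻¹ * bregman p.w x₀ z + inner ℝ e (z - x₀))
        + (ω * (p.F x₀ - p.F xs) + inner ℝ e (xs - x₀)) := by
    funext z
    simp only [inner_sub_right]
    ring
  have h4 := mul_le_mul_of_nonneg_left h2 hω
  rw [h3]
  simp only [stepMean] at h1 h4 ⊢
  rw [batchMean_add, batchMean_add, batchMean_const hbn, batchMean_mul_left]
  linarith

/-- The weighted sum over the steps of an epoch, for a given batch. -/
theorem inner_sum_le [MeasurableSpace E] [BorelSpace E] (hp : p.Assumptions G L μ xs)
    (hG : IsCHEF g CG G) (hCG : 0 < CG)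
    (hb : 0 < b) (hbn : b ≤ n) (hprox : p.IsProxMap b η prox) (hx₀ : x₀ ∈ p.X) (hJ : J.Nonempty)
    (hη : 0 < η) (hr : 0 < r) (hc : 0 < η⁻¹ - L) (hL : L ≤ (η⁻¹ - L) * b * g r / 4)
    (hω : 0 ≤ ω) {γ c : ℝ} (hγ0 : 0 ≤ γ) (hγ1 : γ < 1) (hc0 : 0 < c)
    (hcω : (1 + ω) * c = (1 - γ) * η⁻¹ * ω)
    (hfin : conjE G (c⁻¹ • (p.batchGrad J x₀ - p.fullGrad x₀)) ≠ ⊤) (K : ℕ) :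
    ∑ k ∈ Finset.range (K + 1), (1 - γ) * γ ^ k * innerMean p prox b J x₀ k (fun z =>
        (1 + ω) * (1 - γ * (2 * CG * r)) * (p.F z - p.F xs) + (1 - γ) * η⁻¹ * bregman p.w xs z)
      ≤ (1 - γ) * ((1 + ω) * (p.F x₀ - p.F xs) + η⁻¹ * bregman p.w xs x₀)
        + (1 - γ ^ (K + 1)) * ((1 + ω) *
          (c * (conjE G (c⁻¹ • (p.batchGrad J x₀ - p.fullGrad x₀))).toReal))
        + (γ - γ ^ (K + 1)) * ((ω + (1 + ω) * (2 * CG * r)) * (p.F x₀ - p.F xs)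
          + inner ℝ (p.batchGrad J x₀ - p.fullGrad x₀) (xs - x₀)) := by
  set e := p.batchGrad J x₀ - p.fullGrad x₀ with he
  set v := 2 * CG * r with hv
  have hv0 : 0 < v := by positivity
  set cost := (1 + ω) * (c * (conjE G (c⁻¹ • e)).toReal) with hcost
  set C := (ω + (1 + ω) * v) * (p.F x₀ - p.F xs) + inner ℝ e (xs - x₀) with hC
  let Φ : E → ℝ := fun z =>
    (1 + ω) * (1 - γ * v) * (p.F z - p.F xs) + (1 - γ) * η⁻¹ * bregman p.w xs z
  let Ψ : E → ℝ := fun z => (1 + ω) * (p.F z - p.F xs + inner ℝ e (z - x₀))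
          + η⁻¹ * (bregman p.w xs z + ω * bregman p.w x₀ z)
  let R : E → ℝ := fun z => η⁻¹ * (bregman p.w xs z + ω * bregman p.w x₀ z)
          + (1 + ω) * v * (p.F z - p.F xs)
  let M : ℕ → (E → ℝ) → ℝ := innerMean p prox b J x₀
  have hR : ∀ z ∈ p.X, 0 ≤ R z := fun z hz => by
    have h1 := hp.bregman_nonneg hG.nonneg hp.mem hz
    have h2 := hp.bregman_nonneg hG.nonneg hx₀ hz
    have h3 := hp.gap_nonneg hz
    positivity
  have hMR : ∀ k, 0 ≤ M k R := fun k => by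
    have := innerMean_mono hprox hx₀ hJ k (φ := fun _ => 0) (χ := R) hR
    rwa [innerMean_const hbn] at this
  -- Fenchel–Young for the batch error at scale `c`. By `hcω`, the resulting `(1 + ω) c G(x₀ - z)`
  -- is covered by the `D_w(x₀, z)` that remains in `Ψ - γ R`.
  have hΦ : ∀ z ∈ p.X, Φ z ≤ Ψ z + ((-γ) * R z + cost) := by
    intro z hz
    have h1 := inner_le_of_conjE_smul_ne_top hc0 hfin (x₀ - z)
    have h2 := hp.B1 x₀ hx₀ z hz
    have h3 : inner ℝ e (z - x₀) = - inner ℝ e (x₀ - z) := by rw [← inner_neg_right, neg_sub]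
    have h4 := mul_le_mul_of_nonneg_left h1 (by positivity : (0 : ℝ) ≤ 1 + ω)
    have h5 : (1 + ω) * (c * G (x₀ - z)) ≤ (1 - γ) * η⁻¹ * ω * bregman p.w x₀ z := by
      rw [← hcω, ← mul_assoc]
      gcongr
    simp only [Φ, Ψ, R, h3, hcost]
    linarith
  have hMΦ : ∀ k, M k Φ ≤ M k Ψ + ((-γ) * M k R + cost) := fun k => by
    have := innerMean_mono hprox hx₀ hJ k hΦ
    rwa [innerMean_add k Ψ fun z => (-γ) * R z + cost,
      innerMean_add k (fun z => (-γ) * R z) fun _ => cost, innerMean_mul_left k (-γ) R,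
      innerMean_const hbn] at this
  have hstep : ∀ k, M (k + 1) Ψ ≤ M k R + C := fun k => by
    have h1 : M (k + 1) Ψ ≤ M k (fun x => R x + C) :=
      innerMean_mono hprox hx₀ hJ k fun x hx =>
        hp.step_potential_le hG hCG hb hbn hprox hx₀ hJ hη hr hc hL hω hx
    exact h1.trans_eq ((innerMean_add k R fun _ => C).trans (by rw [innerMean_const hbn]))
  have h0 : Ψ x₀ = (1 + ω) * (p.F x₀ - p.F xs) + η⁻¹ * bregman p.w xs x₀ := by
    simp [Ψ, bregman_self]
  -- Telescoping: the term `-γ * γ ^ k * M k R` of step `k` cancels `γ ^ (k + 1) * M (k + 1) Ψ` up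
  -- to the constant `C`. The last uncancelled `R` term is kept on the left and dropped at the end.
  have key : ∀ K : ℕ, ∑ k ∈ Finset.range (K + 1), (1 - γ) * γ ^ k * M k Φ
        + (1 - γ) * γ ^ (K + 1) * M K R
      ≤ (1 - γ) * Ψ x₀ + (1 - γ ^ (K + 1)) * cost + (γ - γ ^ (K + 1)) * C := by
    intro K
    induction K with
    | zero =>
      have h1 := mul_le_mul_of_nonneg_left (hMΦ 0) (sub_nonneg.2 hγ1.le)
      have h2 : M 0 Ψ = Ψ x₀ := rfl
      rw [h2] at h1
      simp only [zero_add, Finset.sum_range_one, pow_zero, pow_one, mul_one, sub_self, zero_mul,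
        add_zero]
      linarith
    | succ K ih =>
      rw [Finset.sum_range_succ]
      have hw : 0 ≤ (1 - γ) * γ ^ (K + 1) :=
        mul_nonneg (sub_nonneg.2 hγ1.le) (pow_nonneg hγ0 _)
      have h1 := mul_le_mul_of_nonneg_left ((hMΦ (K + 1)).trans (add_le_add_left (hstep K) _)) hw
      have h2 : γ ^ (K + 1 + 1) = γ * γ ^ (K + 1) := pow_succ' _ _
      rw [h2]
      linarith
  have h1 := key K
  rw [h0] at h1
  have h2 : 0 ≤ (1 - γ) * γ ^ (K + 1) * M K R :=
    mul_nonneg (mul_nonneg (sub_nonneg.2 hγ1.le) (pow_nonneg hγ0 _)) (hMR K)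
  linarith

end CompositeProblem.Assumptions

/-! ### One epoch -/

section Epoch

variable {E : Type u} [NormedAddCommGroup E] [InnerProductSpace ℝ E] [CompleteSpace E]
  {n : ℕ} {p : CompositeProblem E n} {G : E → ℝ}
  {L μ CG η r ω : ℝ} {xs x₀ : E} {g : ℝ → ℝ} {b : ℕ} {prox : E → E → E}

theorem geomLaw_apply {γ : ℝ} (h0 : 0 ≤ γ) (h1 : γ < 1) (k : ℕ) :
    geomLaw γ k = ENNReal.ofReal ((1 - γ) * γ ^ k) := by
  have h : geomLaw γ = ⟨fun k => ENNReal.ofReal ((1 - γ) * γ ^ k), geom_hasSum ⟨h0, h1⟩⟩ :=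
    dif_pos ⟨h0, h1⟩
  rw [h]
  rfl

theorem expect_epoch (m : ℝ) (B : ℕ) (x : E) (φ : E × ℕ → ℝ≥0∞) :
    expect (epoch p prox b m B x) φ = expect (uniformBatch n B) fun J =>
      expect (geomLaw (m / (m + b))) fun N =>
        expect (innerLoop p prox b J x N) fun y => φ (y, b * N + B) := by
  simp only [epoch, expect_bind, expect_map]

theorem nonempty_of_mem_powersetCard {k : ℕ} (hk : 0 < k) {J : Finset (Fin n)}
    (hJ : J ∈ Finset.powersetCard k Finset.univ) : J.Nonempty :=
  Finset.card_pos.1 ((Finset.mem_powersetCard.1 hJ).2 ▸ hk)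

/-- The epoch inequality, for general parameters. -/
theorem CompositeProblem.Assumptions.expect_epoch_le [MeasurableSpace E] [BorelSpace E]
    (hp : p.Assumptions G L μ xs) (hG : IsCHEF g CG G) (hCG : 0 < CG)
    (hb : 0 < b) (hbn : b ≤ n) (hprox : p.IsProxMap b η prox) (hx₀ : x₀ ∈ p.X)
    (hη : 0 < η) (hr : 0 < r) (hc : 0 < η⁻¹ - L) (hL : L ≤ (η⁻¹ - L) * b * g r / 4)
    (hω : 0 ≤ ω) {m γ c S : ℝ} (hγ : γ = m / (m + b)) (hγ0 : 0 ≤ γ) (hγ1 : γ < 1) (hc0 : 0 < c)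
    (hcω : (1 + ω) * c = (1 - γ) * η⁻¹ * ω) (hv : γ * (2 * CG * r) ≤ 1)
    {B : ℕ} (hB : 0 < B) (hBn : B ≤ n)
    (hfin : ∀ J ∈ Finset.powersetCard B Finset.univ,
      conjE G (c⁻¹ • (p.batchGrad J x₀ - p.fullGrad x₀)) ≠ ⊤)
    (hS : c * batchMean n B (fun J =>
      (conjE G (c⁻¹ • (p.batchGrad J x₀ - p.fullGrad x₀))).toReal) ≤ S) :
    expect (epoch p prox b m B x₀) (fun s => ENNReal.ofReal (
        (1 + ω) * (1 - γ * (2 * CG * r)) * (p.F s.1 - p.F xs)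
          + (1 - γ) * η⁻¹ * bregman p.w xs s.1))
      ≤ ENNReal.ofReal ((1 - γ) * ((1 + ω) * (p.F x₀ - p.F xs) + η⁻¹ * bregman p.w xs x₀)
        + (1 + ω) * S + γ * ((ω + (1 + ω) * (2 * CG * r)) * (p.F x₀ - p.F xs))) := by
  have hn : 0 < n := hb.trans_le hbn
  have hγ' : 0 ≤ 1 - γ := sub_nonneg.2 hγ1.le
  have hη' : 0 ≤ η⁻¹ := by positivity
  let Φ : E → ℝ := fun z =>
    (1 + ω) * (1 - γ * (2 * CG * r)) * (p.F z - p.F xs) + (1 - γ) * η⁻¹ * bregman p.w xs z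
  have hΦ : ∀ z ∈ p.X, 0 ≤ Φ z := fun z hz =>
    add_nonneg (mul_nonneg (mul_nonneg (by positivity) (sub_nonneg.2 hv)) (hp.gap_nonneg hz))
      (mul_nonneg (mul_nonneg hγ' hη') (hp.bregman_nonneg hG.nonneg hp.mem hz))
  have hM : ∀ J ∈ Finset.powersetCard B Finset.univ, ∀ k, 0 ≤ innerMean p prox b J x₀ k Φ := by
    intro J hJ k
    have := innerMean_mono hprox hx₀ (nonempty_of_mem_powersetCard hB hJ) k
      (φ := fun _ => 0) (χ := Φ) hΦ
    rwa [innerMean_const hbn] at this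
  rw [expect_epoch, ← hγ]
  have h1 : expect (uniformBatch n B) (fun J => expect (geomLaw γ) fun N =>
        expect (innerLoop p prox b J x₀ N) fun y => ENNReal.ofReal (Φ y))
      = ∑' N, expect (uniformBatch n B) fun J =>
          ENNReal.ofReal ((1 - γ) * γ ^ N * innerMean p prox b J x₀ N Φ) := by
    have h2 : ∀ J ∈ (uniformBatch n B).support, (expect (geomLaw γ) fun N =>
        expect (innerLoop p prox b J x₀ N) fun y => ENNReal.ofReal (Φ y))
        = ∑' N, ENNReal.ofReal ((1 - γ) * γ ^ N * innerMean p prox b J x₀ N Φ) := by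
      intro J hJ
      rw [mem_support_uniformBatch hBn] at hJ
      rw [expect]
      congr 1
      funext N
      rw [geomLaw_apply hγ0 hγ1, expect_innerLoop hprox hbn hx₀
        (nonempty_of_mem_powersetCard hB hJ) N hΦ, ← ENNReal.ofReal_mul
          (mul_nonneg hγ' (pow_nonneg hγ0 N))]
    rw [expect_congr h2]
    simp only [expect, ← ENNReal.tsum_mul_left]
    exact ENNReal.tsum_comm
  refine h1.trans_le (ENNReal.tsum_le_of_sum_range_le fun K => ?_)
  have hw : ∀ N, 0 ≤ (1 - γ) * γ ^ N := fun N => mul_nonneg hγ' (pow_nonneg hγ0 N)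
  calc ∑ N ∈ Finset.range K, expect (uniformBatch n B) (fun J =>
          ENNReal.ofReal ((1 - γ) * γ ^ N * innerMean p prox b J x₀ N Φ))
      ≤ ∑ N ∈ Finset.range (K + 1), expect (uniformBatch n B) (fun J =>
          ENNReal.ofReal ((1 - γ) * γ ^ N * innerMean p prox b J x₀ N Φ)) :=
        Finset.sum_le_sum_of_subset (Finset.range_mono K.le_succ)
    _ = ENNReal.ofReal (batchMean n B fun J => ∑ N ∈ Finset.range (K + 1),
          (1 - γ) * γ ^ N * innerMean p prox b J x₀ N Φ) := by
        rw [batchMean_sum, ENNReal.ofReal_sum_of_nonneg fun N _ =>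
          batchMean_nonneg fun J hJ => mul_nonneg (hw N) (hM J hJ N)]
        exact Finset.sum_congr rfl fun N _ => expect_uniformBatch_ofReal hBn fun J hJ =>
          mul_nonneg (hw N) (hM J hJ N)
    _ ≤ _ := by
        apply ENNReal.ofReal_le_ofReal
        refine (batchMean_mono fun J hJ => hp.inner_sum_le hG hCG hb hbn hprox hx₀
          (nonempty_of_mem_powersetCard hB hJ) hη hr hc hL hω hγ0 hγ1 hc0 hcω (hfin J hJ) K).trans ?_
        -- Here the batch error is centred, since `x₀` and `x*` do not depend on the batch.
        have h3 : batchMean n B (fun J => inner ℝ (p.batchGrad J x₀ - p.fullGrad x₀) (xs - x₀))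
            = 0 := by
          rw [← batchMean_inner_eq_zero (k := B) (fun i => gradient (p.f i) x₀ - p.fullGrad x₀)
            (CompositeProblem.sum_gradient_sub_fullGrad p hn x₀) (B : ℝ)⁻¹ (xs - x₀)]
          simp only [batchMean]
          congr 1
          exact Finset.sum_congr rfl fun J hJ => by
            rw [CompositeProblem.batchGrad_sub_fullGrad p hB (Finset.mem_powersetCard.1 hJ).2]
        rw [batchMean_add, batchMean_add, batchMean_const hBn, batchMean_mul_left,
          batchMean_mul_left, batchMean_mul_left, batchMean_mul_left, batchMean_add,
          batchMean_const hBn, h3, add_zero]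
        have hpow := pow_nonneg hγ0 (K + 1)
        have hgap := hp.gap_nonneg hx₀
        have hmean : 0 ≤ batchMean n B (fun J =>
            (conjE G (c⁻¹ • (p.batchGrad J x₀ - p.fullGrad x₀))).toReal) :=
          batchMean_nonneg fun J _ => ENNReal.toReal_nonneg
        refine add_le_add (add_le_add le_rfl ?_) ?_
        · calc _ ≤ 1 * ((1 + ω) * (c * batchMean n B (fun J =>
              (conjE G (c⁻¹ • (p.batchGrad J x₀ - p.fullGrad x₀))).toReal))) := by
                gcongr; linarith
            _ ≤ _ := by rw [one_mul]; gcongr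
        · gcongr
          linarith

end Epoch

/-! ### Constants of the tuned algorithm and the contraction factor. -/

namespace Tuning

/-- The contraction constant `α^{1/ξ}`. -/
noncomputable def a (t : Tuning) : ℝ := t.α ^ (1 / t.ξ)

/-- The weight of the Bregman divergence in the potential. -/
noncomputable def u (t : Tuning) : ℝ :=
  t.b / (t.θ * (1 + 1 / (3 * t.a)) * (1 - 1 / (6 * t.a)))

/-- The weight of the gradient deviation `D_H`. -/
noncomputable def cH (t : Tuning) : ℝ := 5 / 4 * t.CG / (1 - 1 / (6 * t.a))

/-- The regularity of `g` that is part of the definition of a CHEF. -/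
structure Regular (t : Tuning) : Prop where
  g_mono : MonotoneOn t.g (Set.Ici 0)
  g_pos : ∀ s, 0 < s → 0 < t.g s

variable {t : Tuning}

namespace Admissible

theorem a_gt (ht : t.Admissible) : 1 < t.a :=
  Real.one_lt_rpow ht.α_gt (by have := ht.ξ_pos; positivity)

theorem α_le_a (ht : t.Admissible) : t.α ≤ t.a := by
  have h : (1 : ℝ) ≤ 1 / t.ξ := by rw [le_div_iff₀ ht.ξ_pos]; linarith [ht.ξ_lt]
  simpa [a] using Real.rpow_le_rpow_of_exponent_le ht.α_gt.le h

theorem m₀_ge_b (ht : t.Admissible) : 4 * t.a * t.b ≤ t.m₀ := by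
  have h := ht.m₀_ge
  have h1 := le_max_left (t.b : ℝ) (4 * t.CG)
  have h2 := ht.a_gt
  calc 4 * t.a * t.b ≤ 4 * t.a * max (t.b : ℝ) (4 * t.CG) := by gcongr
    _ ≤ _ := h

theorem m₀_ge_CG (ht : t.Admissible) : 16 * t.a * t.CG ≤ t.m₀ := by
  have h := ht.m₀_ge
  have h1 := le_max_right (t.b : ℝ) (4 * t.CG)
  have h2 := ht.a_gt
  calc 16 * t.a * t.CG = 4 * t.a * (4 * t.CG) := by ring
    _ ≤ 4 * t.a * max (t.b : ℝ) (4 * t.CG) := by gcongr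
    _ ≤ _ := h

theorem b_ge (ht : t.Admissible) : (1 : ℝ) ≤ t.b := by exact_mod_cast ht.b_pos

theorem m₀_gt (ht : t.Admissible) : 4 < t.m₀ := by
  have h1 := ht.m₀_ge_b
  have h2 := ht.a_gt
  have h3 := ht.b_ge
  nlinarith

theorem m_ge (ht : t.Admissible) {τ : ℝ} (hτ : 0 ≤ τ) : t.m₀ ≤ t.m τ := by
  have h := Real.one_le_rpow ht.α_gt.le hτ
  have h1 := ht.m₀_gt
  rw [m]
  nlinarith

theorem g₀_pos (ht : t.Admissible) (hg : t.Regular) : 0 < t.g₀ := by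
  have h1 := ht.a_gt
  have h2 := ht.CG_pos
  exact hg.g_pos _ (by rw [a] at h1; positivity)

theorem u_pos (ht : t.Admissible) : 0 < t.u := by
  have h1 := ht.a_gt
  have h2 := ht.θ_pos
  have h3 := ht.b_ge
  have h4 : 1 / (6 * t.a) < 1 := by rw [div_lt_one (by positivity)]; linarith
  have h5 : 0 < 1 - 1 / (6 * t.a) := by linarith
  rw [u]
  positivity

theorem cH_pos (ht : t.Admissible) : 0 < t.cH := by
  have h1 := ht.a_gt
  have h2 := ht.CG_pos
  have h4 : 1 / (6 * t.a) < 1 := by rw [div_lt_one (by positivity)]; linarith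
  have h5 : 0 < 1 - 1 / (6 * t.a) := by linarith
  rw [cH]
  positivity

theorem rawBatch_pos (ht : t.Admissible) (hg : t.Regular) (τ : ℝ) : 0 < t.rawBatch τ := by
  have h1 := ht.a_gt
  have h2 := ht.g₀_pos hg
  have h3 := ht.m₀_gt
  have h4 := ht.α_gt
  have h5 : 0 < t.m τ := by rw [m]; positivity
  have h6 := hg.g_pos (1 / t.m τ) (by positivity)
  rw [a] at h1
  rw [rawBatch]
  positivity

theorem B_pos (ht : t.Admissible) (hg : t.Regular) {n : ℕ} (hn : 0 < n) (j : ℕ) :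
    0 < t.B n j :=
  lt_min (Nat.ceil_pos.2 (ht.rawBatch_pos hg j)) hn

/-- The contraction factor of an epoch. -/
theorem contraction (ht : t.Admissible) {m : ℝ} (hm : t.m₀ ≤ m) :
    t.b / m + (1 / (3 * t.a)) / (1 + 1 / (3 * t.a)) + 1 / (6 * t.a) + 5 / 2 * t.CG / m
      ≤ t.a⁻¹ * (1 - 1 / (6 * t.a)) := by
  have ha := ht.a_gt
  have hb := ht.m₀_ge_b
  have hCG := ht.m₀_ge_CG
  have hm0 : 0 < m := by linarith [ht.m₀_gt]
  have h1 : t.b / m ≤ 1 / (4 * t.a) := by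
    rw [div_le_div_iff₀ hm0 (by positivity)]; linarith
  have h2 : 5 / 2 * t.CG / m ≤ 5 / (32 * t.a) := by
    rw [div_le_div_iff₀ hm0 (by positivity)]; linarith
  have h3 : (1 / (3 * t.a)) / (1 + 1 / (3 * t.a)) = 1 / (3 * t.a + 1) := by field_simp
  have h4 : 1 / (3 * t.a + 1) + 1 / (6 * t.a) * t.a⁻¹ ≤ 5 / (12 * t.a) := by
    have : 5 / (12 * t.a) - (1 / (3 * t.a + 1) + 1 / (6 * t.a) * t.a⁻¹)
        = (3 * t.a + 2) * (t.a - 1) / (12 * t.a ^ 2 * (3 * t.a + 1)) := by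
      field_simp; ring
    have h5 : 0 ≤ (3 * t.a + 2) * (t.a - 1) / (12 * t.a ^ 2 * (3 * t.a + 1)) :=
      div_nonneg (mul_nonneg (by positivity) (by linarith)) (by positivity)
    linarith
  have h5 : t.a⁻¹ * (1 - 1 / (6 * t.a)) = t.a⁻¹ - 1 / (6 * t.a) * t.a⁻¹ := by ring
  -- The bounds on the contributions add up to `95/96` of the available `a⁻¹`; the constants in the
  -- lower bound on `m₀` fit this budget.
  have h6 : 1 / (4 * t.a) + 5 / (12 * t.a) + 1 / (6 * t.a) + 5 / (32 * t.a) ≤ t.a⁻¹ := by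
    have : t.a⁻¹ - (1 / (4 * t.a) + 5 / (12 * t.a) + 1 / (6 * t.a) + 5 / (32 * t.a))
        = 1 / (96 * t.a) := by field_simp; norm_num
    have h7 : 0 ≤ 1 / (96 * t.a) := by positivity
    linarith
  rw [h3, h5]
  linarith

end Admissible

end Tuning

/-! ### The epoch inequality with the tuned parameters. -/

section TunedEpoch

variable {E : Type u} [NormedAddCommGroup E] [InnerProductSpace ℝ E] [CompleteSpace E]
  [MeasurableSpace E] [BorelSpace E]
  {n : ℕ} {p : CompositeProblem E n} {G : E → ℝ}
  {L μ η : ℝ} {xs x₀ : E} {prox : E → E → E} {t : Tuning}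

/-- The indicator of a truncated batch. -/
noncomputable def Tuning.ind (t : Tuning) (n j : ℕ) : ℝ := if t.B n j < n then 1 else 0

set_option maxHeartbeats 1000000 in
/-- The epoch inequality for the tuned parameters. -/
theorem CompositeProblem.Assumptions.tuned_epoch_le (hp : p.Assumptions G L μ xs)
    (ht : t.Admissible) (hG : IsCHEF t.g t.CG G) (hbn : t.b ≤ n) (hηL : η * L = t.θ)
    (hfin : ∀ i, convexConj G (p.gradDev L xs i) ≠ ⊤)
    (hprox : p.IsProxMap t.b η prox) (hx₀ : x₀ ∈ p.X) (j : ℕ) :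
    expect (epoch p prox t.b (t.m j) (t.B n j) x₀) (fun s => ENNReal.ofReal (
        (p.F s.1 - p.F xs) + t.u / t.m j * (L * bregman p.w xs s.1)))
      ≤ ENNReal.ofReal (t.a⁻¹ * (p.F x₀ - p.F xs) + t.u / t.m j * (L * bregman p.w xs x₀)
          + t.cH / t.m j * p.DH G L xs * t.ind n j) := by
  have hLp := hp.L_pos
  have hθ := ht.θ_pos
  have hη : 0 < η := by
    by_contra! h
    nlinarith
  have hb := ht.b_pos
  have hb1 := ht.b_ge
  have hn : 0 < n := hb.trans_le hbn
  have hCG := ht.CG_pos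
  have ha := ht.a_gt
  have hreg : t.Regular := ⟨hG.g_mono, hG.g_pos⟩
  have hg₀ := ht.g₀_pos hreg
  have hθ1 : 6 * t.θ ≤ 1 := ht.θ_le.trans (min_le_left _ _)
  have hθ2 : 6 * t.θ ≤ t.g₀ * t.b := ht.θ_le.trans (min_le_right _ _)
  have hm : t.m₀ ≤ t.m j := ht.m_ge (Nat.cast_nonneg j)
  have hcontr := ht.contraction hm
  -- Either the batch is everything, and its error vanishes, or it has at least the prescribed size.
  have hindcase : t.B n j = n ∧ t.ind n j = 0 ∨ t.rawBatch j ≤ t.B n j ∧ t.ind n j = 1 := by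
    by_cases h : t.B n j < n
    · right
      refine ⟨?_, if_pos h⟩
      have h1 : t.B n j = ⌈t.rawBatch j⌉₊ := by
        rcases min_choice ⌈t.rawBatch j⌉₊ n with h2 | h2
        · exact h2
        · exact absurd h2 (by rw [Tuning.B] at h; omega)
      rw [h1]
      exact Nat.le_ceil _
    · left
      exact ⟨le_antisymm (min_le_right _ _) (not_lt.1 h), if_neg h⟩
  set m := t.m j with hmdef
  have hm0 : 0 < m := by linarith [ht.m₀_gt]
  have hm4b : 4 * (t.b : ℝ) ≤ m := by
    have := ht.m₀_ge_b
    nlinarith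
  set a := t.a with hadef
  set ω : ℝ := 1 / (3 * a) with hω
  have hω0 : 0 < ω := by positivity
  -- This `r` makes the mini-batch noise coefficient `2 C_G r` equal to `1/(6a)`, and `g r` is the
  -- constant `g₀` of the tuning.
  set r : ℝ := 1 / (12 * t.CG * a) with hrdef
  have hr : 0 < r := by positivity
  have hgr : t.g r = t.g₀ := rfl
  have hv : 2 * t.CG * r = 1 / (6 * a) := by rw [hrdef]; field_simp; norm_num
  set γ : ℝ := m / (m + t.b) with hγ
  have hγ1' : 1 - γ = t.b / (m + t.b) := by rw [hγ]; field_simp; ring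
  have hγ0 : 0 < γ := by positivity
  have hγ1 : γ < 1 := by rw [hγ, div_lt_one (by positivity)]; linarith
  have hηL' : η⁻¹ = L / t.θ := by rw [← hηL]; field_simp
  have hstep : L ≤ (η⁻¹ - L) * t.b * t.g r / 4 := by
    rw [hgr, hηL']
    -- The two parts of the step size condition: `6θ ≤ 1` keeps five sixths of `η⁻¹`, and `6θ ≤ g₀
    -- b` makes the right side of `hstep` at least `5L/4`.
    have h1 : 5 / 6 * (L / t.θ) ≤ L / t.θ - L := by
      have : L ≤ 1 / 6 * (L / t.θ) := by
        rw [div_mul_div_comm, le_div_iff₀ (by positivity)]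
        nlinarith
      linarith
    have h2 : 5 * L ≤ 5 / 6 * (L / t.θ) * (t.g₀ * t.b) := by
      calc 5 * L = 5 / 6 * (L / t.θ) * (6 * t.θ) := by field_simp
        _ ≤ _ := by gcongr
    have h3 := mul_le_mul_of_nonneg_right h1 (by positivity : 0 ≤ t.g₀ * t.b)
    linarith
  have hc : 0 < η⁻¹ - L := by
    rw [hηL']
    have : L < L / t.θ := by
      rw [lt_div_iff₀ hθ]; nlinarith
    linarith
  set c : ℝ := (1 - γ) * η⁻¹ * ω / (1 + ω) with hcdef
  have h1γ : 0 < 1 - γ := by linarith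
  have hc0 : 0 < c := by positivity
  have hcω : (1 + ω) * c = (1 - γ) * η⁻¹ * ω := by rw [hcdef]; field_simp
  have hBpos := ht.B_pos hreg hn j
  have hBn : t.B n j ≤ n := min_le_right _ _
  have hDH := p.DH_nonneg hG.zero hLp xs
  have hgap := hp.gap_nonneg hx₀
  have hnoise : (∀ J ∈ Finset.powersetCard (t.B n j) Finset.univ,
        conjE G (c⁻¹ • (p.batchGrad J x₀ - p.fullGrad x₀)) ≠ ⊤) ∧
      c * batchMean n (t.B n j) (fun J =>
        (conjE G (c⁻¹ • (p.batchGrad J x₀ - p.fullGrad x₀))).toReal)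
        ≤ t.CG * (1 / m) * (2 * (p.F x₀ - p.F xs) + p.DH G L xs * t.ind n j) := by
    rcases hindcase with ⟨hB, hi⟩ | ⟨hB, hi⟩
    · have h1 : ∀ J ∈ Finset.powersetCard (t.B n j) (Finset.univ : Finset (Fin n)),
          conjE G (c⁻¹ • (p.batchGrad J x₀ - p.fullGrad x₀)) = 0 := by
        intro J hJ
        have h2 : J = Finset.univ := by
          rw [← Finset.card_eq_iff_eq_univ, (Finset.mem_powersetCard.1 hJ).2, hB, Fintype.card_fin]
        rw [h2, CompositeProblem.fullGrad, sub_self, smul_zero, conjE_zero hG.nonneg]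
      refine ⟨fun J hJ => by rw [h1 J hJ]; simp, ?_⟩
      have h3 : batchMean n (t.B n j) (fun J =>
          (conjE G (c⁻¹ • (p.batchGrad J x₀ - p.fullGrad x₀))).toReal) = 0 := by
        rw [batchMean, Finset.sum_eq_zero fun J hJ => by rw [h1 J hJ]; simp, mul_zero]
      rw [h3, mul_zero, hi]
      positivity
    · rw [hi, mul_one]
      -- The epoch noise is taken with `r = 1/m`, which makes it of order `1/m`. The prescribed
      -- batch size gives `c B g(1/m) ≥ 12 a L/(3a + 1) ≥ 3L`.
      refine hp.epoch_noise hG hCG hfin hBpos hBn hx₀ (by positivity) hc0 ?_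
      have hgm := hreg.g_pos (1 / m) (by positivity)
      have h1 : 5 * a / 2 * t.g₀ * m ≤ t.B n j * t.g (1 / m) := by
        have : t.rawBatch j = 5 * a / 2 * t.g₀ * m / t.g (1 / m) := by
          rw [Tuning.rawBatch, ← hmdef]; simp only [hadef, Tuning.a]; ring
        rw [this, div_le_iff₀ hgm] at hB
        exact hB
      have h2 : 4 / 5 * (t.b : ℝ) ≤ (1 - γ) * m := by
        rw [hγ1', show t.b / (m + t.b) * m = t.b * m / (m + t.b) by ring,
          le_div_iff₀ (by positivity)]
        nlinarith only [hm4b, hb1]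
      have h3 : ω / (1 + ω) = 1 / (3 * a + 1) := by rw [hω]; field_simp
      have h4 : c = (1 - γ) * (L / t.θ) * (1 / (3 * a + 1)) := by
        rw [hcdef, hηL', ← h3]; ring
      have h5 : 3 * L ≤ L / t.θ * (1 / (3 * a + 1)) * (5 * a / 2) * (4 / 5 * (6 * t.θ)) := by
        have : L / t.θ * (1 / (3 * a + 1)) * (5 * a / 2) * (4 / 5 * (6 * t.θ))
            = 12 * a * L / (3 * a + 1) := by field_simp; norm_num
        rw [this, le_div_iff₀ (by positivity)]
        nlinarith only [hLp, ha, mul_pos hLp (sub_pos.2 ha)]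
      have h6 : c * (5 * a / 2 * t.g₀ * m) ≤ c * (t.B n j * t.g (1 / m)) := by gcongr
      have h7 : L / t.θ * (1 / (3 * a + 1)) * (5 * a / 2) * (4 / 5 * (6 * t.θ))
          ≤ L / t.θ * (1 / (3 * a + 1)) * (5 * a / 2) * (((1 - γ) * m) * t.g₀) := by
        refine mul_le_mul_of_nonneg_left ?_ (by positivity)
        calc 4 / 5 * (6 * t.θ) ≤ 4 / 5 * (t.g₀ * t.b) := by gcongr
          _ = (4 / 5 * t.b) * t.g₀ := by ring
          _ ≤ _ := by gcongr
      rw [h4] at h6 ⊢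
      linarith
  have hmain := hp.expect_epoch_le hG hCG hb hbn hprox hx₀ hη hr hc hstep hω0.le hγ hγ0.le hγ1 hc0
    hcω (by
      rw [hv, ← div_eq_mul_one_div, div_le_one (by positivity)]; linarith) hBpos hBn hnoise.1 hnoise.2
  have hv1 : 0 < 1 - 1 / (6 * a) := by
    have : 1 / (6 * a) < 1 := by rw [div_lt_one (by positivity)]; linarith
    linarith
  have hγinv : 1 / γ = 1 + t.b / m := by rw [hγ]; field_simp
  have hγinv' : 1 / γ ≤ 5 / 4 := by
    have : t.b / m ≤ 1 / 4 := by rw [div_le_div_iff₀ hm0 (by norm_num)]; linarith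
    linarith
  -- This normalization brings the coefficient of the gap on the left to at least one, because `γ (1
  -- - v) ≤ 1 - γ v` for `v = 1/(6a)`, and the weight of the divergence to exactly `u/m` on both
  -- sides.
  set q : ℝ := 1 / (γ * (1 + ω) * (1 - 1 / (6 * a))) with hq
  have hq0 : 0 < q := by positivity
  have hu : t.u / m = q * ((1 - γ) * t.θ⁻¹) := by
    rw [hq, hγ1', Tuning.u, ← hadef, ← hω, hγ]
    field_simp
  have hηB : ∀ y, η⁻¹ * bregman p.w xs y = t.θ⁻¹ * (L * bregman p.w xs y) := fun y => by
    rw [hηL']; ring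
  have hpt : ∀ s ∈ (epoch p prox t.b m (t.B n j) x₀).support, ENNReal.ofReal (
      (p.F s.1 - p.F xs) + t.u / m * (L * bregman p.w xs s.1))
      ≤ ENNReal.ofReal q * ENNReal.ofReal (
        (1 + ω) * (1 - γ * (2 * t.CG * r)) * (p.F s.1 - p.F xs)
          + (1 - γ) * η⁻¹ * bregman p.w xs s.1) := by
    intro s hs
    have hsX : s.1 ∈ p.X := by
      rw [epoch, PMF.mem_support_bind_iff] at hs
      obtain ⟨J, hJ, hs⟩ := hs
      rw [PMF.mem_support_bind_iff] at hs
      obtain ⟨N, -, hs⟩ := hs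
      rw [PMF.mem_support_map_iff] at hs
      obtain ⟨y, hy, rfl⟩ := hs
      exact support_innerLoop_subset hprox hbn hx₀
        (nonempty_of_mem_powersetCard hBpos ((mem_support_uniformBatch hBn).1 hJ)) N hy
    have hgs := hp.gap_nonneg hsX
    rw [← ENNReal.ofReal_mul hq0.le]
    apply ENNReal.ofReal_le_ofReal
    have h1 : q * ((1 - γ) * η⁻¹ * bregman p.w xs s.1)
        = t.u / m * (L * bregman p.w xs s.1) := by
      rw [mul_assoc (1 - γ), hηB, hu]; ring
    have h2 : 1 ≤ q * ((1 + ω) * (1 - γ * (2 * t.CG * r))) := by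
      rw [hv, hq, one_div, inv_mul_eq_div, le_div_iff₀ (by positivity)]
      nlinarith
    rw [mul_add, h1, ← mul_assoc]
    nlinarith
  refine (expect_mono hpt).trans ?_
  rw [expect_mul_left]
  refine (mul_le_mul_right hmain _).trans ?_
  rw [← ENNReal.ofReal_mul hq0.le]
  apply ENNReal.ofReal_le_ofReal
  have hid : q * ((1 - γ) * ((1 + ω) * (p.F x₀ - p.F xs) + η⁻¹ * bregman p.w xs x₀)
        + (1 + ω) * (t.CG * (1 / m) * (2 * (p.F x₀ - p.F xs) + p.DH G L xs * t.ind n j))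
        + γ * ((ω + (1 + ω) * (2 * t.CG * r)) * (p.F x₀ - p.F xs)))
      = (t.b / m + ω / (1 + ω) + 1 / (6 * a) + 2 * (1 / γ) * t.CG / m) * (p.F x₀ - p.F xs)
          / (1 - 1 / (6 * a))
        + t.u / m * (L * bregman p.w xs x₀)
        + (1 / γ) * t.CG / (1 - 1 / (6 * a)) / m * p.DH G L xs * t.ind n j := by
    rw [hηB, hu, hv]
    have hbm : t.b / m = (1 - γ) / γ := by rw [hγ1', hγ]; field_simp
    rw [hbm, hq]
    field_simp
    ring
  rw [hid]
  have hind : 0 ≤ t.ind n j := by rcases hindcase with h | h <;> simp [h.2]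
  refine add_le_add (add_le_add ?_ le_rfl) ?_
  · rw [div_le_iff₀ hv1]
    have h1 : 2 * (1 / γ) * t.CG / m ≤ 5 / 2 * t.CG / m := by
      gcongr; linarith
    calc _ ≤ (a⁻¹ * (1 - 1 / (6 * a))) * (p.F x₀ - p.F xs) := by
          gcongr
          linarith
      _ = _ := by ring
  · rw [Tuning.cH]
    gcongr

end TunedEpoch

/-! ### The run of the algorithm -/

section Run

variable {E : Type u} [NormedAddCommGroup E] [InnerProductSpace ℝ E] [CompleteSpace E]
  {n : ℕ} {p : CompositeProblem E n} {G : E → ℝ}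
  {L μ η : ℝ} {xs : E} {prox : E → E → E} {t : Tuning}

theorem expect_run_succ (x : E) (T : ℕ) (φ : E × ℕ → ℝ≥0∞) :
    expect (run t p prox x (T + 1)) φ = expect (run t p prox x T) fun s =>
      expect (epoch p prox t.b (t.m (T + 1 : ℕ)) (t.B n (T + 1)) s.1) fun r =>
        φ (r.1, s.2 + r.2) := by
  simp only [run, expect_bind, expect_map]

theorem mem_of_mem_support_run (hbn : t.b ≤ n) (hB : ∀ j, 0 < t.B n j)
    (hprox : p.IsProxMap t.b η prox) {x : E} (hx : x ∈ p.X) (T : ℕ) :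
    ∀ s ∈ (run t p prox x T).support, s.1 ∈ p.X := by
  induction T with
  | zero =>
    intro s hs
    rw [run, PMF.mem_support_pure_iff] at hs
    rw [hs]; exact hx
  | succ T ih =>
    intro s hs
    rw [run, PMF.mem_support_bind_iff] at hs
    obtain ⟨s', hs', hs⟩ := hs
    rw [PMF.mem_support_map_iff] at hs
    obtain ⟨r, hr, rfl⟩ := hs
    rw [epoch, PMF.mem_support_bind_iff] at hr
    obtain ⟨J, hJ, hr⟩ := hr
    rw [PMF.mem_support_bind_iff] at hr
    obtain ⟨N, -, hr⟩ := hr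
    rw [PMF.mem_support_map_iff] at hr
    obtain ⟨y, hy, rfl⟩ := hr
    exact support_innerLoop_subset hprox hbn (ih s' hs') (nonempty_of_mem_powersetCard (hB _)
      ((mem_support_uniformBatch (min_le_right _ _)).1 hJ)) N hy

/-- The recursion for the expected gap and the expected divergence, from a given initial point. -/
structure EpochRecursion (t : Tuning) (n : ℕ) (L μ DH : ℝ) (h d : ℕ → ℝ) : Prop where
  h_nonneg : ∀ T, 0 ≤ h T
  d_nonneg : ∀ T, 0 ≤ d T
  step : ∀ T, h (T + 1) + t.u / t.m (T + 1 : ℕ) * d (T + 1)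
    ≤ t.a⁻¹ * h T + t.u / t.m (T + 1 : ℕ) * d T + t.cH / t.m (T + 1 : ℕ) * DH * t.ind n (T + 1)
  growth : ∀ T, μ * d T ≤ L * h T

theorem ind_nonneg (t : Tuning) (n j : ℕ) : 0 ≤ t.ind n j := by
  unfold Tuning.ind; split_ifs <;> norm_num

/-- The epoch inequality is averaged over the law of the previous iterate, for a deterministic
starting point, so that only discrete laws occur. B3 gives the growth condition. -/
theorem CompositeProblem.Assumptions.exists_recursion [MeasurableSpace E] [BorelSpace E]
    (hp : p.Assumptions G L μ xs)
    (ht : t.Admissible) (hG : IsCHEF t.g t.CG G) (hbn : t.b ≤ n) (hηL : η * L = t.θ)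
    (hfin : ∀ i, convexConj G (p.gradDev L xs i) ≠ ⊤)
    (hprox : p.IsProxMap t.b η prox) {x : E} (hx : x ∈ p.X) :
    ∃ h d : ℕ → ℝ, EpochRecursion t n L μ (p.DH G L xs) h d ∧
      h 0 = p.F x - p.F xs ∧ d 0 = L * bregman p.w xs x ∧
      ∀ T, expect (run t p prox x T) (fun s => ENNReal.ofReal (p.F s.1 - p.F xs))
        = ENNReal.ofReal (h T) := by
  have hn : 0 < n := ht.b_pos.trans_le hbn
  have hLp := hp.L_pos
  have hDH := p.DH_nonneg hG.zero hLp xs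
  have hX := fun T => mem_of_mem_support_run hbn (ht.B_pos ⟨hG.g_mono, hG.g_pos⟩ hn) hprox hx T
  have hLD : ∀ y ∈ p.X, 0 ≤ L * bregman p.w xs y := fun y hy =>
    mul_nonneg hLp.le (hp.bregman_nonneg hG.nonneg hp.mem hy)
  let H : ℕ → ℝ≥0∞ := fun T =>
    expect (run t p prox x T) fun s => ENNReal.ofReal (p.F s.1 - p.F xs)
  let V : ℕ → ℝ≥0∞ := fun T =>
    expect (run t p prox x T) fun s => ENNReal.ofReal (L * bregman p.w xs s.1)
  have hm : ∀ T : ℕ, 0 < t.m T := fun T =>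
    (by linarith [ht.m₀_gt] : (0 : ℝ) < t.m₀).trans_le (ht.m_ge (Nat.cast_nonneg T))
  have hum : ∀ T : ℕ, 0 < t.u / t.m T := fun T => div_pos ht.u_pos (hm T)
  have ha : 0 < t.a := by linarith [ht.a_gt]
  have hcst : ∀ T : ℕ, 0 ≤ t.cH / t.m T * p.DH G L xs * t.ind n T := fun T =>
    mul_nonneg (mul_nonneg (div_pos ht.cH_pos (hm T)).le hDH) (ind_nonneg t n T)
  have hrec : ∀ T, H (T + 1) + ENNReal.ofReal (t.u / t.m (T + 1 : ℕ)) * V (T + 1)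
      ≤ ENNReal.ofReal t.a⁻¹ * H T + ENNReal.ofReal (t.u / t.m (T + 1 : ℕ)) * V T
        + ENNReal.ofReal (t.cH / t.m (T + 1 : ℕ) * p.DH G L xs * t.ind n (T + 1)) := by
    intro T
    calc H (T + 1) + ENNReal.ofReal (t.u / t.m (T + 1 : ℕ)) * V (T + 1)
        = expect (run t p prox x (T + 1)) (fun s => ENNReal.ofReal
            ((p.F s.1 - p.F xs) + t.u / t.m (T + 1 : ℕ) * (L * bregman p.w xs s.1))) := by
          simp only [H, V]
          rw [← expect_mul_left, ← expect_add]
          refine expect_congr fun s hs => ?_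
          rw [ENNReal.ofReal_add (hp.gap_nonneg (hX _ s hs))
            (mul_nonneg (hum _).le (hLD _ (hX _ s hs))), ENNReal.ofReal_mul (hum _).le]
      _ ≤ expect (run t p prox x T) (fun s => ENNReal.ofReal (t.a⁻¹ * (p.F s.1 - p.F xs)
            + t.u / t.m (T + 1 : ℕ) * (L * bregman p.w xs s.1)
            + t.cH / t.m (T + 1 : ℕ) * p.DH G L xs * t.ind n (T + 1))) := by
          rw [expect_run_succ]
          exact expect_mono fun s hs =>
            hp.tuned_epoch_le ht hG hbn hηL hfin hprox (hX T s hs) (T + 1)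
      _ = _ := by
          simp only [H, V]
          rw [← expect_mul_left, ← expect_mul_left, ← expect_add]
          conv_rhs => rw [← expect_const (run t p prox x T) (ENNReal.ofReal
            (t.cH / t.m (T + 1 : ℕ) * p.DH G L xs * t.ind n (T + 1))), ← expect_add]
          refine expect_congr fun s hs => ?_
          have h1 : 0 ≤ t.a⁻¹ * (p.F s.1 - p.F xs) :=
            mul_nonneg (by positivity) (hp.gap_nonneg (hX _ s hs))
          have h2 := mul_nonneg (hum (T + 1)).le (hLD _ (hX _ s hs))
          rw [ENNReal.ofReal_add (add_nonneg h1 h2) (hcst _), ENNReal.ofReal_add h1 h2,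
            ENNReal.ofReal_mul (by positivity), ENNReal.ofReal_mul (hum _).le]
  have h0 : H 0 = ENNReal.ofReal (p.F x - p.F xs) := expect_pure _ _
  have d0 : V 0 = ENNReal.ofReal (L * bregman p.w xs x) := expect_pure _ _
  -- The recursion itself propagates finiteness from the starting point; the positive weight `u/m`
  -- is needed to recover it for the divergence.
  have hfinite : ∀ T, H T ≠ ⊤ ∧ V T ≠ ⊤ := by
    intro T
    induction T with
    | zero => rw [h0, d0]; exact ⟨ENNReal.ofReal_ne_top, ENNReal.ofReal_ne_top⟩
    | succ T ih =>
      have h1 : H (T + 1) + ENNReal.ofReal (t.u / t.m (T + 1 : ℕ)) * V (T + 1) ≠ ⊤ := by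
        refine ne_top_of_le_ne_top ?_ (hrec T)
        exact ENNReal.add_ne_top.2 ⟨ENNReal.add_ne_top.2
          ⟨ENNReal.mul_ne_top ENNReal.ofReal_ne_top ih.1,
            ENNReal.mul_ne_top ENNReal.ofReal_ne_top ih.2⟩, ENNReal.ofReal_ne_top⟩
      obtain ⟨h2, h3⟩ := ENNReal.add_ne_top.1 h1
      refine ⟨h2, fun h4 => h3 ?_⟩
      rw [h4, ENNReal.mul_top]
      exact (ENNReal.ofReal_pos.2 (hum _)).ne'
  refine ⟨fun T => (H T).toReal, fun T => (V T).toReal,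
    ⟨fun T => ENNReal.toReal_nonneg, fun T => ENNReal.toReal_nonneg, fun T => ?_, fun T => ?_⟩,
    ?_, ?_, fun T => (ENNReal.ofReal_toReal (hfinite T).1).symm⟩
  · have h1 := ENNReal.toReal_mono (ENNReal.add_ne_top.2 ⟨ENNReal.add_ne_top.2
          ⟨ENNReal.mul_ne_top ENNReal.ofReal_ne_top (hfinite T).1,
            ENNReal.mul_ne_top ENNReal.ofReal_ne_top (hfinite T).2⟩, ENNReal.ofReal_ne_top⟩)
        (hrec T)
    rw [ENNReal.toReal_add (hfinite _).1 (ENNReal.mul_ne_top ENNReal.ofReal_ne_top (hfinite _).2),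
      ENNReal.toReal_add (ENNReal.add_ne_top.2
          ⟨ENNReal.mul_ne_top ENNReal.ofReal_ne_top (hfinite T).1,
            ENNReal.mul_ne_top ENNReal.ofReal_ne_top (hfinite T).2⟩) ENNReal.ofReal_ne_top,
      ENNReal.toReal_add (ENNReal.mul_ne_top ENNReal.ofReal_ne_top (hfinite T).1)
        (ENNReal.mul_ne_top ENNReal.ofReal_ne_top (hfinite T).2)] at h1
    simp only [ENNReal.toReal_mul] at h1
    rwa [ENNReal.toReal_ofReal (hum _).le, ENNReal.toReal_ofReal (by positivity),
      ENNReal.toReal_ofReal (hcst _)] at h1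
  · have h1 : ENNReal.ofReal μ * V T ≤ ENNReal.ofReal L * H T := by
      simp only [H, V]
      rw [← expect_mul_left, ← expect_mul_left]
      refine expect_mono fun s hs => ?_
      rw [← ENNReal.ofReal_mul hp.μ_nonneg, ← ENNReal.ofReal_mul hLp.le]
      apply ENNReal.ofReal_le_ofReal
      have h2 := mul_le_mul_of_nonneg_left (hp.B3 s.1 (hX T s hs)) hLp.le
      linarith
    have h2 := ENNReal.toReal_mono (ENNReal.mul_ne_top ENNReal.ofReal_ne_top (hfinite T).1) h1
    rwa [ENNReal.toReal_mul, ENNReal.toReal_mul, ENNReal.toReal_ofReal hp.μ_nonneg,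
      ENNReal.toReal_ofReal hLp.le] at h2
  · simp only [h0]
    exact ENNReal.toReal_ofReal (hp.gap_nonneg hx)
  · simp only [d0]
    exact ENNReal.toReal_ofReal (hLD x hx)

theorem expect_geomLaw {γ : ℝ} (h0 : 0 ≤ γ) (h1 : γ < 1) :
    expect (geomLaw γ) (fun N => (N : ℝ≥0∞)) = ENNReal.ofReal (γ / (1 - γ)) := by
  have h2 : ‖γ‖ < 1 := by rwa [Real.norm_of_nonneg h0]
  have h3 := (hasSum_coe_mul_geometric_of_norm_lt_one h2).mul_left (1 - γ)
  have h4 : (1 - γ) * (γ / (1 - γ) ^ 2) = γ / (1 - γ) := by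
    have : 1 - γ ≠ 0 := by linarith
    field_simp
  rw [h4] at h3
  rw [← h3.tsum_eq, ENNReal.ofReal_tsum_of_nonneg (fun N => mul_nonneg (by linarith)
    (mul_nonneg (Nat.cast_nonneg N) (pow_nonneg h0 N))) h3.summable, expect]
  congr 1
  funext N
  rw [geomLaw_apply h0 h1, ← ENNReal.ofReal_natCast, ← ENNReal.ofReal_mul
    (mul_nonneg (by linarith) (pow_nonneg h0 N))]
  congr 1; ring

theorem expect_cost_epoch {b : ℕ} (hb : 0 < b) {m : ℝ} (hm : 0 < m) (B : ℕ) (x : E) :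
    expect (epoch p prox b m B x) (fun s => (s.2 : ℝ≥0∞)) = ENNReal.ofReal m + B := by
  have hb' : (0 : ℝ) < b := by exact_mod_cast hb
  have hγ1 : m / (m + b) < 1 := by rw [div_lt_one (by positivity)]; linarith
  rw [expect_epoch]
  simp only [expect_const, Nat.cast_add, Nat.cast_mul]
  rw [expect_add, expect_mul_left, expect_geomLaw (by positivity) hγ1, expect_const,
    ← ENNReal.ofReal_natCast b, ← ENNReal.ofReal_mul hb'.le]
  have h1 : 1 - m / (m + b) = b / (m + b) := by field_simp; ring
  rw [h1]
  congr 2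
  field_simp

/-- The expected cost of the first `T` epochs. -/
theorem expect_cost_run (ht : t.Admissible) (x : E) (T : ℕ) :
    expect (run t p prox x T) (fun s => (s.2 : ℝ≥0∞))
      = ENNReal.ofReal (∑ j ∈ Finset.range T, (t.m (j + 1 : ℕ) + t.B n (j + 1))) := by
  have hm : ∀ T : ℕ, 0 < t.m T := fun T =>
    (by linarith [ht.m₀_gt] : (0 : ℝ) < t.m₀).trans_le (ht.m_ge (Nat.cast_nonneg T))
  induction T with
  | zero =>
    rw [run, expect_pure]
    simp
  | succ T ih =>
    rw [expect_run_succ, Finset.sum_range_succ, ENNReal.ofReal_add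
      (Finset.sum_nonneg fun j _ => add_nonneg (hm _).le (Nat.cast_nonneg _))
      (add_nonneg (hm _).le (Nat.cast_nonneg _)), ← ih, ENNReal.ofReal_add (hm _).le
      (Nat.cast_nonneg _), ENNReal.ofReal_natCast]
    simp only [Nat.cast_add, expect_add, expect_const]
    congr 1
    have := expect_cost_epoch (p := p) (prox := prox) ht.b_pos (hm (T + 1)) (t.B n (T + 1))
    push_cast at this ⊢
    simp only [this, expect_const]

end Run

/-! ### The recursion over the epochs -/

section Recursion

variable {t : Tuning} {n : ℕ} {L μ DH : ℝ} {h d : ℕ → ℝ}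

theorem Tuning.m_natCast (t : Tuning) (j : ℕ) : t.m j = t.m₀ * t.α ^ j := by
  rw [Tuning.m, Real.rpow_natCast]

theorem Tuning.Admissible.m_pos (ht : t.Admissible) (j : ℕ) : 0 < t.m j :=
  (by linarith [ht.m₀_gt] : (0 : ℝ) < t.m₀).trans_le (ht.m_ge (Nat.cast_nonneg j))

theorem Tuning.Admissible.m_succ_le (ht : t.Admissible) (j : ℕ) :
    t.m (j + 1 : ℕ) * t.a⁻¹ ≤ t.m j := by
  have ha : 0 < t.a := by linarith [ht.a_gt]
  rw [mul_inv_le_iff₀ ha, t.m_natCast, t.m_natCast, pow_succ, ← mul_assoc]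
  have h1 := ht.m_pos j
  rw [t.m_natCast] at h1
  exact mul_le_mul_of_nonneg_left ht.α_le_a h1.le

/-- The potential `m_T h_T + u d_T` only grows by the truncated epochs. -/
theorem EpochRecursion.potential_le (hr : EpochRecursion t n L μ DH h d) (ht : t.Admissible)
    (T : ℕ) : t.m T * h T + t.u * d T
      ≤ t.m₀ * h 0 + t.u * d 0 + t.cH * DH * ∑ j ∈ Finset.range T, t.ind n (j + 1) := by
  induction T with
  | zero => simp [Tuning.m]
  | succ T ih =>
    have hm := ht.m_pos (T + 1)
    have h1 := mul_le_mul_of_nonneg_left (hr.step T) hm.le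
    have h2 : t.m (T + 1 : ℕ) * (h (T + 1) + t.u / t.m (T + 1 : ℕ) * d (T + 1))
        = t.m (T + 1 : ℕ) * h (T + 1) + t.u * d (T + 1) := by field_simp
    have h3 : t.m (T + 1 : ℕ) * (t.a⁻¹ * h T + t.u / t.m (T + 1 : ℕ) * d T
          + t.cH / t.m (T + 1 : ℕ) * DH * t.ind n (T + 1))
        = t.m (T + 1 : ℕ) * t.a⁻¹ * h T + t.u * d T + t.cH * DH * t.ind n (T + 1) := by
      field_simp
    -- Since `α ≤ a`, the contraction of the gap offsets the growth of the weight `m`.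
    have h4 := mul_le_mul_of_nonneg_right (ht.m_succ_le T) (hr.h_nonneg T)
    rw [Finset.sum_range_succ, mul_add]
    linarith

/-- The constant that bounds the product of the perturbed contraction factors. -/
noncomputable def Tuning.P (t : Tuning) : ℝ := Real.exp (t.a * t.u / t.m₀ / (t.α - 1))

/-- Once `m_j` exceeds the condition number, the gap contracts by `1 / a` in every epoch, up to a
constant and to the noise of the truncated epochs. -/
theorem EpochRecursion.contract (hr : EpochRecursion t n L μ DH h d) (ht : t.Admissible)
    (hDH : 0 ≤ DH) (hμ : 0 < μ) {j₀ : ℕ} (hj₀ : L / μ ≤ t.α ^ j₀) (i : ℕ) :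
    h (j₀ + i) ≤ t.P * ((t.a⁻¹) ^ i * h j₀ + (t.m (j₀ + i : ℕ))⁻¹ *
      (t.cH * DH * ∑ l ∈ Finset.range i, t.ind n (j₀ + l + 1))) := by
  have ha : 0 < t.a := by linarith [ht.a_gt]
  have hα := ht.α_gt
  have hα0 : 0 < t.α := by linarith
  have hm₀ : 0 < t.m₀ := by linarith [ht.m₀_gt]
  have hu := ht.u_pos
  have hcH := ht.cH_pos
  set c : ℝ := t.a * t.u / t.m₀ with hc
  have hc0 : 0 < c := by positivity
  have hdh : ∀ T, d T ≤ L / μ * h T := fun T => by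
    rw [div_mul_eq_mul_div, le_div_iff₀ hμ, mul_comm]
    exact hr.growth T
  have key : ∀ i : ℕ, h (j₀ + i) ≤ Real.exp (c * ∑ l ∈ Finset.range i, (t.α⁻¹) ^ (l + 1)) *
      ((t.a⁻¹) ^ i * h j₀ + (t.m (j₀ + i : ℕ))⁻¹ *
        (t.cH * DH * ∑ l ∈ Finset.range i, t.ind n (j₀ + l + 1))) := by
    intro i
    induction i with
    | zero => simp
    | succ i ih =>
      set S := t.cH * DH * ∑ l ∈ Finset.range i, t.ind n (j₀ + l + 1) with hS
      have hS0 : 0 ≤ S := mul_nonneg (by positivity)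
        (Finset.sum_nonneg fun l _ => ind_nonneg t n _)
      set e := Real.exp (c * ∑ l ∈ Finset.range i, (t.α⁻¹) ^ (l + 1)) with he
      have hm := ht.m_pos (j₀ + i)
      have hm' := ht.m_pos (j₀ + i + 1)
      have hstep := hr.step (j₀ + i)
      have hd0 : 0 ≤ t.u / t.m (j₀ + i + 1 : ℕ) * d (j₀ + i + 1) :=
        mul_nonneg (by positivity) (hr.d_nonneg _)
      -- The divergence is at most `κ h ≤ α ^ j₀ * h`, so its share of the factor decays like `α ^
      -- (-(i + 1))`. The product of the factors `1 + c α ^ (-(l + 1))` is then bounded by an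
      -- exponential of a geometric sum.
      have hd1 : t.u / t.m (j₀ + i + 1 : ℕ) * d (j₀ + i)
          ≤ t.a⁻¹ * (c * (t.α⁻¹) ^ (i + 1)) * h (j₀ + i) := by
        calc t.u / t.m (j₀ + i + 1 : ℕ) * d (j₀ + i)
            ≤ t.u / t.m (j₀ + i + 1 : ℕ) * (t.α ^ j₀ * h (j₀ + i)) := by
              gcongr
              exact (hdh _).trans (mul_le_mul_of_nonneg_right hj₀ (hr.h_nonneg _))
          _ = _ := by
              rw [t.m_natCast, hc, add_assoc, pow_add, inv_pow]
              field_simp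
      have hexp : 1 + c * (t.α⁻¹) ^ (i + 1) ≤ Real.exp (c * (t.α⁻¹) ^ (i + 1)) := by
        rw [add_comm]; exact Real.add_one_le_exp _
      have hsum : Real.exp (c * ∑ l ∈ Finset.range (i + 1), (t.α⁻¹) ^ (l + 1))
          = e * Real.exp (c * (t.α⁻¹) ^ (i + 1)) := by
        rw [Finset.sum_range_succ, mul_add, Real.exp_add]
      have he1 : 1 ≤ Real.exp (c * ∑ l ∈ Finset.range (i + 1), (t.α⁻¹) ^ (l + 1)) :=
        Real.one_le_exp (mul_nonneg hc0.le (Finset.sum_nonneg fun l _ => by positivity))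
      have hinv : t.a⁻¹ * (t.m (j₀ + i : ℕ))⁻¹ ≤ (t.m (j₀ + i + 1 : ℕ))⁻¹ := by
        have h2 := ht.m_succ_le (j₀ + i)
        rw [← div_eq_mul_inv, div_le_iff₀ hm, inv_mul_eq_div, le_div_iff₀ hm']
        linarith
      have hF0 : 0 ≤ t.cH / t.m (j₀ + i + 1 : ℕ) * DH * t.ind n (j₀ + i + 1) :=
        mul_nonneg (by positivity) (ind_nonneg t n _)
      have hpow : 0 ≤ (t.a⁻¹) ^ i * h j₀ := mul_nonneg (by positivity) (hr.h_nonneg _)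
      calc h (j₀ + (i + 1))
          ≤ t.a⁻¹ * (1 + c * (t.α⁻¹) ^ (i + 1)) * h (j₀ + i)
            + t.cH / t.m (j₀ + i + 1 : ℕ) * DH * t.ind n (j₀ + i + 1) := by
            rw [← add_assoc]; linarith
        _ ≤ t.a⁻¹ * Real.exp (c * (t.α⁻¹) ^ (i + 1)) *
              (e * ((t.a⁻¹) ^ i * h j₀ + (t.m (j₀ + i : ℕ))⁻¹ * S))
            + Real.exp (c * ∑ l ∈ Finset.range (i + 1), (t.α⁻¹) ^ (l + 1)) *
              (t.cH / t.m (j₀ + i + 1 : ℕ) * DH * t.ind n (j₀ + i + 1)) := by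
            have h0 := hr.h_nonneg (j₀ + i)
            refine add_le_add ?_ (le_mul_of_one_le_left hF0 he1)
            gcongr
        _ = Real.exp (c * ∑ l ∈ Finset.range (i + 1), (t.α⁻¹) ^ (l + 1)) *
              ((t.a⁻¹) ^ (i + 1) * h j₀ + t.a⁻¹ * (t.m (j₀ + i : ℕ))⁻¹ * S
              + t.cH / t.m (j₀ + i + 1 : ℕ) * DH * t.ind n (j₀ + i + 1)) := by
            rw [hsum]; ring
        _ ≤ Real.exp (c * ∑ l ∈ Finset.range (i + 1), (t.α⁻¹) ^ (l + 1)) *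
              ((t.a⁻¹) ^ (i + 1) * h j₀ + (t.m (j₀ + i + 1 : ℕ))⁻¹ * S
              + t.cH / t.m (j₀ + i + 1 : ℕ) * DH * t.ind n (j₀ + i + 1)) := by
            gcongr
        _ = _ := by
            rw [Finset.sum_range_succ (fun l => t.ind n (j₀ + l + 1)), mul_add (t.cH * DH), ← hS,
              ← add_assoc j₀ i 1]
            ring
  refine (key i).trans ?_
  have hS0 : 0 ≤ t.cH * DH * ∑ l ∈ Finset.range i, t.ind n (j₀ + l + 1) :=
    mul_nonneg (by positivity) (Finset.sum_nonneg fun l _ => ind_nonneg t n _)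
  have hm := ht.m_pos (j₀ + i)
  have hh := hr.h_nonneg j₀
  refine mul_le_mul_of_nonneg_right ?_ (by positivity)
  rw [Tuning.P]
  apply Real.exp_le_exp.2
  rw [← hc, div_eq_mul_inv c]
  gcongr
  have h1 : t.α⁻¹ < 1 := inv_lt_one_of_one_lt₀ hα
  calc ∑ l ∈ Finset.range i, (t.α⁻¹) ^ (l + 1)
      = t.α⁻¹ * ∑ l ∈ Finset.range i, (t.α⁻¹) ^ l := by
        rw [Finset.mul_sum]
        exact Finset.sum_congr rfl fun l _ => pow_succ' _ _
    _ ≤ t.α⁻¹ * (1 - t.α⁻¹)⁻¹ := by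
        gcongr
        rw [← tsum_geometric_of_lt_one (by positivity) h1]
        exact (summable_geometric_of_lt_one (by positivity) h1).sum_le_tsum _
          fun l _ => by positivity
    _ = _ := by
        have : t.α - 1 ≠ 0 := by linarith
        field_simp

end Recursion

/-! ### Truncated epochs -/

section Truncation

variable {t : Tuning} {n : ℕ}

theorem Tuning.Admissible.α_pos (ht : t.Admissible) : 0 < t.α := by linarith [ht.α_gt]

theorem Tuning.Admissible.m_real_pos (ht : t.Admissible) (τ : ℝ) : 0 < t.m τ :=
  mul_pos (by linarith [ht.m₀_gt]) (Real.rpow_pos_of_pos ht.α_pos τ)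

theorem Tuning.Admissible.m_mono (ht : t.Admissible) {σ τ : ℝ} (h : σ ≤ τ) : t.m σ ≤ t.m τ :=
  mul_le_mul_of_nonneg_left (Real.rpow_le_rpow_of_exponent_le ht.α_gt.le h)
    (by linarith [ht.m₀_gt])

theorem Tuning.Admissible.g_inv_m_anti (ht : t.Admissible) (hg : t.Regular) {σ τ : ℝ}
    (h : σ ≤ τ) : t.g (1 / t.m τ) ≤ t.g (1 / t.m σ) := by
  have h1 := ht.m_real_pos σ
  have h2 := ht.m_real_pos τ
  exact hg.g_mono (Set.mem_Ici.2 (by positivity)) (Set.mem_Ici.2 (by positivity))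
    (one_div_le_one_div_of_le h1 (ht.m_mono h))

theorem Tuning.Admissible.rawBatch_mono (ht : t.Admissible) (hg : t.Regular) {σ τ : ℝ}
    (h : σ ≤ τ) : t.rawBatch σ ≤ t.rawBatch τ := by
  have ha : 0 < t.α ^ (1 / t.ξ) := Real.rpow_pos_of_pos ht.α_pos _
  have h1 := ht.m_real_pos σ
  have h2 := ht.m_real_pos τ
  have h3 := ht.g₀_pos hg
  have h4 := hg.g_pos (1 / t.m τ) (by positivity)
  rw [rawBatch, rawBatch]
  exact mul_le_mul_of_nonneg_left (div_le_div₀ h2.le (ht.m_mono h) h4 (ht.g_inv_m_anti hg h))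
    (by positivity)

/-- Monotonicity of `g` alone makes the batch size grow at least as fast as `m`; hence only `O(1 +
log n)` epochs can be truncated. -/
theorem Tuning.Admissible.rawBatch_ge (ht : t.Admissible) (hg : t.Regular) {τ : ℝ}
    (h : 0 ≤ τ) : t.rawBatch 0 * t.α ^ τ ≤ t.rawBatch τ := by
  have ha : 0 < t.α ^ (1 / t.ξ) := Real.rpow_pos_of_pos ht.α_pos _
  have h1 := ht.m_real_pos 0
  have h2 := ht.m_real_pos τ
  have h3 := ht.g₀_pos hg
  have h4 := hg.g_pos (1 / t.m τ) (by positivity)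
  have h5 : t.m τ = t.m 0 * t.α ^ τ := by simp [m]
  have h6 : t.rawBatch 0 * t.α ^ τ
      = 5 * t.α ^ (1 / t.ξ) / 2 * t.g₀ * (t.m τ / t.g (1 / t.m 0)) := by
    rw [rawBatch, h5]; ring
  rw [h6, rawBatch]
  exact mul_le_mul_of_nonneg_left (div_le_div_of_nonneg_left h2.le h4 (ht.g_inv_m_anti hg h))
    (by positivity)

theorem Tuning.rawBatch_lt_of_ind_ne_zero {j : ℕ} (h : t.ind n j ≠ 0) :
    t.rawBatch j < n := by
  have h1 : t.B n j < n := by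
    by_contra h2
    exact h (if_neg h2)
  have h2 : ⌈t.rawBatch j⌉₊ < n := by
    rw [Tuning.B] at h1
    simpa using h1
  exact (Nat.le_ceil _).trans_lt (by exact_mod_cast h2)

theorem Tuning.Admissible.ind_eq_zero (ht : t.Admissible) (hg : t.Regular) {j : ℕ}
    (h : t.α ^ t.Tn n < t.α ^ j) : t.ind n j = 0 := by
  by_contra h0
  have h1 := Tuning.rawBatch_lt_of_ind_ne_zero h0
  have h2 : t.Tn n < j := by
    rw [← Real.rpow_natCast] at h
    exact (Real.rpow_lt_rpow_left_iff ht.α_gt).1 h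
  -- Nonemptiness makes `T_n*` a genuine infimum rather than the default value `0` of `sInf ∅`.
  have h3 : {τ : ℝ | 0 ≤ τ ∧ (n : ℝ) ≤ t.rawBatch τ}.Nonempty := by
    have h4 := ht.rawBatch_pos hg 0
    obtain ⟨k, hk⟩ := pow_unbounded_of_one_lt (n / t.rawBatch 0) ht.α_gt
    refine ⟨k, Nat.cast_nonneg k, ?_⟩
    refine le_trans ?_ (ht.rawBatch_ge hg (Nat.cast_nonneg k))
    rw [Real.rpow_natCast]
    rw [div_lt_iff₀ h4] at hk
    linarith
  obtain ⟨τ, ⟨-, hτ⟩, hτj⟩ := exists_lt_of_csInf_lt h3 h2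
  exact absurd h1 (not_lt.2 (hτ.trans (ht.rawBatch_mono hg hτj.le)))

/-- The constant in the bound on the number of truncated epochs. -/
noncomputable def Tuning.cI (t : Tuning) : ℝ := (1 + |Real.log (t.rawBatch 0)|) / Real.log t.α

theorem Tuning.Admissible.sum_ind_le (ht : t.Admissible) (hg : t.Regular)
    (j₀ i : ℕ) :
    ∑ l ∈ Finset.range i, t.ind n (j₀ + l + 1) ≤ t.cI * (1 + Real.log n) := by
  have hlogα := Real.log_pos ht.α_gt
  have hlogn : 0 ≤ Real.log n := Real.log_natCast_nonneg n
  set Q : ℝ := t.cI * (1 + Real.log n) with hQ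
  have hQ0 : 0 ≤ Q := by rw [hQ, Tuning.cI]; positivity
  have hraw := ht.rawBatch_pos hg 0
  have h1 : ∀ l, t.ind n (j₀ + l + 1) ≠ 0 → l + 1 ≤ ⌊Q⌋₊ := by
    intro l hl
    have h2 := Tuning.rawBatch_lt_of_ind_ne_zero hl
    have h3 := (ht.rawBatch_ge hg (Nat.cast_nonneg (j₀ + l + 1))).trans_lt h2
    have h4 := Real.log_lt_log (mul_pos hraw (Real.rpow_pos_of_pos ht.α_pos _)) h3
    rw [Real.log_mul hraw.ne' (Real.rpow_pos_of_pos ht.α_pos _).ne', Real.log_rpow ht.α_pos] at h4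
    apply Nat.le_floor
    -- Dropping `j₀` makes the bound on the number of truncated epochs uniform in the starting
    -- epoch.
    have h5 : ((l + 1 : ℕ) : ℝ) ≤ ((j₀ + l + 1 : ℕ) : ℝ) := by exact_mod_cast (by omega)
    refine h5.trans ?_
    rw [hQ, Tuning.cI, div_mul_eq_mul_div, le_div_iff₀ hlogα]
    have h6 := neg_abs_le (Real.log (t.rawBatch 0))
    have h7 := mul_nonneg (abs_nonneg (Real.log (t.rawBatch 0))) hlogn
    linarith
  calc ∑ l ∈ Finset.range i, t.ind n (j₀ + l + 1)
      ≤ ∑ l ∈ Finset.range i, if l < ⌊Q⌋₊ then (1 : ℝ) else 0 := by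
        refine Finset.sum_le_sum fun l _ => ?_
        by_cases h : t.ind n (j₀ + l + 1) = 0
        · rw [h]; split_ifs <;> norm_num
        · have h2 := h1 l h
          rw [if_pos (by omega), Tuning.ind]
          split_ifs <;> norm_num
    _ = (((Finset.range i).filter (· < ⌊Q⌋₊)).card : ℝ) := by
        rw [Finset.sum_boole]
    _ ≤ (⌊Q⌋₊ : ℝ) := by
        have : (Finset.range i).filter (· < ⌊Q⌋₊) ⊆ Finset.range ⌊Q⌋₊ := fun l hl => by
          simpa using (Finset.mem_filter.1 hl).2
        exact_mod_cast (Finset.card_le_card this).trans_eq (Finset.card_range _)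
    _ ≤ Q := Nat.floor_le hQ0

end Truncation

/-! ### Bounds for the expected gap -/

section Gap

variable {E : Type u} [NormedAddCommGroup E] [InnerProductSpace ℝ E] [CompleteSpace E]
  {n : ℕ} {p : CompositeProblem E n} {G : E → ℝ}
  {L μ η : ℝ} {xs : E} {prox : E → E → E} {t : Tuning}
  {Ω : Type v} [MeasurableSpace Ω] {P : Measure Ω} [IsProbabilityMeasure P] {x₀ : Ω → E}

/-- Bounds that are affine in the initial gap and divergence survive integration over the random
starting point. Monotonicity of the lower integral requires no measurability of the run in its
starting point. -/
theorem expectedGap_le (hx₀ : p.IsInitial xs P x₀) {T : ℕ} {c₁ c₂ c₃ : ℝ}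
    (hp : ∀ x ∈ p.X, 0 ≤ p.F x - p.F xs) (hw : ∀ x ∈ p.X, 0 ≤ L * bregman p.w xs x)
    (h₁ : 0 ≤ c₁) (h₂ : 0 ≤ c₂) (h₃ : 0 ≤ c₃)
    (h : ∀ x ∈ p.X, expect (run t p prox x T) (fun s => ENNReal.ofReal (p.F s.1 - p.F xs))
      ≤ ENNReal.ofReal (c₁ * (p.F x - p.F xs) + c₂ * (L * bregman p.w xs x) + c₃)) :
    expectedGap t p prox xs P x₀ T
      ≤ ENNReal.ofReal (c₁ * p.DF xs P x₀ + c₂ * p.Dx L xs P x₀ + c₃) := by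
  have hi1 := hx₀.integrable_F.const_mul c₁
  have hi2 := (hx₀.integrable_w.const_mul L).const_mul c₂
  have hi12 : Integrable (fun ω => c₁ * (p.F (x₀ ω) - p.F xs)
      + c₂ * (L * bregman p.w xs (x₀ ω))) P := hi1.add hi2
  have hi : Integrable (fun ω => c₁ * (p.F (x₀ ω) - p.F xs)
      + c₂ * (L * bregman p.w xs (x₀ ω)) + c₃) P := hi12.add (integrable_const c₃)
  have hint : ∫ ω, (c₁ * (p.F (x₀ ω) - p.F xs) + c₂ * (L * bregman p.w xs (x₀ ω)) + c₃) ∂P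
      = c₁ * p.DF xs P x₀ + c₂ * p.Dx L xs P x₀ + c₃ := by
    rw [integral_add hi12 (integrable_const c₃), integral_add hi1 hi2,
      integral_const_mul, integral_const_mul, integral_const_mul]
    simp [CompositeProblem.DF, CompositeProblem.Dx]
  rw [← hint, ofReal_integral_eq_lintegral_ofReal hi]
  · refine lintegral_mono_ae ?_
    filter_upwards [hx₀.mem] with ω hω
    exact h _ hω
  · filter_upwards [hx₀.mem] with ω hω
    have h4 := hp _ hω
    have h5 := hw _ hω
    simp only [Pi.zero_apply]
    positivity

variable [MeasurableSpace E] [BorelSpace E]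

/-- The bound for the expected gap that does not use strong convexity. -/
theorem expectedGap_le_potential (hp : p.Assumptions G L μ xs)
    (ht : t.Admissible) (hG : IsCHEF t.g t.CG G) (hbn : t.b ≤ n) (hηL : η * L = t.θ)
    (hfin : ∀ i, convexConj G (p.gradDev L xs i) ≠ ⊤)
    (hprox : p.IsProxMap t.b η prox) (hx₀ : p.IsInitial xs P x₀) (T : ℕ) :
    expectedGap t p prox xs P x₀ T ≤ ENNReal.ofReal ((t.m₀ * p.DF xs P x₀ + t.u * p.Dx L xs P x₀
      + t.cH * p.DH G L xs * (t.cI * (1 + Real.log n))) / t.m T) := by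
  have hm := ht.m_pos T
  have hm₀ := ht.m₀_gt
  have hu := ht.u_pos
  have hcH := ht.cH_pos
  have hDH := p.DH_nonneg hG.zero hp.L_pos xs
  have hreg : t.Regular := ⟨hG.g_mono, hG.g_pos⟩
  have hN0 : 0 ≤ t.cI * (1 + Real.log n) := by
    simpa using ht.sum_ind_le hreg 0 0
  refine (expectedGap_le hx₀ (c₁ := t.m₀ / t.m T) (c₂ := t.u / t.m T)
    (c₃ := t.cH * p.DH G L xs * (t.cI * (1 + Real.log n)) / t.m T) (fun x hx => hp.gap_nonneg hx)
    (fun x hx => mul_nonneg hp.L_pos.le (hp.bregman_nonneg hG.nonneg hp.mem hx))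
    (by positivity) (by positivity) (by positivity) fun x hx => ?_).trans_eq ?_
  · obtain ⟨h, d, hr, hh0, hd0, hrun⟩ := hp.exists_recursion ht hG hbn hηL hfin hprox hx
    rw [hrun T, ← hh0, ← hd0]
    apply ENNReal.ofReal_le_ofReal
    have h1 := hr.potential_le ht T
    have h2 := mul_nonneg hu.le (hr.d_nonneg T)
    have h3 : t.cH * p.DH G L xs * ∑ j ∈ Finset.range T, t.ind n (j + 1)
        ≤ t.cH * p.DH G L xs * (t.cI * (1 + Real.log n)) :=
      mul_le_mul_of_nonneg_left (by simpa using ht.sum_ind_le hreg 0 T) (by positivity)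
    rw [div_mul_eq_mul_div, div_mul_eq_mul_div, ← add_div, ← add_div, le_div_iff₀ hm]
    linarith
  · congr 1; ring

/-- The bound for the expected gap after the epoch `j₀` at which `m_j` exceeds the condition
number. The number `N` bounds the number of truncated epochs after `j₀`. -/
theorem expectedGap_le_contract (hp : p.Assumptions G L μ xs) (hμ : 0 < μ)
    (ht : t.Admissible) (hG : IsCHEF t.g t.CG G) (hbn : t.b ≤ n) (hηL : η * L = t.θ)
    (hfin : ∀ i, convexConj G (p.gradDev L xs i) ≠ ⊤)
    (hprox : p.IsProxMap t.b η prox) (hx₀ : p.IsInitial xs P x₀) {j₀ : ℕ}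
    (hj₀ : L / μ ≤ t.α ^ j₀) (i : ℕ) {N : ℝ}
    (hN : ∑ l ∈ Finset.range i, t.ind n (j₀ + l + 1) ≤ N) :
    expectedGap t p prox xs P x₀ (j₀ + i) ≤ ENNReal.ofReal (t.P * ((t.a⁻¹) ^ i *
      ((t.m₀ * p.DF xs P x₀ + t.u * p.Dx L xs P x₀
        + t.cH * p.DH G L xs * (t.cI * (1 + Real.log n))) / t.m j₀)
      + t.cH * p.DH G L xs * N / t.m (j₀ + i : ℕ))) := by
  have ha : 0 < t.a := by linarith [ht.a_gt]
  have hm := ht.m_pos (j₀ + i)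
  have hmj := ht.m_pos j₀
  have hm₀ := ht.m₀_gt
  have hu := ht.u_pos
  have hcH := ht.cH_pos
  have hDH := p.DH_nonneg hG.zero hp.L_pos xs
  have hP : 0 < t.P := Real.exp_pos _
  have hreg : t.Regular := ⟨hG.g_mono, hG.g_pos⟩
  have hN0 : 0 ≤ t.cI * (1 + Real.log n) := by
    simpa using ht.sum_ind_le hreg 0 0
  have hN0' : 0 ≤ N := (Finset.sum_nonneg fun l _ => ind_nonneg t n _).trans hN
  refine (expectedGap_le hx₀ (c₁ := t.P * (t.a⁻¹) ^ i * (t.m₀ / t.m j₀))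
    (c₂ := t.P * (t.a⁻¹) ^ i * (t.u / t.m j₀))
    (c₃ := t.P * ((t.a⁻¹) ^ i * (t.cH * p.DH G L xs * (t.cI * (1 + Real.log n)) / t.m j₀)
      + t.cH * p.DH G L xs * N / t.m (j₀ + i : ℕ))) (fun x hx => hp.gap_nonneg hx)
    (fun x hx => mul_nonneg hp.L_pos.le (hp.bregman_nonneg hG.nonneg hp.mem hx))
    (by positivity) (by positivity) (by positivity) fun x hx => ?_).trans_eq ?_
  · obtain ⟨h, d, hr, hh0, hd0, hrun⟩ := hp.exists_recursion ht hG hbn hηL hfin hprox hx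
    rw [hrun, ← hh0, ← hd0]
    apply ENNReal.ofReal_le_ofReal
    refine (hr.contract ht hDH hμ hj₀ i).trans ?_
    have h1 := hr.potential_le ht j₀
    have h2 := mul_nonneg hu.le (hr.d_nonneg j₀)
    have h3 : t.cH * p.DH G L xs * ∑ j ∈ Finset.range j₀, t.ind n (j + 1)
        ≤ t.cH * p.DH G L xs * (t.cI * (1 + Real.log n)) :=
      mul_le_mul_of_nonneg_left (by simpa using ht.sum_ind_le hreg 0 j₀) (by positivity)
    have h4 : h j₀ ≤ (t.m₀ * h 0 + t.u * d 0
        + t.cH * p.DH G L xs * (t.cI * (1 + Real.log n))) / t.m j₀ := by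
      rw [le_div_iff₀ hmj]; linarith
    calc t.P * ((t.a⁻¹) ^ i * h j₀ + (t.m (j₀ + i : ℕ))⁻¹ *
          (t.cH * p.DH G L xs * ∑ l ∈ Finset.range i, t.ind n (j₀ + l + 1)))
        ≤ t.P * ((t.a⁻¹) ^ i * ((t.m₀ * h 0 + t.u * d 0
          + t.cH * p.DH G L xs * (t.cI * (1 + Real.log n))) / t.m j₀)
          + (t.m (j₀ + i : ℕ))⁻¹ * (t.cH * p.DH G L xs * N)) := by gcongr
      _ = _ := by ring
  · congr 1; ring

end Gap

/-! ### The accuracy of the iterates -/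

section Accuracy

namespace Tuning

variable {t : Tuning}

/-- The total weight of `D_F`, `D_x` and `D_H` in the bound for the expected gap. -/
noncomputable def R (t : Tuning) : ℝ := (t.m₀ + t.u + t.cH * t.cI) / t.m₀

/-- The constant in the number of epochs. -/
noncomputable def cT (t : Tuning) : ℝ := t.α * (1 + 4 * (t.P * t.R))

theorem Admissible.cI_pos (ht : t.Admissible) : 0 < t.cI := by
  have := Real.log_pos ht.α_gt
  rw [cI]; positivity

theorem Admissible.R_pos (ht : t.Admissible) : 0 < t.R := by
  have h1 := ht.m₀_gt
  have h2 := ht.u_pos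
  have h3 := ht.cH_pos
  have h4 := ht.cI_pos
  rw [R]; positivity

theorem Admissible.PR_pos (ht : t.Admissible) : 0 < t.P * t.R :=
  mul_pos (Real.exp_pos _) ht.R_pos

theorem Admissible.one_le_P (ht : t.Admissible) : 1 ≤ t.P := by
  have h1 := ht.m₀_gt
  have h2 := ht.u_pos
  have h3 := ht.a_gt
  have h4 : 0 < t.α - 1 := by linarith [ht.α_gt]
  exact Real.one_le_exp (by positivity)

theorem Admissible.α_le_cT (ht : t.Admissible) : t.α ≤ t.cT := by
  have h1 := ht.α_pos
  have h2 := ht.PR_pos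
  rw [cT]; nlinarith

theorem Admissible.PR_le_cT (ht : t.Admissible) : 4 * (t.P * t.R) ≤ t.cT := by
  have h1 := ht.α_gt
  have h2 := ht.PR_pos
  rw [cT]; nlinarith

theorem Admissible.m₀_add_u_le (ht : t.Admissible) : t.m₀ + t.u ≤ t.m₀ * t.R := by
  have h1 := ht.m₀_gt
  have h3 := mul_pos ht.cH_pos ht.cI_pos
  rw [R, mul_div_cancel₀ _ (by positivity)]; linarith

theorem Admissible.cH_mul_cI_le (ht : t.Admissible) : t.cH * t.cI ≤ t.m₀ * t.R := by
  have h1 := ht.m₀_gt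
  have h3 := ht.u_pos
  rw [R, mul_div_cancel₀ _ (by positivity)]; linarith

/-- The numerator of the bounds for the expected gap. -/
theorem Admissible.numerator_le (ht : t.Admissible) {DF Dx DH D l : ℝ} (hF : DF ≤ D) (hx : Dx ≤ D)
    (hH : DH ≤ D) (hD : 0 ≤ D) (hl : 1 ≤ l) :
    t.m₀ * DF + t.u * Dx + t.cH * DH * (t.cI * l) ≤ t.m₀ * t.R * (l * D) := by
  have h1 := ht.m₀_gt
  have h2 := ht.u_pos
  have h3 := mul_pos ht.cH_pos ht.cI_pos
  have h4 : t.m₀ * t.R = t.m₀ + t.u + t.cH * t.cI := by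
    rw [R, mul_div_cancel₀ _ (by positivity)]
  have hlD : D ≤ l * D := le_mul_of_one_le_left hD hl
  have h5 : t.m₀ * DF ≤ t.m₀ * (l * D) := by gcongr; exact hF.trans hlD
  have h6 : t.u * Dx ≤ t.u * (l * D) := by gcongr; exact hx.trans hlD
  have h7 : t.cH * t.cI * (l * DH) ≤ t.cH * t.cI * (l * D) := by gcongr
  rw [h4]
  linarith

/-- If `α^i` is large then the contraction factor over `i` epochs is small. -/
theorem Admissible.inv_a_pow_le (ht : t.Admissible) {c Z : ℝ} (hc : 1 ≤ c) {i : ℕ}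
    (h : c * max Z 1 ^ t.ξ ≤ t.α ^ i) : (t.a⁻¹) ^ i ≤ (c * max Z 1)⁻¹ := by
  have hξ := ht.ξ_pos
  have hM : 1 ≤ max Z 1 := le_max_right _ _
  have hM0 : 0 < max Z 1 := by linarith
  -- The source of the exponent `ξ`: raising `α ^ i ≥ c Z^ξ` to the power `1/ξ` yields `a ^ i ≥ c
  -- Z`, with `c ≤ c^{1/ξ}` because `c ≥ 1`.
  have h1 : t.a ^ i = (t.α ^ i) ^ (1 / t.ξ) := by
    rw [a, ← Real.rpow_natCast, ← Real.rpow_natCast, ← Real.rpow_mul ht.α_pos.le,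
      ← Real.rpow_mul ht.α_pos.le, mul_comm]
  rw [inv_pow, h1]
  refine inv_anti₀ (by positivity) ?_
  refine le_trans ?_ (Real.rpow_le_rpow (by positivity) h (by positivity))
  rw [Real.mul_rpow (by positivity) (by positivity), ← Real.rpow_mul hM0.le,
    mul_one_div_cancel hξ.ne', Real.rpow_one]
  gcongr
  have h2 : 1 ≤ 1 / t.ξ := by rw [le_div_iff₀ hξ]; linarith [ht.ξ_lt]
  simpa using Real.rpow_le_rpow_of_exponent_le hc h2

/-- The first epoch at which `α^j` reaches `k`. -/
theorem Admissible.exists_epoch (ht : t.Admissible) {k : ℝ} (hk : 1 ≤ k) :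
    ∃ j : ℕ, k ≤ t.α ^ j ∧ t.α ^ j ≤ t.α * k := by
  obtain ⟨j, h1, h2⟩ := exists_nat_pow_near hk ht.α_gt
  refine ⟨j + 1, h2.le, ?_⟩
  rw [pow_succ']
  exact mul_le_mul_of_nonneg_left h1 ht.α_pos.le

/-- Splits a large epoch index at the first epoch where `α^j` reaches `k`. -/
theorem Admissible.exists_split (ht : t.Admissible) {k c M : ℝ} (hk : 1 ≤ k) (hc : 1 ≤ c)
    (hM : 1 ≤ M) {T : ℕ} (hT : t.α * c * (k * M) ≤ t.α ^ T) :
    ∃ j i : ℕ, T = j + i ∧ k ≤ t.α ^ j ∧ c * M ≤ t.α ^ i := by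
  obtain ⟨j, h1, h2⟩ := ht.exists_epoch hk
  have hα := ht.α_pos
  have hcM : 1 ≤ c * M := one_le_mul_of_one_le_of_one_le hc hM
  have h3 : t.α ^ j ≤ t.α ^ T := by
    refine (h2.trans ?_).trans hT
    calc t.α * k = t.α * k * 1 := (mul_one _).symm
      _ ≤ t.α * k * (c * M) := by gcongr
      _ = _ := by ring
  have hjT : j ≤ T := (pow_le_pow_iff_right₀ ht.α_gt).1 h3
  refine ⟨j, T - j, by omega, h1, ?_⟩
  have h4 : t.α ^ T = t.α ^ j * t.α ^ (T - j) := by rw [← pow_add]; congr 1; omega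
  rw [h4] at hT
  have h5 : t.α * k * (c * M) ≤ t.α * k * t.α ^ (T - j) := by
    calc _ = t.α * c * (k * M) := by ring
      _ ≤ _ := hT
      _ ≤ _ := by gcongr
  exact le_of_mul_le_mul_left h5 (by positivity)

end Tuning

variable {E : Type u} [NormedAddCommGroup E] [InnerProductSpace ℝ E] [CompleteSpace E]
  [MeasurableSpace E] [BorelSpace E]
  {n : ℕ} {p : CompositeProblem E n} {G : E → ℝ}
  {L μ η : ℝ} {xs : E} {prox : E → E → E} {t : Tuning}
  {Ω : Type v} [MeasurableSpace Ω] {P : Measure Ω} [IsProbabilityMeasure P] {x₀ : Ω → E}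

set_option maxHeartbeats 800000 in
/-- The expected gap is at most `ε` as soon as `α^T` exceeds a multiple of the scale. -/
theorem expectedGap_le_of_scale (hp : p.Assumptions G L μ xs)
    (ht : t.Admissible) (hG : IsCHEF t.g t.CG G) (hbn : t.b ≤ n) (hηL : η * L = t.θ)
    (hfin : ∀ i, convexConj G (p.gradDev L xs i) ≠ ⊤)
    (hprox : p.IsProxMap t.b η prox) (hx₀ : p.IsInitial xs P x₀) {ε : ℝ} (hε : 0 < ε) {T : ℕ}
    (hT : t.cT * ((1 + Real.log n) *
      max 1 (scale t n L μ (p.Dx L xs P x₀) (p.DH G L xs) (p.DF xs P x₀) ε)) ≤ t.α ^ T) :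
    expectedGap t p prox xs P x₀ T ≤ ENNReal.ofReal ε := by
  set DH := p.DH G L xs with hDHdef
  set DF := p.DF xs P x₀ with hDFdef
  set Dx := p.Dx L xs P x₀ with hDxdef
  set l := 1 + Real.log n with hl
  set s := max 1 (scale t n L μ Dx DH DF ε) with hs
  have hL := hp.L_pos
  have hl1 : 1 ≤ l := by have := Real.log_natCast_nonneg n; linarith
  have hDH : 0 ≤ DH := p.DH_nonneg hG.zero hL xs
  have hDF : 0 ≤ DF := integral_nonneg_of_ae (by
    filter_upwards [hx₀.mem] with ω hω using hp.gap_nonneg hω)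
  have hDx : 0 ≤ Dx := mul_nonneg hL.le (integral_nonneg_of_ae (by
    filter_upwards [hx₀.mem] with ω hω using hp.bregman_nonneg hG.nonneg hp.mem hω))
  set D := max Dx (max DH DF) with hD
  have hxD : Dx ≤ D := le_max_left _ _
  have hHD : DH ≤ D := (le_max_left _ _).trans (le_max_right _ _)
  have hFD : DF ≤ D := (le_max_right _ _).trans (le_max_right _ _)
  have hD0 : 0 ≤ D := hDx.trans hxD
  have hα := ht.α_gt
  have hα0 := ht.α_pos
  have hm₀ := ht.m₀_gt
  have hPR := ht.PR_pos
  have hP := ht.one_le_P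
  have hR := ht.R_pos
  have hcT : 0 < t.cT := hα0.trans_le ht.α_le_cT
  have hs1 : 1 ≤ s := le_max_left _ _
  have ha : 0 < t.a := by linarith [ht.a_gt]
  have hu := ht.u_pos
  have hcH := ht.cH_pos
  have hcI := ht.cI_pos
  have hnum := ht.numerator_le hFD hxD hHD hD0 hl1
  -- The convex regime: the potential bound alone. It also settles `μ = 0`.
  have general : D / ε ≤ s → expectedGap t p prox xs P x₀ T ≤ ENNReal.ofReal ε := by
    intro hDs
    refine (expectedGap_le_potential hp ht hG hbn hηL hfin hprox hx₀ T).trans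
      (ENNReal.ofReal_le_ofReal ?_)
    rw [div_le_iff₀ (ht.m_pos T), t.m_natCast]
    refine hnum.trans ?_
    have h1 : t.R ≤ t.cT := by
      refine le_trans ?_ ht.PR_le_cT
      nlinarith
    have h2 : t.R * (l * (D / ε)) ≤ t.α ^ T := by
      refine le_trans ?_ hT
      gcongr
    calc t.m₀ * t.R * (l * D) = ε * (t.m₀ * (t.R * (l * (D / ε)))) := by field_simp
      _ ≤ _ := by gcongr
  by_cases hμ0 : μ = 0
  · refine general (le_trans (le_of_eq ?_) (le_max_right _ _))
    rw [scale, if_pos hμ0]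
  have hμ : 0 < μ := lt_of_le_of_ne hp.μ_nonneg (Ne.symm hμ0)
  set κ := L / μ with hκ
  have hκ1 : 1 ≤ κ := by rw [hκ, le_div_iff₀ hμ]; linarith [hp.μ_le]
  set κ' := t.α ^ t.Tn n + κ with hκ'
  have hTn : 0 < t.α ^ t.Tn n := Real.rpow_pos_of_pos hα0 _
  have hκ'1 : 1 ≤ κ' := by linarith
  have hscale : scale t n L μ Dx DH DF ε = min (D / ε)
      (min (κ * max ((Dx + DF) / (ε * κ)) 1 ^ t.ξ + DH / ε)
        (κ' * max (D / (ε * κ')) 1 ^ t.ξ)) := by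
    rw [scale, if_neg hμ0]
  have hs2 : scale t n L μ Dx DH DF ε ≤ s := le_max_right _ _
  have hc1 : 1 ≤ 1 + 4 * (t.P * t.R) := by linarith
  rw [hscale] at hs2
  rcases min_le_iff.1 hs2 with h | h
  · exact general h
  rcases min_le_iff.1 h with h | h
  · set M := max ((Dx + DF) / (ε * κ)) 1 with hM
    have hM1 : 1 ≤ M := le_max_right _ _
    have hMξ : 1 ≤ M ^ t.ξ := Real.one_le_rpow hM1 ht.ξ_pos.le
    have hDHε : 0 ≤ DH / ε := by positivity
    obtain ⟨j, i, rfl, hj, hi⟩ := ht.exists_split hκ1 hc1 hMξ (T := T) (by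
      refine le_trans ?_ hT
      rw [← Tuning.cT]
      refine mul_le_mul_of_nonneg_left ?_ hcT.le
      calc κ * M ^ t.ξ ≤ 1 * s := by linarith
        _ ≤ l * s := by gcongr)
    have hai := ht.inv_a_pow_le hc1 hi
    rw [← hM] at hai
    refine (expectedGap_le_contract hp hμ ht hG hbn hηL hfin hprox hx₀ hj i
      (ht.sum_ind_le ⟨hG.g_mono, hG.g_pos⟩ j i)).trans (ENNReal.ofReal_le_ofReal ?_)
    have hmji : t.m (j + i : ℕ) = t.m j * t.α ^ i := by
      rw [t.m_natCast, t.m_natCast, pow_add, mul_assoc]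
    have hmj := ht.m_pos j
    have hmT := ht.m_pos (j + i)
    -- Noise of truncated epochs before `j` contracts by `a⁻¹` per epoch, hence is no larger than
    -- the bound for the noise after `j`.
    have hainv : (t.a⁻¹) ^ i / t.m j ≤ 1 / t.m (j + i : ℕ) := by
      rw [hmji, div_le_div_iff₀ hmj (by positivity), one_mul]
      have : (t.a⁻¹) ^ i * t.α ^ i ≤ 1 := by
        rw [← mul_pow]
        refine pow_le_one₀ (by positivity) ?_
        rw [inv_mul_eq_div, div_le_one ha]
        exact ht.α_le_a
      calc (t.a⁻¹) ^ i * (t.m j * t.α ^ i) = t.m j * ((t.a⁻¹) ^ i * t.α ^ i) := by ring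
        _ ≤ t.m j * 1 := by gcongr
        _ = _ := mul_one _
    -- The initial error at epoch `j` is at most `R ε κ M / κ`; the contraction divides it by `(1 +
    -- 4PR) M`. With the two noise terms below, the total is at most `3ε/4`.
    have hfirst : t.P * ((t.a⁻¹) ^ i * ((t.m₀ * DF + t.u * Dx) / t.m j)) ≤ ε / 4 := by
      have h1 : t.m₀ * κ ≤ t.m j := by rw [t.m_natCast]; gcongr
      have h2 : t.m₀ * DF + t.u * Dx ≤ t.m₀ * t.R * (Dx + DF) := by
        have h3 := mul_le_mul_of_nonneg_right ht.m₀_add_u_le (by positivity : 0 ≤ Dx + DF)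
        have h4 : 0 ≤ t.m₀ * Dx + t.u * DF := by positivity
        linarith
      have h3 : (Dx + DF) ≤ ε * κ * M := by
        have h4 : (Dx + DF) / (ε * κ) ≤ M := le_max_left _ _
        rw [div_le_iff₀ (by positivity)] at h4
        linarith
      calc t.P * ((t.a⁻¹) ^ i * ((t.m₀ * DF + t.u * Dx) / t.m j))
          ≤ t.P * (((1 + 4 * (t.P * t.R)) * M)⁻¹ *
            (t.m₀ * t.R * (ε * κ * M) / (t.m₀ * κ))) := by
            gcongr
            exact h2.trans (by gcongr)
        _ = ε * (t.P * t.R / (1 + 4 * (t.P * t.R))) := by field_simp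
        _ ≤ ε * (1 / 4) := by
            refine mul_le_mul_of_nonneg_left ?_ hε.le
            rw [div_le_div_iff₀ (by positivity) (by norm_num)]
            linarith
        _ = _ := by ring
    have hsecond : t.P * (t.cH * DH * (t.cI * l) / t.m (j + i : ℕ)) ≤ ε / 4 := by
      have h1 : 4 * (t.P * t.R) * (l * (DH / ε)) ≤ t.α ^ (j + i) := by
        refine le_trans ?_ hT
        have h2 := ht.PR_le_cT
        have h3 : 0 ≤ κ * M ^ t.ξ := by positivity
        gcongr
        linarith
      have h4 : t.cH * DH * (t.cI * l) ≤ t.m₀ * t.R * (l * DH) := by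
        have := mul_le_mul_of_nonneg_right ht.cH_mul_cI_le (by positivity : 0 ≤ l * DH)
        linarith
      rw [mul_div_assoc', div_le_iff₀ hmT, t.m_natCast]
      calc t.P * (t.cH * DH * (t.cI * l)) ≤ t.P * (t.m₀ * t.R * (l * DH)) := by gcongr
        _ = ε / 4 * (t.m₀ * (4 * (t.P * t.R) * (l * (DH / ε)))) := by field_simp
        _ ≤ _ := by gcongr
    have hX : 0 ≤ t.cH * DH * (t.cI * l) := by positivity
    have hthird : t.P * ((t.a⁻¹) ^ i * (t.cH * DH * (t.cI * l) / t.m j))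
        ≤ t.P * (t.cH * DH * (t.cI * l) / t.m (j + i : ℕ)) := by
      have h1 := mul_le_mul_of_nonneg_right hainv hX
      have h2 : (t.a⁻¹) ^ i * (t.cH * DH * (t.cI * l) / t.m j)
          = (t.a⁻¹) ^ i / t.m j * (t.cH * DH * (t.cI * l)) := by ring
      rw [h2]
      gcongr
      exact h1.trans_eq (by ring)
    rw [add_div, mul_add, mul_add, mul_add]
    linarith
  · set M := max (D / (ε * κ')) 1 with hM
    have hM1 : 1 ≤ M := le_max_right _ _
    have hMξ : 1 ≤ M ^ t.ξ := Real.one_le_rpow hM1 ht.ξ_pos.le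
    -- The logarithm is put into the second factor, so that the contraction after `j` also removes
    -- the factor `l` from the noise accumulated before `j`.
    obtain ⟨j, i, rfl, hj, hi⟩ := ht.exists_split hκ'1 hc1
      (one_le_mul_of_one_le_of_one_le hl1 hMξ) (T := T) (by
      refine le_trans ?_ hT
      rw [← Tuning.cT]
      refine mul_le_mul_of_nonneg_left ?_ hcT.le
      calc κ' * (l * M ^ t.ξ) = l * (κ' * M ^ t.ξ) := by ring
        _ ≤ l * s := by gcongr)
    rw [← mul_assoc] at hi
    have hai := ht.inv_a_pow_le (one_le_mul_of_one_le_of_one_le hc1 hl1) hi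
    rw [← hM] at hai
    have hκj : κ ≤ t.α ^ j := by linarith
    -- Since `κ > 0`, the bound `α ^ j ≥ κ'` exceeds `α^{T_n*}` strictly, so all later epochs use
    -- the full batch.
    have hind : ∑ q ∈ Finset.range i, t.ind n (j + q + 1) ≤ 0 := by
      refine (Finset.sum_eq_zero fun q _ => ?_).le
      refine ht.ind_eq_zero ⟨hG.g_mono, hG.g_pos⟩ ?_
      have : t.α ^ j ≤ t.α ^ (j + q + 1) := pow_le_pow_right₀ hα.le (by omega)
      linarith
    refine (expectedGap_le_contract hp hμ ht hG hbn hηL hfin hprox hx₀ hκj i hind).trans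
      (ENNReal.ofReal_le_ofReal ?_)
    rw [mul_zero, zero_div, add_zero]
    have hmj := ht.m_pos j
    have h1 : t.m₀ * κ' ≤ t.m j := by rw [t.m_natCast]; gcongr
    have h3 : D ≤ ε * κ' * M := by
      have h4 : D / (ε * κ') ≤ M := le_max_left _ _
      rw [div_le_iff₀ (by positivity)] at h4
      linarith
    calc t.P * ((t.a⁻¹) ^ i * ((t.m₀ * DF + t.u * Dx + t.cH * DH * (t.cI * l)) / t.m j))
        ≤ t.P * (((1 + 4 * (t.P * t.R)) * l * M)⁻¹ *
          (t.m₀ * t.R * (l * (ε * κ' * M)) / (t.m₀ * κ'))) := by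
          gcongr
          exact hnum.trans (by gcongr)
      _ = ε * (t.P * t.R / (1 + 4 * (t.P * t.R))) := by field_simp
      _ ≤ ε * 1 := by
          refine mul_le_mul_of_nonneg_left ?_ hε.le
          rw [div_le_one (by positivity)]
          linarith
      _ = ε := mul_one ε

end Accuracy

/-! ### The complexity -/

section Complexity

namespace Tuning

variable {t : Tuning}

/-- The constant in front of the sum of the inner loop sizes. -/
noncomputable def cM (t : Tuning) : ℝ := t.α / (t.α - 1)

/-- The constant of the bound that uses the untruncated batch sizes. -/
noncomputable def cRaw (t : Tuning) : ℝ :=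
  t.g 1 * (t.cM + 1 / Real.log t.α) + 5 * t.a / 2 * t.g₀ * t.cM

/-- The constant of the complexity bound. -/
noncomputable def K (t : Tuning) : ℝ :=
  max (t.m₀ * (t.α * t.cT)) (max t.cRaw (t.cM + 1 / Real.log t.α))

theorem Admissible.K_pos (ht : t.Admissible) : 0 < t.K := by
  have h1 := ht.m₀_gt
  have h2 := ht.α_pos
  have h3 := h2.trans_le ht.α_le_cT
  exact lt_max_of_lt_left (by positivity)

theorem Admissible.sum_m_le (ht : t.Admissible) (T : ℕ) :
    ∑ j ∈ Finset.range T, t.m (j + 1 : ℕ) ≤ t.cM * t.m T := by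
  have hα : t.α - 1 ≠ 0 := by linarith [ht.α_gt]
  have hα' : 0 < t.α - 1 := by linarith [ht.α_gt]
  have h0 := ht.α_pos
  have hm := ht.m₀_gt
  simp only [t.m_natCast, pow_succ', ← Finset.mul_sum]
  rw [geom_sum_eq (by linarith [ht.α_gt]), cM]
  have : t.m₀ * (t.α * ((t.α ^ T - 1) / (t.α - 1)))
      = t.α / (t.α - 1) * (t.m₀ * (t.α ^ T - 1)) := by ring
  rw [this]
  gcongr
  linarith

/-- The cost of the first `T` epochs, in terms of a bound for `m_T`. -/
theorem Admissible.cost_le (ht : t.Admissible) (hg : t.Regular) (n : ℕ) {T : ℕ} {A : ℝ}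
    (hA1 : 1 ≤ A) (hA : t.m T ≤ A) :
    ∑ j ∈ Finset.range T, (t.m (j + 1 : ℕ) + t.B n (j + 1))
      ≤ t.K * min (A / t.g (1 / A)) (A + n * Real.log A) := by
  have hα := ht.α_pos
  have hlogα := Real.log_pos ht.α_gt
  have hA0 : 0 < A := by linarith
  have hm₀ := ht.m₀_gt
  have hcM : 0 < t.cM := div_pos hα (by linarith [ht.α_gt])
  have hlogA : 0 ≤ Real.log A := Real.log_nonneg hA1
  have hgA := hg.g_pos (1 / A) (by positivity)
  have hg1 := hg.g_pos 1 one_pos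
  have hgA1 : t.g (1 / A) ≤ t.g 1 := hg.g_mono (Set.mem_Ici.2 (by positivity))
    (Set.mem_Ici.2 zero_le_one) (by rw [div_le_one hA0]; exact hA1)
  have hg₀ := ht.g₀_pos hg
  have ha : 0 < t.a := by linarith [ht.a_gt]
  -- As `m₀ > 1`, the bound `m_T ≤ A` forces `α ^ T ≤ A`.
  have hT : (T : ℝ) ≤ 1 / Real.log t.α * Real.log A := by
    have h1 : t.α ^ T ≤ A := by
      rw [t.m_natCast] at hA
      have := pow_pos hα T
      nlinarith
    have h2 := Real.log_le_log (pow_pos hα T) h1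
    rw [Real.log_pow] at h2
    rw [one_div_mul_eq_div, le_div_iff₀ hlogα]
    exact h2
  have hsum : ∑ j ∈ Finset.range T, t.m (j + 1 : ℕ) ≤ t.cM * A :=
    (ht.sum_m_le T).trans (by gcongr)
  rw [Finset.sum_add_distrib]
  rcases min_choice (A / t.g (1 / A)) (A + n * Real.log A) with h | h <;> rw [h]
  · have hB : ∀ j ∈ Finset.range T, (t.B n (j + 1) : ℝ)
        ≤ 5 * t.a / 2 * t.g₀ / t.g (1 / A) * t.m (j + 1 : ℕ) + 1 := by
      intro j hj
      have hmj := ht.m_pos (j + 1)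
      have hmA : t.m (j + 1 : ℕ) ≤ A := by
        refine le_trans (ht.m_mono ?_) hA
        exact_mod_cast Finset.mem_range.1 hj
      have hgj : t.g (1 / A) ≤ t.g (1 / t.m (j + 1 : ℕ)) :=
        hg.g_mono (Set.mem_Ici.2 (by positivity)) (Set.mem_Ici.2 (by positivity))
          (one_div_le_one_div_of_le hmj hmA)
      calc (t.B n (j + 1) : ℝ) ≤ (⌈t.rawBatch (j + 1 : ℕ)⌉₊ : ℝ) := by
            exact_mod_cast min_le_left _ _
        _ ≤ t.rawBatch (j + 1 : ℕ) + 1 := (Nat.ceil_lt_add_one (ht.rawBatch_pos hg _).le).le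
        _ ≤ 5 * t.a / 2 * t.g₀ * (t.m (j + 1 : ℕ) / t.g (1 / A)) + 1 := by
            rw [rawBatch, ← a]
            gcongr
        _ = _ := by ring
    have h1 := Finset.sum_le_sum hB
    rw [Finset.sum_add_distrib, ← Finset.mul_sum] at h1
    simp only [Finset.sum_const, Finset.card_range, nsmul_eq_mul, mul_one] at h1
    have h2 : (T : ℝ) ≤ 1 / Real.log t.α * A :=
      hT.trans (by gcongr; linarith [Real.log_le_sub_one_of_pos hA0])
    -- Absorbs the linear terms, namely the inner loops and the rounding of the batch sizes, since
    -- `g(1/A) ≤ g(1)`.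
    have h3 : A ≤ t.g 1 * (A / t.g (1 / A)) := by
      rw [mul_div_assoc', le_div_iff₀ hgA, mul_comm]
      gcongr
    calc _ ≤ t.cM * A + (5 * t.a / 2 * t.g₀ / t.g (1 / A) * (t.cM * A)
            + 1 / Real.log t.α * A) := by
          refine add_le_add hsum (h1.trans (add_le_add ?_ h2))
          gcongr
      _ = (t.cM + 1 / Real.log t.α) * A + 5 * t.a / 2 * t.g₀ * t.cM * (A / t.g (1 / A)) := by ring
      _ ≤ (t.cM + 1 / Real.log t.α) * (t.g 1 * (A / t.g (1 / A)))
            + 5 * t.a / 2 * t.g₀ * t.cM * (A / t.g (1 / A)) := by gcongr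
      _ = t.cRaw * (A / t.g (1 / A)) := by rw [cRaw]; ring
      _ ≤ _ := by
          gcongr
          exact (le_max_left _ _).trans (le_max_right _ _)
  · have hB : ∑ j ∈ Finset.range T, (t.B n (j + 1) : ℝ) ≤ n * T := by
      calc _ ≤ ∑ _j ∈ Finset.range T, (n : ℝ) :=
            Finset.sum_le_sum fun j _ => by exact_mod_cast min_le_right _ _
        _ = n * T := by simp [mul_comm]
    calc _ ≤ t.cM * A + n * (1 / Real.log t.α * Real.log A) :=
          add_le_add hsum (hB.trans (by gcongr))
      _ ≤ (t.cM + 1 / Real.log t.α) * (A + n * Real.log A) := by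
          have h1 : 0 ≤ 1 / Real.log t.α * A := by positivity
          have h2 : 0 ≤ t.cM * (n * Real.log A) := by positivity
          linarith
      _ ≤ _ := by
          gcongr
          exact (le_max_right _ _).trans (le_max_right _ _)

end Tuning

variable {E : Type u} [NormedAddCommGroup E] [InnerProductSpace ℝ E] [CompleteSpace E]
  {n : ℕ} {p : CompositeProblem E n} {G : E → ℝ}
  {L μ η : ℝ} {xs : E} {prox : E → E → E} {t : Tuning}
  {Ω : Type v} [MeasurableSpace Ω] {P : Measure Ω} [IsProbabilityMeasure P] {x₀ : Ω → E}

/-- The complexity of mirror-proximal SCSG. -/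
theorem complexity [MeasurableSpace E] [BorelSpace E] (hp : p.Assumptions G L μ xs)
    (ht : t.Admissible) (hG : IsCHEF t.g t.CG G) (hbn : t.b ≤ n) (hηL : η * L = t.θ)
    (hfin : ∀ i, convexConj G (p.gradDev L xs i) ≠ ⊤)
    (hprox : p.IsProxMap t.b η prox) (hx₀ : p.IsInitial xs P x₀) {ε : ℝ} (hε : 0 < ε) :
    (accurateTimes t p prox xs P x₀ ε).Nonempty ∧
      expectedCost t p prox xs P x₀ ε ≤ ENNReal.ofReal (t.K *
        min (A t t.K p G L μ xs P x₀ ε / t.g (1 / A t t.K p G L μ xs P x₀ ε))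
          (A t t.K p G L μ xs P x₀ ε + n * Real.log (A t t.K p G L μ xs P x₀ ε))) := by
  set S := (1 + Real.log n) *
    max 1 (scale t n L μ (p.Dx L xs P x₀) (p.DH G L xs) (p.DF xs P x₀) ε) with hS
  have hA : A t t.K p G L μ xs P x₀ ε = t.K * S := by rw [A, hS]; ring
  have hα := ht.α_gt
  have hα0 := ht.α_pos
  have hm₀ := ht.m₀_gt
  have hcT : 1 ≤ t.cT := hα.le.trans ht.α_le_cT
  have hS1 : 1 ≤ S := one_le_mul_of_one_le_of_one_le
    (by linarith [Real.log_natCast_nonneg n]) (le_max_left _ _)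
  obtain ⟨T, hT1, hT2⟩ := ht.exists_epoch (one_le_mul_of_one_le_of_one_le hcT hS1)
  have hmem : T ∈ accurateTimes t p prox xs P x₀ ε := fun T' hT' =>
    expectedGap_le_of_scale hp ht hG hbn hηL hfin hprox hx₀ hε
      (hT1.trans (pow_le_pow_right₀ hα.le hT'))
  refine ⟨⟨T, hmem⟩, ?_⟩
  have hinf : sInf (accurateTimes t p prox xs P x₀ ε) ≤ T := Nat.sInf_le hmem
  set T₀ := sInf (accurateTimes t p prox xs P x₀ ε) with hT₀
  -- The constant `K` contains `m₀ α c_T` for this purpose; the factor `α` comes from rounding up to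
  -- an integer epoch.
  have hmA : t.m T₀ ≤ t.K * S := by
    calc t.m T₀ ≤ t.m T := ht.m_mono (by exact_mod_cast hinf)
      _ = t.m₀ * t.α ^ T := t.m_natCast T
      _ ≤ t.m₀ * (t.α * (t.cT * S)) := by gcongr
      _ = t.m₀ * (t.α * t.cT) * S := by ring
      _ ≤ t.K * S := by
          gcongr
          exact le_max_left _ _
  have hA1 : 1 ≤ t.K * S := by
    have := ht.m_ge (Nat.cast_nonneg T₀)
    linarith
  rw [expectedCost, ← hT₀, hA]
  -- The stopping time is deterministic and the expected cost does not depend on the starting point,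
  -- so the outer integral is that of a constant.
  simp only [expect_cost_run ht]
  rw [lintegral_const, measure_univ, mul_one]
  exact ENNReal.ofReal_le_ofReal (ht.cost_le ⟨hG.g_mono, hG.g_pos⟩ n hA1 hmA)

/-- Powers of seminorms are CHEFs. -/
theorem isCHEF_seminorm_rpow {E : Type u} [NormedAddCommGroup E] [InnerProductSpace ℝ E]
    [MeasurableSpace E] {G : E → ℝ} {g : ℝ → ℝ} {CG q : ℝ} (hq : 1 < q)
    (hg : ∀ s : ℝ, 0 ≤ s → g s = s ^ (q - 1)) (N : Seminorm ℝ E)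
    (hG : ∀ x, G x = 1 / q * N x ^ q) (hN : GeneralizedNemirovsky CG G) : IsCHEF g CG G where
  g_nonneg s hs := by rw [hg s hs]; positivity
  g_mono s hs r hr hsr := by
    rw [hg s hs, hg r hr]
    exact Real.rpow_le_rpow hs hsr (by linarith)
  g_pos s hs := by rw [hg s hs.le]; positivity
  nonneg x := by rw [hG]; have := apply_nonneg N x; positivity
  zero := by rw [hG, map_zero, Real.zero_rpow (by linarith), mul_zero]
  convex := by
    have hq0 : 0 < q := by linarith
    refine ⟨convex_univ, fun x _ y _ a b ha hb hab => ?_⟩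
    simp only [hG, smul_eq_mul]
    have h1 : N (a • x + b • y) ≤ a * N x + b * N y := by
      refine (map_add_le_add N _ _).trans_eq ?_
      rw [map_smul_eq_mul, map_smul_eq_mul, Real.norm_of_nonneg ha, Real.norm_of_nonneg hb]
    have h2 : N (a • x + b • y) ^ q ≤ (a * N x + b * N y) ^ q :=
      Real.rpow_le_rpow (apply_nonneg N _) h1 hq0.le
    have h3 : (a * N x + b * N y) ^ q ≤ a * N x ^ q + b * N y ^ q := by
      simpa using (convexOn_rpow hq.le).2 (Set.mem_Ici.2 (apply_nonneg N x))
        (Set.mem_Ici.2 (apply_nonneg N y)) ha hb hab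
    calc 1 / q * N (a • x + b • y) ^ q ≤ 1 / q * (a * N x ^ q + b * N y ^ q) := by
          gcongr; exact h2.trans h3
      _ = _ := by ring
  symm x := by rw [hG, hG, map_neg_eq_map]
  sup_homogeneous x r hr := by
    rw [hG, hG, hg r hr.le, map_smul_eq_mul, Real.norm_of_nonneg hr.le,
      Real.mul_rpow hr.le (apply_nonneg N x), Real.rpow_sub_one hr.ne']
    apply le_of_eq
    field_simp
  nemirovsky := hN

end Complexity

end MirrorSCSG

theorem mainTheorem4 (t : Tuning) (ht : t.Admissible) :
    (∃ K : ℝ, 0 < K ∧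
      ∀ (E : Type u) [NormedAddCommGroup E] [InnerProductSpace ℝ E] [CompleteSpace E]
        [MeasurableSpace E] [BorelSpace E] (n : ℕ) (p : CompositeProblem E n) (G : E → ℝ)
        (L μ η : ℝ) (xs : E) (prox : E → E → E) (Ω : Type v) [MeasurableSpace Ω]
        (P : Measure Ω) [IsProbabilityMeasure P] (x₀ : Ω → E),
        t.b ≤ n → η * L = t.θ → IsCHEF t.g t.CG G → p.Assumptions G L μ xs →
        (∀ i, convexConj G (p.gradDev L xs i) ≠ ⊤) →
        p.IsProxMap t.b η prox → p.IsInitial xs P x₀ →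
        ∀ ε : ℝ, 0 < ε →
          (accurateTimes t p prox xs P x₀ ε).Nonempty ∧
          expectedCost t p prox xs P x₀ ε ≤ ENNReal.ofReal (K *
            min (A t K p G L μ xs P x₀ ε / t.g (1 / A t K p G L μ xs P x₀ ε))
              (A t K p G L μ xs P x₀ ε + n * Real.log (A t K p G L μ xs P x₀ ε)))) ∧
    (∀ q : ℝ, 1 < q → (∀ s : ℝ, 0 ≤ s → t.g s = s ^ (q - 1)) →
      ∃ K : ℝ, 0 < K ∧
      ∀ (E : Type u) [NormedAddCommGroup E] [InnerProductSpace ℝ E] [CompleteSpace E]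
        [MeasurableSpace E] [BorelSpace E] (n : ℕ) (p : CompositeProblem E n)
        (N : Seminorm ℝ E) (G : E → ℝ)
        (L μ η : ℝ) (xs : E) (prox : E → E → E) (Ω : Type v) [MeasurableSpace Ω]
        (P : Measure Ω) [IsProbabilityMeasure P] (x₀ : Ω → E),
        t.b ≤ n → η * L = t.θ → (∀ x, G x = 1 / q * N x ^ q) →
        GeneralizedNemirovsky t.CG G → p.Assumptions G L μ xs →
        (∀ i, convexConj G (p.gradDev L xs i) ≠ ⊤) →
        p.IsProxMap t.b η prox → p.IsInitial xs P x₀ →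
        ∀ ε : ℝ, 0 < ε →
          (accurateTimes t p prox xs P x₀ ε).Nonempty ∧
          expectedCost t p prox xs P x₀ ε ≤ ENNReal.ofReal (K *
            min (A t K p G L μ xs P x₀ ε ^ q)
              (A t K p G L μ xs P x₀ ε + n * Real.log (A t K p G L μ xs P x₀ ε)))) := by
  refine ⟨⟨t.K, ht.K_pos, ?_⟩, fun q hq hg => ⟨t.K, ht.K_pos, ?_⟩⟩
  · intro E _ _ _ _ _ n p G L μ η xs prox Ω _ P _ x₀ hbn hηL hG hp hfin hprox hx₀ ε hε
    exact complexity hp ht hG hbn hηL hfin hprox hx₀ hε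
  · intro E _ _ _ _ _ n p N G L μ η xs prox Ω _ P _ x₀ hbn hηL hGN hNem hp hfin hprox hx₀ ε hε
    obtain ⟨h1, h2⟩ := complexity hp ht (isCHEF_seminorm_rpow hq hg N hGN hNem) hbn hηL hfin hprox
      hx₀ hε
    refine ⟨h1, ?_⟩
    set a := A t t.K p G L μ xs P x₀ ε with ha
    have ha0 : 0 < a := mul_pos (mul_pos ht.K_pos (by linarith [Real.log_natCast_nonneg n]))
      (lt_max_of_lt_left one_pos)
    have h3 : a / t.g (1 / a) = a ^ q := by
      rw [hg _ (by positivity), one_div, Real.inv_rpow ha0.le, Real.rpow_sub_one ha0.ne', inv_div]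
      field_simp
    rwa [h3] at h2
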